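/- A \emph{simplicial set with marking} is a simplicial set together with a set of marked simplices of positive dimension that contains all degenerate simplices; maps are the simplicial maps preserving marked simplices. Simplices $\Delta[m]$, their boundaries $\partial\Delta[m]$, and $\Delta[-1]=\emptyset$ have only degenerate simplices marked. Let $\Delta[3]_{eq}$ (resp. $\Delta[3]_\sharp$) be $\Delta[3]$ with marked non-degenerate simplices all $2$- and $3$-simplices and the edges $[02]$ and $[13]$ (resp. all simplices of positive dimension). In the join $X\star Y$, whose underlying simplicial set is the join of the underlying simplicial sets, a simplex $x\star y$ is marked if and only if $x$ is marked in $X$ or $y$ is marked in $Y$. The tensor $X\otimes Y$ has as underlying simplicial set the product, and a non-degenerate $r$-simplex $(x,y)$ is marked if and only if for all $p,q\ge 0$ with $p+q=r$ the restriction of $x$ to the vertices $0,\dots,p$ is marked in $X$ or the restriction of $y$ to the vertices $p,\dots,p+q$ is marked in $Y$. Let $\Delta^k[m]$ be $\Delta[m]$ in which a non-degenerate simplex (of positive dimension) is marked if and only if it contains the vertices $\{k-1,k,k+1\}\cap[m]$; let $\Lambda^k[m]$ be the $k$-horn with the marking restricted from $\Delta^k[m]$; let $\Delta^k[m]'$ be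 $\Delta^k[m]$ with the $(k-1)$-st and $(k+1)$-st faces (those that exist) marked in addition; and let $\Delta^k[m]''$ be $\Delta^k[m]'$ with the $k$-th face marked in addition. A \emph{saturated complicial set} is a simplicial set with marking that has the right lifting property with respect to the maps $\Lambda^k[m]\to\Delta^k[m]$ ($m\ge1$, $0\le k\le m$), the maps $\Delta^k[m]'\to\Delta^k[m]''$ ($m\ge2$, $0\le k\le m$), and the left saturation extensions $\Delta[\ell]\star\Delta[3]_{eq}\to\Delta[\ell]\star\Delta[3]_\sharp$ ($\ell\ge-1$). The \emph{$(\infty,\infty)$-acyclic cofibrations} are the acyclic cofibrations of the model structure on simplicial sets with marking whose cofibrations are the monomorphisms and whose fibrant objects are the saturated complicial sets. Explicitly, they are the monomorphisms $X\to Y$ that induce, for every saturated complicial set $Z$, a bijection from left homotopy classes of maps $Y\to Z$ to left homotopy classes of maps $X\to Z$. \textbf{Proposition.} For all $m\ge0$ and $\ell\ge-1$, the pushout-tensor $$(\Delta[\ell]\star\Delta[3]_\sharp\otimes\partial\Delta[m])\amalg_{\Delta[\ell]\star\Delta[3]_{eq}\otimes\partial\Delta[m]}(\Delta[\ell]\star\Delta[3]_{eq}\otimes\Delta[m])\longrightarrow\Delta[\ell]\star\Delta[3]_\sharp\otimes\Delta[m]$$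 of the left saturation extension $\Delta[\ell]\star\Delta[3]_{eq}\to\Delta[\ell]\star\Delta[3]_\sharp$ with the boundary inclusion $\partial\Delta[m]\to\Delta[m]$ is an $(\infty,\infty)$-acyclic cofibration. (Here $\star$ binds more strongly than $\otimes$.) -/

import Mathlib

open CategoryTheory Opposite MonoidalCategory CategoryTheory.Limits

universe u

section

open Simplicial

/-- A simplicial set with marking: a simplicial set with a set of marked simplices of positive
dimension that contains all degenerate simplices. -/
structure MSSet : Type (u + 1) where
  /-- the underlying simplicial set -/
  toSSet : SSet.{u}
  /-- the marked `n`-simplices -/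
  marked (n : ℕ) : Set (toSSet _⦋n⦌)
  marked_zero : marked 0 = ∅
  degenerate_subset (n : ℕ) : toSSet.degenerate n ⊆ marked n

end

namespace MSSet

section

open Simplicial

/-- Maps of simplicial sets with marking: simplicial maps that preserve the marking. -/
@[ext]
structure Hom (X Y : MSSet.{u}) : Type u where
  /-- the underlying simplicial map -/
  toSSetHom : X.toSSet ⟶ Y.toSSet
  map_marked (n : ℕ) (x : X.toSSet _⦋n⦌) (hx : x ∈ X.marked n) :
    toSSetHom.app (op ⦋n⦌) x ∈ Y.marked n

instance : Category.{u} MSSet.{u} where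
  Hom := Hom
  id X := ⟨𝟙 _, fun _ _ h => h⟩
  comp f g := ⟨f.toSSetHom ≫ g.toSSetHom,
    fun n x h => g.map_marked n _ (f.map_marked n x h)⟩

@[ext]
theorem hom_ext {X Y : MSSet.{u}} {f g : X ⟶ Y} (h : f.toSSetHom = g.toSSetHom) : f = g :=
  Hom.ext h

@[simp]
theorem id_toSSetHom (X : MSSet.{u}) : Hom.toSSetHom (𝟙 X) = 𝟙 X.toSSet := rfl

@[simp]
theorem comp_toSSetHom {X Y Z : MSSet.{u}} (f : X ⟶ Y) (g : Y ⟶ Z) :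
    Hom.toSSetHom (f ≫ g) = f.toSSetHom ≫ g.toSSetHom := rfl

theorem map_degenerate {X Y : SSet.{u}} (f : X ⟶ Y) {n : ℕ} {x : X _⦋n⦌}
    (hx : x ∈ X.degenerate n) : f.app (op ⦋n⦌) x ∈ Y.degenerate n := by
  obtain ⟨m, hm, φ, y, rfl⟩ := hx
  exact ⟨m, hm, φ, f.app (op ⦋m⦌) y, (NatTrans.naturality_apply f φ.op y).symm⟩

/-- The simplicial set `X` in which, besides the degenerate simplices, the positive-dimensional
simplices that belong to `S` are marked. -/
def ofMarking (X : SSet.{u}) (S : ∀ n : ℕ, Set (X _⦋n⦌)) : MSSet.{u} where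
  toSSet := X
  marked n := {x | x ∈ X.degenerate n ∨ 0 < n ∧ x ∈ S n}
  marked_zero := by
    ext x
    simp
  degenerate_subset _ _ h := Or.inl h

/-- A simplicial map that carries `S` into `T`, as a map of simplicial sets with marking. -/
def ofMarkingMap {X Y : SSet.{u}} {S : ∀ n : ℕ, Set (X _⦋n⦌)} {T : ∀ n : ℕ, Set (Y _⦋n⦌)}
    (f : X ⟶ Y) (h : ∀ (n : ℕ) (x : X _⦋n⦌), x ∈ S n → f.app (op ⦋n⦌) x ∈ T n) :
    ofMarking X S ⟶ ofMarking Y T where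
  toSSetHom := f
  map_marked n x hx := hx.imp (map_degenerate f) (fun hx => ⟨hx.1, h n x hx.2⟩)

/-- The map that is the identity of `X` on underlying simplicial sets, for `S ⊆ T`. -/
def entire {X : SSet.{u}} {S T : ∀ n : ℕ, Set (X _⦋n⦌)} (h : ∀ n, S n ⊆ T n) :
    ofMarking X S ⟶ ofMarking X T :=
  ofMarkingMap (𝟙 X) (fun n _ hx => h n hx)

/-- A simplicial set in which only the degenerate simplices are marked. -/
def minimal (X : SSet.{u}) : MSSet.{u} := ofMarking X (fun _ => ∅)

/-- A subcomplex of a simplicial set with marking, in which a simplex is marked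
if and only if it is marked in the ambient object. -/
def restrict (X : MSSet.{u}) (A : X.toSSet.Subcomplex) : MSSet.{u} where
  toSSet := A
  marked n := {x | x.1 ∈ X.marked n}
  marked_zero := by
    ext x
    simp [X.marked_zero]
  degenerate_subset n _ hx := X.degenerate_subset n (map_degenerate A.ι hx)

/-- The inclusion of a subcomplex with the restricted marking. -/
def restrictι (X : MSSet.{u}) (A : X.toSSet.Subcomplex) : X.restrict A ⟶ X where
  toSSetHom := A.ι
  map_marked _ _ hx := hx

/-! ### Simplices, boundaries, horns -/

/-- The boundary inclusion `∂Δ[m] ⟶ Δ[m]`; only degenerate simplices are marked. -/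
def boundaryInclusion (m : ℕ) : minimal (∂Δ[m] : SSet.{u}) ⟶ minimal Δ[m] :=
  ofMarkingMap (∂Δ[m]).ι (fun _ _ hx => hx.elim)

/-- The simplices of `Δ[m]` that contain the vertices `{k - 1, k, k + 1} ∩ [m]`. -/
def admissible (m : ℕ) (k : Fin (m + 1)) (n : ℕ) : Set ((Δ[m] : SSet.{u}) _⦋n⦌) :=
  {x | ∀ j : Fin (m + 1),
    ((j : ℕ) + 1 = k ∨ (j : ℕ) = k ∨ (j : ℕ) = k + 1) → j ∈ Set.range x}

/-- The simplices of `Δ[m]` whose set of vertices is `[m] ∖ {j}`. The only non-degenerate one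
is the `j`-th face of `Δ[m]`. -/
def faceSimplices (m : ℕ) (j : Fin (m + 1)) (n : ℕ) : Set ((Δ[m] : SSet.{u}) _⦋n⦌) :=
  {x | Set.range x = {j}ᶜ}

/-- The marking of `Δᵏ[m]'`. -/
def admissible' (m : ℕ) (k : Fin (m + 1)) (n : ℕ) : Set ((Δ[m] : SSet.{u}) _⦋n⦌) :=
  {x | x ∈ admissible m k n ∨
    ∃ j : Fin (m + 1), ((j : ℕ) + 1 = k ∨ (j : ℕ) = k + 1) ∧ x ∈ faceSimplices m j n}

/-- The marking of `Δᵏ[m]''`. -/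
def admissible'' (m : ℕ) (k : Fin (m + 1)) (n : ℕ) : Set ((Δ[m] : SSet.{u}) _⦋n⦌) :=
  {x | x ∈ admissible' m k n ∨ x ∈ faceSimplices m k n}

/-- The complicial horn extension `Λᵏ[m] ⟶ Δᵏ[m]`. -/
def hornExtension (m : ℕ) (k : Fin (m + 1)) :
    restrict (ofMarking (Δ[m] : SSet.{u}) (admissible m k)) Λ[m, k] ⟶
      ofMarking (Δ[m] : SSet.{u}) (admissible m k) :=
  restrictι _ _

/-- The complicial thinness extension `Δᵏ[m]' ⟶ Δᵏ[m]''`. -/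
def thinnessExtension (m : ℕ) (k : Fin (m + 1)) :
    ofMarking (Δ[m] : SSet.{u}) (admissible' m k) ⟶ ofMarking (Δ[m] : SSet.{u}) (admissible'' m k) :=
  entire (fun _ _ hx => Or.inl hx)

/-- The triviality extension `Δ[p] ⟶ Δ[p]ₜ`. The only non-degenerate `p`-simplex of `Δ[p]`
is the top one. -/
def trivialityExtension (p : ℕ) :
    minimal (Δ[p] : SSet.{u}) ⟶ ofMarking (Δ[p] : SSet.{u}) (fun n => {_x | n = p}) :=
  entire (fun _ _ hx => hx.elim)

/-! ### Joins -/

/-- For `χ : [n] → [1]`, the subcomplex of `Δ[n]` spanned by the vertices `i` with `χ i = ε`.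
It is a simplex, or empty. -/
def cutFiber {n : SimplexCategory} (χ : Fin (n.len + 1) →o Fin 2) (ε : Fin 2) :
    (SSet.stdSimplex.{u}.obj n).Subcomplex where
  obj _ := {s | ∀ i, χ ((SSet.stdSimplex.objEquiv s).toOrderHom i) = ε}
  map θ _ hs i := hs (θ.unop.toOrderHom i)

/-- The map between the subcomplexes `cutFiber` induced by `θ : [m] → [n]`. -/
def cutFiberMap {m n : SimplexCategory} (θ : m ⟶ n) (χ : Fin (n.len + 1) →o Fin 2) (ε : Fin 2) :
    (cutFiber.{u} (χ.comp θ.toOrderHom) ε : SSet.{u}) ⟶ (cutFiber.{u} χ ε : SSet.{u}) where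
  app k := ↾fun s => ⟨(SSet.stdSimplex.map θ).app k s.1, fun i => s.2 i⟩

theorem cutFiberMap_id {n : SimplexCategory} (χ : Fin (n.len + 1) →o Fin 2) (ε : Fin 2) :
    cutFiberMap.{u} (𝟙 n) χ ε = 𝟙 (cutFiber.{u} χ ε : SSet.{u}) := by
  ext k s
  have h : (SSet.stdSimplex.map (𝟙 n)).app k s.1 = s.1 := by
    rw [SSet.stdSimplex.{u}.map_id n]
    rfl
  exact Subtype.ext h

/-- An `n`-simplex `x ⋆ y` of the join of `X` and `Y`: a decomposition of `[n]` into an initial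
segment (where `cut` is `0`) and a final segment (where `cut` is `1`), either of which may be
empty, a simplex `x` of `X` on the initial segment and a simplex `y` of `Y` on the final one. -/
structure JoinSimplex (X Y : SSet.{u}) (n : SimplexCategory) : Type u where
  /-- the decomposition of `[n]` -/
  cut : Fin (n.len + 1) →o Fin 2
  /-- the simplex `x` -/
  left : (cutFiber.{u} cut 0 : SSet.{u}) ⟶ X
  /-- the simplex `y` -/
  right : (cutFiber.{u} cut 1 : SSet.{u}) ⟶ Y

/-- The join of simplicial sets. -/
def joinSSet (X Y : SSet.{u}) : SSet.{u} where
  obj n := JoinSimplex X Y n.unop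
  map θ := ↾fun σ =>
    { cut := σ.cut.comp θ.unop.toOrderHom
      left := cutFiberMap θ.unop σ.cut 0 ≫ σ.left
      right := cutFiberMap θ.unop σ.cut 1 ≫ σ.right }
  map_id n := by
    ext σ
    obtain ⟨χ, x, y⟩ := σ
    exact congrArg₂ (JoinSimplex.mk χ)
      ((congrArg (fun t => t ≫ x) (cutFiberMap_id χ 0)).trans (Category.id_comp x))
      ((congrArg (fun t => t ≫ y) (cutFiberMap_id χ 1)).trans (Category.id_comp y))
  map_comp θ θ' := by
    ext σ
    rfl

/-- A map from the subcomplex `cutFiber χ ε` to `X` is marked if it corresponds to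
a marked simplex of `X`, that is, if the subcomplex is not empty and the value at its top simplex
is marked. -/
def MarkedOnFiber (X : MSSet.{u}) {n : SimplexCategory} {χ : Fin (n.len + 1) →o Fin 2} {ε : Fin 2}
    (f : (cutFiber.{u} χ ε : SSet.{u}) ⟶ X.toSSet) : Prop :=
  ∃ (k : ℕ) (s : (cutFiber.{u} χ ε : SSet.{u}) _⦋k⦌),
    Function.Injective (SSet.stdSimplex.objEquiv s.1).toOrderHom ∧
    (∀ i, χ i = ε → i ∈ Set.range (SSet.stdSimplex.objEquiv s.1).toOrderHom) ∧
    f.app (op ⦋k⦌) s ∈ X.marked k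

/-- The condition that `x` is marked or `y` is marked, for a simplex `x ⋆ y` of the join. -/
def JoinSimplex.Marked {X Y : MSSet.{u}} {n : SimplexCategory}
    (σ : JoinSimplex X.toSSet Y.toSSet n) : Prop :=
  X.MarkedOnFiber σ.left ∨ Y.MarkedOnFiber σ.right

/-- The join of simplicial sets with marking: `x ⋆ y` is marked if and only if
`x` is marked or `y` is marked. -/
def join (X Y : MSSet.{u}) : MSSet.{u} :=
  ofMarking (joinSSet X.toSSet Y.toSSet)
    (fun n => {σ | JoinSimplex.Marked (X := X) (Y := Y) (n := ⦋n⦌) σ})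

/-- The join of two maps. -/
def joinMap {X X' Y Y' : MSSet.{u}} (f : X ⟶ X') (g : Y ⟶ Y') : join X Y ⟶ join X' Y' :=
  ofMarkingMap
    { app n := ↾fun (σ : JoinSimplex X.toSSet Y.toSSet n.unop) =>
        (⟨σ.cut, σ.left ≫ f.toSSetHom, σ.right ≫ g.toSSetHom⟩ :
          JoinSimplex X'.toSSet Y'.toSSet n.unop)
      naturality _ _ _ := rfl }
    (by
      rintro n σ (⟨k, s, h, h', hs⟩ | ⟨k, s, h, h', hs⟩)
      · exact Or.inl ⟨k, s, h, h', f.map_marked _ _ hs⟩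
      · exact Or.inr ⟨k, s, h, h', g.map_marked _ _ hs⟩)

/-- The marking of `Δ[3]_eq`: all simplices of dimension at least `2` and the edges
`[02]` and `[13]`. -/
def eqMarking (n : ℕ) : Set ((Δ[3] : SSet.{u}) _⦋n⦌) :=
  {x | 2 ≤ n ∨ Set.range x = {0, 2} ∨ Set.range x = {1, 3}}

/-- `Δ[3]_eq`. -/
def simplexThreeEq : MSSet.{u} := ofMarking Δ[3] eqMarking

/-- `Δ[3]_♯`, in which all simplices of positive dimension are marked. -/
def simplexThreeSharp : MSSet.{u} := ofMarking Δ[3] (fun _ => Set.univ)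

/-- The map `Δ[3]_eq ⟶ Δ[3]_♯` that is the identity on `Δ[3]`. -/
def eqToSharp : simplexThreeEq.{u} ⟶ simplexThreeSharp.{u} :=
  entire (fun _ _ _ => Set.mem_univ _)

end

/-- The simplex with `a` vertices in which only degenerate simplices are marked, that is,
`Δ[a - 1]`, where `Δ[-1]` is empty. -/
def simplexOnVertices : ℕ → MSSet.{u}
  | 0 => minimal ((Functor.const _).obj PEmpty)
  | n + 1 => minimal (SSet.stdSimplex.obj (SimplexCategory.mk n))

/-- The left saturation extension `Δ[ℓ] ⋆ Δ[3]_eq ⟶ Δ[ℓ] ⋆ Δ[3]_♯`, where `a = ℓ + 1`. -/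
def leftSaturationExtension (a : ℕ) :
    join (simplexOnVertices.{u} a) simplexThreeEq ⟶
      join (simplexOnVertices.{u} a) simplexThreeSharp :=
  joinMap (𝟙 _) eqToSharp

/-! ### Acyclic cofibrations -/

/-- The elementary `(∞, N)`-anodyne extensions. -/
inductive ElementaryAnodyne (N : ℕ∞) : MorphismProperty MSSet.{u}
  | horn (m : ℕ) (hm : 1 ≤ m) (k : Fin (m + 1)) : ElementaryAnodyne N (hornExtension m k)
  | thinness (m : ℕ) (hm : 2 ≤ m) (k : Fin (m + 1)) : ElementaryAnodyne N (thinnessExtension m k)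
  | saturation (a : ℕ) : ElementaryAnodyne N (leftSaturationExtension a)
  | triviality (p : ℕ) (hp : N < (p : ℕ∞)) : ElementaryAnodyne N (trivialityExtension p)

/-- `Z` is a saturated `N`-complicial set: every map from the domain of an elementary
`(∞, N)`-anodyne extension to `Z` extends to the codomain. -/
def IsSaturatedComplicial (N : ℕ∞) (Z : MSSet.{u}) : Prop :=
  ∀ ⦃I J : MSSet.{u}⦄ (i : I ⟶ J), ElementaryAnodyne N i →
    ∀ g : I ⟶ Z, ∃ h : J ⟶ Z, i ≫ h = g

/-- Two maps `f g : X ⟶ Z` are left homotopic if they are the two ends of a map `C ⟶ Z`, where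
`C` is a cylinder of `X` whose projection `C ⟶ X` is an acyclic fibration, that is, has the right
lifting property with respect to all cofibrations. The cofibrations are the monomorphisms. -/
def LeftHomotopic {X Z : MSSet.{u}} (f g : X ⟶ Z) : Prop :=
  ∃ P : HomotopicalAlgebra.Precylinder X,
    (MorphismProperty.monomorphisms MSSet.{u}).rlp P.π ∧
    ∃ h : P.I ⟶ Z, P.i₀ ≫ h = f ∧ P.i₁ ≫ h = g

/-- The weak equivalences of the model structure on simplicial sets with marking in which the
cofibrations are the monomorphisms and the fibrant objects are the saturated `N`-complicial sets:
the maps `X ⟶ Y` that induce bijections from homotopy classes of maps `Y ⟶ Z` to homotopy classes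
of maps `X ⟶ Z` for all saturated `N`-complicial sets `Z`. (All objects are cofibrant, so
a model structure with these cofibrations and fibrant objects has these weak equivalences.) -/
def WeakEquivalence (N : ℕ∞) : MorphismProperty MSSet.{u} := fun X Y w =>
  ∀ Z : MSSet.{u}, IsSaturatedComplicial N Z →
    (∀ g : X ⟶ Z, ∃ h : Y ⟶ Z, LeftHomotopic (w ≫ h) g) ∧
    (∀ h h' : Y ⟶ Z, LeftHomotopic (w ≫ h) (w ≫ h') → LeftHomotopic h h')

/-- The `(∞, N)`-acyclic cofibrations. -/
def AcyclicCofibration (N : ℕ∞) : MorphismProperty MSSet.{u} := fun _ _ w =>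
  Mono w ∧ WeakEquivalence N w

section

open Simplicial

/-! ### The tensor -/

/-- The tensor `X ⊗ Y`: the product of the underlying simplicial sets, in which a non-degenerate
`r`-simplex `(x, y)` is marked if and only if, for each partition `r = p + q`, the restriction of
`x` to the vertices `0, …, p` is marked in `X` or the restriction of `y` to the vertices
`p, …, p + q` is marked in `Y`. -/
def tensor (X Y : MSSet.{u}) : MSSet.{u} :=
  ofMarking (X.toSSet ⊗ Y.toSSet) (fun r => {z | ∀ (p q : ℕ) (hpq : p + q = r),
    X.toSSet.map (SimplexCategory.subinterval 0 p (by lia)).op z.1 ∈ X.marked p ∨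
    Y.toSSet.map (SimplexCategory.subinterval p q hpq.le).op z.2 ∈ Y.marked q})

/-- The tensor of two maps. -/
def tensorMap {X X' Y Y' : MSSet.{u}} (f : X ⟶ X') (g : Y ⟶ Y') : tensor X Y ⟶ tensor X' Y' :=
  ofMarkingMap (f.toSSetHom ⊗ₘ g.toSSetHom) (by
    intro r z hz p q hpq
    refine (hz p q hpq).imp (fun h => ?_) (fun h => ?_)
    · have := f.map_marked _ _ h
      rw [NatTrans.naturality_apply] at this
      exact this
    · have := g.map_marked _ _ h
      rw [NatTrans.naturality_apply] at this
      exact this)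

theorem tensorMap_comp {X X' X'' Y Y' Y'' : MSSet.{u}} (f : X ⟶ X') (f' : X' ⟶ X'')
    (g : Y ⟶ Y') (g' : Y' ⟶ Y'') :
    tensorMap f g ≫ tensorMap f' g' = tensorMap (f ≫ f') (g ≫ g') := rfl

/-! ### Pushouts -/

section Pushouts

variable {A X Y : MSSet.{u}} (f : A ⟶ X) (g : A ⟶ Y)

/-- The pushout of the underlying simplicial sets, in which the marked simplices are the degenerate
ones and the images of marked simplices. -/
noncomputable def pushoutObj : MSSet.{u} :=
  ofMarking (pushout f.toSSetHom g.toSSetHom) (fun n =>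
    ((pushout.inl f.toSSetHom g.toSSetHom).app (op ⦋n⦌)) '' X.marked n ∪
      ((pushout.inr f.toSSetHom g.toSSetHom).app (op ⦋n⦌)) '' Y.marked n)

theorem pos_of_mem_marked (X : MSSet.{u}) {n : ℕ} {x : X.toSSet _⦋n⦌} (hx : x ∈ X.marked n) :
    0 < n := by
  rcases n with _ | n
  · rw [X.marked_zero] at hx
    exact hx.elim
  · exact n.succ_pos

/-- The first inclusion. -/
noncomputable def pushoutInl : X ⟶ pushoutObj f g where
  toSSetHom := pushout.inl _ _
  map_marked _ x hx := Or.inr ⟨X.pos_of_mem_marked hx, Or.inl ⟨x, hx, rfl⟩⟩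

/-- The second inclusion. -/
noncomputable def pushoutInr : Y ⟶ pushoutObj f g where
  toSSetHom := pushout.inr _ _
  map_marked _ x hx := Or.inr ⟨Y.pos_of_mem_marked hx, Or.inr ⟨x, hx, rfl⟩⟩

theorem isPushout_pushoutObj : IsPushout f g (pushoutInl f g) (pushoutInr f g) where
  w := hom_ext pushout.condition
  isColimit' := ⟨PushoutCocone.IsColimit.mk _
    (fun s =>
      { toSSetHom := pushout.desc s.inl.toSSetHom s.inr.toSSetHom
          (congrArg Hom.toSSetHom s.condition)
        map_marked := by
          rintro n x (hx | ⟨-, ⟨y, hy, rfl⟩ | ⟨y, hy, rfl⟩⟩)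
          · exact s.pt.degenerate_subset n (map_degenerate _ hx)
          · have := s.inl.map_marked n y hy
            rw [← pushout.inl_desc s.inl.toSSetHom s.inr.toSSetHom
              (congrArg Hom.toSSetHom s.condition)] at this
            exact this
          · have := s.inr.map_marked n y hy
            rw [← pushout.inr_desc s.inl.toSSetHom s.inr.toSSetHom
              (congrArg Hom.toSSetHom s.condition)] at this
            exact this })
    (fun s => hom_ext (pushout.inl_desc _ _ _))
    (fun s => hom_ext (pushout.inr_desc _ _ _))
    (fun s m h₁ h₂ => hom_ext (pushout.hom_ext
      ((congrArg Hom.toSSetHom h₁).trans (pushout.inl_desc _ _ _).symm)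
      ((congrArg Hom.toSSetHom h₂).trans (pushout.inr_desc _ _ _).symm)))⟩

end Pushouts

end

instance : HasPushouts MSSet.{u} :=
  by
  have : ∀ {A X Y : MSSet.{u}} {f : A ⟶ X} {g : A ⟶ Y}, HasColimit (span f g) :=
    fun {_ _ _ f g} => (isPushout_pushoutObj f g).hasPushout
  exact hasPushouts_of_hasColimit_span MSSet.{u}

/-- The pushout-tensor `(J ⊗ A) ⨿_{I ⊗ A} (I ⊗ B) ⟶ J ⊗ B` of `i : I ⟶ J` and `b : A ⟶ B`. -/
noncomputable def pushoutTensor {I J A B : MSSet.{u}} (i : I ⟶ J) (b : A ⟶ B) :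
    pushout (tensorMap i (𝟙 A)) (tensorMap (𝟙 I) b) ⟶ tensor J B :=
  pushout.desc (tensorMap (𝟙 J) b) (tensorMap i (𝟙 B)) rfl

end MSSet

/-! The pushout-tensor is an isomorphism of underlying simplicial sets; only markings change. Such a
map is an acyclic cofibration as soon as every map from its domain to a saturated complicial set `Z`
extends along it, that is, already preserves the larger marking
(`acyclicCofibration_of_exists_extension`). The summand `Δ[ℓ] ⋆ Δ[3]_eq ⊗ Δ[m]` of the pushout
carries the whole underlying simplicial set, so it suffices that maps from this tensor to `Z`
preserve the marking of `Δ[ℓ] ⋆ Δ[3]_♯ ⊗ Δ[m]` (`exists_extension_tensor`).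

Let `(ξ, y)` be a simplex that is marked only in the larger marking. Then for some `p` the
restriction of `ξ` to `0, …, p` has exactly its last two vertices in `Δ[3]`, and comparison with the
partition at `p - 1` shows that `y` agrees on these two vertices. If all later vertices lie over the
last vertex of `Δ[3]`, this edge can be blown up to a full `3`-simplex on which `y` is constant, and
saturation of `Z` applies to it. In general the later vertices are pushed to the last vertex one at
a time by thinness (`image_mem_marked`).

The saturation needed here is two-sided: the `3`-simplex has vertices in front of it and behind it
(`SaturatedAt`), whereas the given lifting property allows vertices only in front. The two-sided
form is proved by induction on the number of vertices behind. To compare the `3`-simplex on `a, …, a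
+ 3` with the one on `a + 1, …, a + 4`, the vertices `a + 3`, `a + 2`, `a + 1` are moved one by one
to the place just before `a + 4`. Moving `p` means inserting, by horn filling, a vertex that is a
copy of `a + 4` away from `a, …, p - 1`, but which these vertices reach through `p`
(`exists_insert`); it then takes over the role of `p`. After three moves the moved vertices stand in
reverse order between `a` and `a + 4`, and the induction hypothesis applies to `a + 1, …, a + 4`.
`EqP` records the marked faces at each stage, `mk_of_eqP'` carries the hypothesis through a move and
`mk_of_twoIn` carries the conclusion back. -/

namespace MSSet

open Simplicial

/-! ### Vertices of simplices of a standard simplex -/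

/-- The `i`-th vertex of a morphism `⦋k⦌ ⟶ ⦋n⦌`, as a natural number. -/
def vtx {k n : ℕ} (x : ⦋k⦌ ⟶ ⦋n⦌) (i : Fin (k + 1)) : ℕ :=
  (x.toOrderHom i : Fin (n + 1)).val

/-- The set of vertices of a morphism `⦋k⦌ ⟶ ⦋n⦌`. -/
def vset {k n : ℕ} (x : ⦋k⦌ ⟶ ⦋n⦌) : Set ℕ := Set.range (vtx x)

theorem vtx_mem {k n : ℕ} (x : ⦋k⦌ ⟶ ⦋n⦌) (i : Fin (k + 1)) : vtx x i ∈ vset x := ⟨i, rfl⟩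

theorem vtx_le {k n : ℕ} (x : ⦋k⦌ ⟶ ⦋n⦌) (i : Fin (k + 1)) : vtx x i ≤ n :=
  Nat.lt_succ_iff.mp (x.toOrderHom i : Fin (n + 1)).isLt

theorem vtx_mono {k n : ℕ} (x : ⦋k⦌ ⟶ ⦋n⦌) {i j : Fin (k + 1)} (h : i ≤ j) :
    vtx x i ≤ vtx x j := x.toOrderHom.monotone h

theorem le_of_mem_vset {k n : ℕ} {x : ⦋k⦌ ⟶ ⦋n⦌} {v : ℕ} (h : v ∈ vset x) : v ≤ n := by
  obtain ⟨i, rfl⟩ := h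
  exact vtx_le x i

theorem vset_nonempty {k n : ℕ} (x : ⦋k⦌ ⟶ ⦋n⦌) : (vset x).Nonempty := ⟨_, vtx_mem x 0⟩

theorem hom_ext_vtx {k n : ℕ} {x y : ⦋k⦌ ⟶ ⦋n⦌} (h : ∀ i, vtx x i = vtx y i) : x = y := by
  apply SimplexCategory.Hom.ext
  ext i
  exact h i

@[simp]
theorem vtx_comp {k l n : ℕ} (x : ⦋k⦌ ⟶ ⦋l⦌) (y : ⦋l⦌ ⟶ ⦋n⦌) (i : Fin (k + 1)) :
    vtx (x ≫ y) i = vtx y (x.toOrderHom i) := rfl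

/-- The morphism with given vertices. -/
def homOfVtx {k n : ℕ} (g : ℕ → ℕ) (hm : ∀ i j, i ≤ j → j ≤ k → g i ≤ g j)
    (hb : ∀ i, i ≤ k → g i ≤ n) : ⦋k⦌ ⟶ ⦋n⦌ :=
  SimplexCategory.Hom.mk
    ⟨fun i => ⟨g i, Nat.lt_succ_iff.mpr (hb i (Nat.lt_succ_iff.mp i.isLt))⟩,
      fun i j h => hm i j h (Nat.lt_succ_iff.mp j.isLt)⟩

theorem vset_comp_homOfVtx {k l n : ℕ} (x : ⦋k⦌ ⟶ ⦋l⦌) (g : ℕ → ℕ)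
    (hm : ∀ i j, i ≤ j → j ≤ l → g i ≤ g j) (hb : ∀ i, i ≤ l → g i ≤ n) :
    vset (x ≫ homOfVtx g hm hb) = g '' vset x := by
  ext v
  constructor
  · rintro ⟨i, rfl⟩
    exact ⟨_, vtx_mem x i, rfl⟩
  · rintro ⟨_, ⟨i, rfl⟩, rfl⟩
    exact ⟨i, rfl⟩

theorem vset_comp_subset {k l n : ℕ} (x : ⦋k⦌ ⟶ ⦋l⦌) (y : ⦋l⦌ ⟶ ⦋n⦌) :
    vset (x ≫ y) ⊆ vset y := by
  rintro _ ⟨i, rfl⟩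
  exact vtx_mem y _

theorem vtx_strictMono {k n : ℕ} {x : ⦋k⦌ ⟶ ⦋n⦌} (hx : Function.Injective (vtx x)) :
    StrictMono (vtx x) :=
  (show Monotone (vtx x) from fun _ _ h => vtx_mono x h).strictMono_of_injective hx

theorem mono_of_injective {k n : ℕ} {x : ⦋k⦌ ⟶ ⦋n⦌} (hx : Function.Injective (vtx x)) :
    Mono x :=
  SimplexCategory.mono_iff_injective.mpr fun _ _ h => hx (congrArg Fin.val h)

theorem exists_enum {n : ℕ} {S : Set ℕ} (hS : ∀ v ∈ S, v ≤ n) (hne : S.Nonempty) :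
    ∃ (d : ℕ) (σ : ⦋d⦌ ⟶ ⦋n⦌), Function.Injective (vtx σ) ∧ vset σ = S := by
  classical
  have hfin : S.Finite := (Set.finite_Iic n).subset hS
  obtain ⟨d, hd⟩ : ∃ d, hfin.toFinset.card = d + 1 :=
    Nat.exists_eq_add_one.mpr (Finset.card_pos.mpr (by simpa using hne))
  have hr := Finset.range_orderEmbOfFin hfin.toFinset hd
  have hm (i : Fin (d + 1)) : hfin.toFinset.orderEmbOfFin hd i ∈ S := by
    exact hfin.mem_toFinset.mp (Finset.orderEmbOfFin_mem hfin.toFinset hd i)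
  refine ⟨d, SimplexCategory.Hom.mk ⟨fun i => ⟨hfin.toFinset.orderEmbOfFin hd i,
    Nat.lt_succ_iff.mpr (hS _ (hm i))⟩, fun i j h => ?_⟩, ?_, ?_⟩
  · exact (hfin.toFinset.orderEmbOfFin hd).monotone h
  · exact (hfin.toFinset.orderEmbOfFin hd).injective
  · refine Eq.trans ?_ (hr.trans hfin.coe_toFinset)
    rfl

theorem exists_retraction {d n : ℕ} {σ : ⦋d⦌ ⟶ ⦋n⦌} (hσ : Function.Injective (vtx σ)) :
    ∃ ρ : ⦋n⦌ ⟶ ⦋d⦌, σ ≫ ρ = 𝟙 _ := by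
  refine ⟨SimplexCategory.Hom.mk ⟨fun v =>
    (Finset.univ.filter (fun j : Fin (d + 1) => vtx σ j ≤ v.val)).sup id, ?_⟩, ?_⟩
  · intro v w h
    apply Finset.sup_mono
    intro j hj
    simp only [Finset.mem_filter, Finset.mem_univ, true_and] at hj ⊢
    exact hj.trans h
  · refine hom_ext_vtx fun i => congrArg Fin.val (a₂ := i) ?_
    change (Finset.univ.filter (fun j : Fin (d + 1) => vtx σ j ≤ vtx σ i)).sup id = i
    apply le_antisymm
    · apply Finset.sup_le
      intro j hj
      simp only [Finset.mem_filter, Finset.mem_univ, true_and] at hj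
      exact (vtx_strictMono hσ).le_iff_le.mp hj
    · exact Finset.le_sup (f := id)
        (Finset.mem_filter.mpr ⟨Finset.mem_univ _, le_rfl⟩)

theorem comp_retraction {d n k : ℕ} {σ : ⦋d⦌ ⟶ ⦋n⦌} {ρ : ⦋n⦌ ⟶ ⦋d⦌} (h : σ ≫ ρ = 𝟙 _)
    {x : ⦋k⦌ ⟶ ⦋n⦌} (hx : vset x ⊆ vset σ) : (x ≫ ρ) ≫ σ = x := by
  refine hom_ext_vtx fun i => ?_
  obtain ⟨j, hj⟩ := hx (vtx_mem x i)
  have hj' : x.toOrderHom i = σ.toOrderHom j := Fin.ext hj.symm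
  have h' : ρ.toOrderHom (σ.toOrderHom j) = j :=
    congrArg (fun f : ⦋d⦌ ⟶ ⦋d⦌ => f.toOrderHom j) h
  change vtx σ (ρ.toOrderHom (x.toOrderHom i)) = vtx x i
  rw [hj', h', hj]

theorem exists_factor {d n k : ℕ} {σ : ⦋d⦌ ⟶ ⦋n⦌} (hσ : Function.Injective (vtx σ))
    {x : ⦋k⦌ ⟶ ⦋n⦌} (hx : vset x ⊆ vset σ) : ∃ y : ⦋k⦌ ⟶ ⦋d⦌, y ≫ σ = x := by
  obtain ⟨ρ, hρ⟩ := exists_retraction hσ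
  exact ⟨x ≫ ρ, comp_retraction hρ hx⟩

theorem vset_comp {k d n : ℕ} (y : ⦋k⦌ ⟶ ⦋d⦌) (σ : ⦋d⦌ ⟶ ⦋n⦌) (v : ℕ) :
    v ∈ vset (y ≫ σ) ↔ ∃ j : Fin (d + 1), (j : ℕ) ∈ vset y ∧ vtx σ j = v := by
  constructor
  · rintro ⟨i, rfl⟩
    exact ⟨y.toOrderHom i, vtx_mem y i, rfl⟩
  · rintro ⟨j, ⟨i, hi⟩, rfl⟩
    refine ⟨i, ?_⟩
    rw [vtx_comp]
    exact congrArg _ (Fin.ext hi)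

theorem map_mem_degenerate (X : SSet.{u}) {k n : ℕ} (θ : X _⦋n⦌) {x : ⦋k⦌ ⟶ ⦋n⦌}
    (hx : ¬ Function.Injective (vtx x)) : X.map x.op θ ∈ X.degenerate k := by
  rcases k with _ | k
  · exact (hx fun i j _ => Subsingleton.elim (α := Fin 1) i j).elim
  · obtain ⟨i, θ', rfl⟩ := SimplexCategory.eq_σ_comp_of_not_injective x
      (fun h => hx fun i j hij => h (Fin.ext hij))
    refine ⟨k, k.lt_succ_self, SimplexCategory.σ i, X.map θ'.op θ, ?_⟩
    rw [op_comp, X.map_comp]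
    rfl

theorem map_map (X : SSet.{u}) {k l n : ℕ} (θ : X _⦋n⦌) (x : ⦋k⦌ ⟶ ⦋l⦌) (y : ⦋l⦌ ⟶ ⦋n⦌) :
    X.map x.op (X.map y.op θ) = X.map (x ≫ y).op θ := by
  rw [op_comp, X.map_comp]
  rfl

theorem map_id_apply (X : SSet.{u}) {n : ℕ} (θ : X _⦋n⦌) : X.map (𝟙 ⦋n⦌ : ⦋n⦌ ⟶ ⦋n⦌).op θ = θ := by
  rw [op_id, X.map_id]
  rfl

/-! ### Marked faces -/

/-- The faces of the simplex `θ` that are spanned by the set of vertices `S` are marked. -/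
def Mk (Z : MSSet.{u}) {n : ℕ} (θ : Z.toSSet _⦋n⦌) (S : Set ℕ) : Prop :=
  ∀ (k : ℕ) (x : ⦋k⦌ ⟶ ⦋n⦌), vset x = S → Z.toSSet.map x.op θ ∈ Z.marked k

/-- A vertex set spans a unique non-degenerate face, and all other simplices with the same vertex
set are degenerate, so one test suffices. -/
theorem mk_of_injective {Z : MSSet.{u}} {n : ℕ} {θ : Z.toSSet _⦋n⦌} {d : ℕ} {σ : ⦋d⦌ ⟶ ⦋n⦌}
    (hσ : Function.Injective (vtx σ)) (h : Z.toSSet.map σ.op θ ∈ Z.marked d) :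
    Z.Mk θ (vset σ) := by
  intro k x hx
  by_cases hi : Function.Injective (vtx x)
  · obtain ⟨y, rfl⟩ := exists_factor hσ hx.le
    obtain ⟨z, hz⟩ := exists_factor hi hx.ge
    have := mono_of_injective hi
    have hz' : Mono (z ≫ y ≫ σ) := by rw [hz]; exact mono_of_injective hσ
    have hy : Mono y := mono_of_mono y σ
    have hz'' : Mono z := mono_of_mono z (y ≫ σ)
    obtain rfl : k = d := le_antisymm (SimplexCategory.le_of_mono y) (SimplexCategory.le_of_mono z)
    rw [SimplexCategory.eq_id_of_mono y, Category.id_comp]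
    exact h
  · exact Z.degenerate_subset k (map_mem_degenerate _ θ hi)

theorem mk_map {Z : MSSet.{u}} {l n : ℕ} {θ : Z.toSSet _⦋n⦌} {g : ℕ → ℕ}
    {hm : ∀ i j, i ≤ j → j ≤ l → g i ≤ g j} {hb : ∀ i, i ≤ l → g i ≤ n} {S : Set ℕ}
    (h : Z.Mk θ (g '' S)) : Z.Mk (Z.toSSet.map (homOfVtx g hm hb).op θ) S := by
  rintro k x rfl
  rw [map_map]
  exact h k _ (vset_comp_homOfVtx x g hm hb)

/-- `Mk` holds vacuously for the empty set and for sets not contained in `[0, n]`. -/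
theorem mk_of_forall {Z : MSSet.{u}} {n : ℕ} {θ : Z.toSSet _⦋n⦌} {S : Set ℕ}
    (h : (∀ v ∈ S, v ≤ n) → S.Nonempty → Z.Mk θ S) : Z.Mk θ S := by
  rintro k x rfl
  exact h (fun v hv => le_of_mem_vset hv) (vset_nonempty x) k x rfl

/-! ### Lifting properties in terms of faces of a simplex -/

/-- `j` is an element of `S` next to `k`. -/
def IsNbr (S : Set ℕ) (j k : ℕ) : Prop :=
  j ∈ S ∧ j ≠ k ∧ ∀ i ∈ S, ¬ (j < i ∧ i < k) ∧ ¬ (k < i ∧ i < j)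

theorem isNbr_of_adjacent {d n : ℕ} {σ : ⦋d⦌ ⟶ ⦋n⦌} (hσ : Function.Injective (vtx σ))
    {j k : Fin (d + 1)} (h : (j : ℕ) + 1 = k ∨ (j : ℕ) = k + 1) :
    IsNbr (vset σ) (vtx σ j) (vtx σ k) := by
  have hs := vtx_strictMono hσ
  refine ⟨vtx_mem σ j, fun e => ?_, ?_⟩
  · have := congrArg Fin.val (hσ e)
    omega
  · rintro _ ⟨i, rfl⟩
    rw [hs.lt_iff_lt, hs.lt_iff_lt, hs.lt_iff_lt, hs.lt_iff_lt]
    omega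

theorem adjacent_of_isNbr {d n : ℕ} {σ : ⦋d⦌ ⟶ ⦋n⦌} (hσ : Function.Injective (vtx σ))
    {j k : Fin (d + 1)} (h : IsNbr (vset σ) (vtx σ j) (vtx σ k)) :
    (j : ℕ) + 1 = k ∨ (j : ℕ) = k + 1 := by
  have hs := vtx_strictMono hσ
  obtain ⟨-, hne, hb⟩ := h
  have hjk : (j : ℕ) ≠ k := fun e => hne (congrArg _ (Fin.ext e))
  rcases lt_or_gt_of_ne hjk with h | h
  · have := (hb _ (vtx_mem σ ⟨j + 1, by omega⟩)).1
    rw [hs.lt_iff_lt, hs.lt_iff_lt, Fin.lt_def, Fin.lt_def] at this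
    simp only at this
    omega
  · have := (hb _ (vtx_mem σ ⟨k + 1, by omega⟩)).2
    rw [hs.lt_iff_lt, hs.lt_iff_lt, Fin.lt_def, Fin.lt_def] at this
    simp only at this
    omega

theorem mem_vset_objEquiv {n d : ℕ} (x : (Δ[d] : SSet.{u}) _⦋n⦌) (j : Fin (d + 1)) :
    (j : ℕ) ∈ vset (SSet.stdSimplex.objEquiv x) ↔ j ∈ Set.range x :=
  ⟨fun ⟨i, hi⟩ => ⟨i, Fin.ext hi⟩, fun ⟨i, hi⟩ => ⟨i, congrArg Fin.val hi⟩⟩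

theorem mem_faceSimplices_iff {n d : ℕ} (x : (Δ[d] : SSet.{u}) _⦋n⦌) (j : Fin (d + 1)) :
    x ∈ faceSimplices d j n ↔
      ∀ i : Fin (d + 1), (i : ℕ) ∈ vset (SSet.stdSimplex.objEquiv x) ↔ i ≠ j :=
  Set.ext_iff.trans (forall_congr' fun i => iff_congr (mem_vset_objEquiv x i).symm Iff.rfl)

variable {N : ℕ∞} {Z : MSSet.{u}}

/-- If the faces of `S` that contain `k` and its neighbours are marked, and the faces of `S`
opposite to the neighbours of `k` are marked, then so is the face opposite to `k`. -/
theorem mk_diff_of_thin (hZ : IsSaturatedComplicial N Z) {n : ℕ} {θ : Z.toSSet _⦋n⦌}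
    {S : Set ℕ} {k : ℕ} (hk : k ∈ S) (hS : ∀ v ∈ S, v ≤ n) (hnt : (S \ {k}).Nontrivial)
    (h₁ : ∀ R ⊆ S, k ∈ R → (∀ j, IsNbr S j k → j ∈ R) → Z.Mk θ R)
    (h₂ : ∀ j, IsNbr S j k → Z.Mk θ (S \ {j})) : Z.Mk θ (S \ {k}) := by
  obtain ⟨d, σ, hσ, rfl⟩ := exists_enum hS ⟨k, hk⟩
  obtain ⟨e, τ, hτ, hτS⟩ := exists_enum (S := vset σ \ {k}) (fun v hv => hS v hv.1) hnt.nonempty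
  obtain ⟨y, rfl⟩ := exists_factor hσ (hτS.le.trans Set.sdiff_subset)
  obtain ⟨κ, rfl⟩ := hk
  have hd : 2 ≤ d := by
    obtain ⟨_, ⟨⟨i, rfl⟩, hi⟩, _, ⟨⟨j, rfl⟩, hj⟩, hij⟩ := hnt
    have h1 : i ≠ κ := fun h => hi (by rw [h]; rfl)
    have h2 : j ≠ κ := fun h => hj (by rw [h]; rfl)
    have h3 : i ≠ j := fun h => hij (by rw [h])
    omega
  have he : 0 < e := by
    obtain ⟨a, ha, b, hb, hab⟩ := hnt
    rw [← hτS] at ha hb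
    obtain ⟨i, rfl⟩ := ha
    obtain ⟨j, rfl⟩ := hb
    have h3 : i ≠ j := fun h => hab (by rw [h])
    omega
  -- The face spanned by `S`, viewed as a map from `Δ[d]`. The hypotheses `h₁` and `h₂` correspond
  -- to the two kinds of marked simplices of the domain of the thinness extension.
  let g : ofMarking (Δ[d] : SSet.{u}) (admissible' d κ) ⟶ Z :=
    { toSSetHom := SSet.yonedaEquiv.symm (Z.toSSet.map σ.op θ)
      map_marked := by
        rintro l x (hx | ⟨-, hx⟩)
        · exact Z.degenerate_subset _ (map_degenerate _ hx)
        · change Z.toSSet.map (SSet.stdSimplex.objEquiv x).op (Z.toSSet.map σ.op θ) ∈ _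
          rw [map_map]
          rcases hx with hx | ⟨j, hj, hx⟩
          · refine h₁ _ (vset_comp_subset _ _) ?_ ?_ _ _ rfl
            · exact (vset_comp _ _ _).mpr
                ⟨κ, (mem_vset_objEquiv x κ).mpr (hx κ (by simp)), rfl⟩
            · rintro _ hj
              obtain ⟨j, rfl⟩ := hj.1
              exact (vset_comp _ _ _).mpr ⟨j, (mem_vset_objEquiv x j).mpr
                (hx j (by have := adjacent_of_isNbr hσ hj; tauto)), rfl⟩
          · refine h₂ _ (isNbr_of_adjacent hσ hj) _ _ ?_
            have hx' := (mem_faceSimplices_iff x j).mp hx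
            ext v
            rw [vset_comp]
            constructor
            · rintro ⟨i, hi, rfl⟩
              exact ⟨vtx_mem σ i, fun h => (hx' i).mp hi (hσ h)⟩
            · rintro ⟨⟨i, rfl⟩, hi⟩
              exact ⟨i, (hx' i).mpr fun h => hi (by rw [h]; rfl), rfl⟩ }
  obtain ⟨h, hh⟩ := hZ _ (ElementaryAnodyne.thinness d hd κ) g
  have hh' : h.toSSetHom = SSet.yonedaEquiv.symm (Z.toSSet.map σ.op θ) :=
    congrArg Hom.toSSetHom hh
  rw [← hτS]
  apply mk_of_injective hτ
  have := h.map_marked e (SSet.stdSimplex.objEquiv.symm y) (Or.inr ⟨he, Or.inr (by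
    refine (mem_faceSimplices_iff _ κ).mpr fun j => ?_
    have hj : vtx σ j ∈ vset (y ≫ σ) ↔ vtx σ j ∈ vset σ \ {vtx σ κ} := iff_of_eq (by rw [hτS])
    rw [vset_comp] at hj
    constructor
    · rintro hj' rfl
      exact (hj.mp ⟨_, hj', rfl⟩).2 rfl
    · intro hj'
      obtain ⟨i, hi, hi'⟩ := hj.mpr ⟨vtx_mem σ j, fun h => hj' (hσ h)⟩
      rw [← hσ hi']
      exact hi)⟩)
  rw [hh'] at this
  change Z.toSSet.map y.op (Z.toSSet.map σ.op θ) ∈ _ at this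
  rwa [map_map] at this

/-- If all faces of `S` that contain the adjacent vertices `u` and `v` are marked, and the face
opposite to `u` is marked, then so is the face opposite to `v`. -/
theorem mk_diff_swap (hZ : IsSaturatedComplicial N Z) {n : ℕ} {θ : Z.toSSet _⦋n⦌}
    {S : Set ℕ} {u v : ℕ} (huv : IsNbr S u v) (hv : v ∈ S) (hS : ∀ v ∈ S, v ≤ n)
    (h₁ : ∀ R ⊆ S, u ∈ R → v ∈ R → Z.Mk θ R) (h₂ : Z.Mk θ (S \ {u}))
    (hnt : (S \ {v}).Nontrivial) : Z.Mk θ (S \ {v}) := by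
  refine mk_diff_of_thin hZ hv hS hnt (fun R hR hvR hR' => h₁ R hR (hR' u huv) hvR) ?_
  -- A second neighbour of `v` is harmless: the face opposite to it still contains `u` and `v`.
  intro j hj
  by_cases h : j = u
  · rwa [h]
  · exact h₁ _ Set.sdiff_subset ⟨huv.1, fun e => h e.symm⟩ ⟨hv, fun e => hj.2.1 e.symm⟩

/-- Complicial horns have fillers. -/
theorem exists_horn_filler (hZ : IsSaturatedComplicial N Z) {d : ℕ} (hd : 1 ≤ d) (κ : Fin (d + 1))
    (G : ∀ k : ℕ, (⦋k⦌ ⟶ ⦋d⦌) → Z.toSSet _⦋k⦌)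
    (hG : ∀ (k l : ℕ) (x : ⦋k⦌ ⟶ ⦋d⦌) (y : ⦋l⦌ ⟶ ⦋k⦌),
      (∃ j : Fin (d + 1), j ≠ κ ∧ (j : ℕ) ∉ vset x) → G l (y ≫ x) = Z.toSSet.map y.op (G k x))
    (hG' : ∀ (k : ℕ) (x : ⦋k⦌ ⟶ ⦋d⦌), (∃ j : Fin (d + 1), j ≠ κ ∧ (j : ℕ) ∉ vset x) →
      (∀ j : Fin (d + 1), ((j : ℕ) + 1 = κ ∨ (j : ℕ) = κ ∨ (j : ℕ) = κ + 1) → (j : ℕ) ∈ vset x) →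
      G k x ∈ Z.marked k) :
    ∃ h : Z.toSSet _⦋d⦌, (∀ (k : ℕ) (x : ⦋k⦌ ⟶ ⦋d⦌),
      (∃ j : Fin (d + 1), j ≠ κ ∧ (j : ℕ) ∉ vset x) → Z.toSSet.map x.op h = G k x) ∧
      ∀ (k : ℕ) (x : ⦋k⦌ ⟶ ⦋d⦌),
      (∀ j : Fin (d + 1), ((j : ℕ) + 1 = κ ∨ (j : ℕ) = κ ∨ (j : ℕ) = κ + 1) → (j : ℕ) ∈ vset x) →
      Z.toSSet.map x.op h ∈ Z.marked k := by
  have hmem (k : ℕ) (x : (Δ[d] : SSet.{u}) _⦋k⦌) : x ∈ (SSet.horn.{u} d κ).obj (op ⦋k⦌) ↔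
      ∃ j : Fin (d + 1), j ≠ κ ∧ (j : ℕ) ∉ vset (SSet.stdSimplex.objEquiv x) := by
    rw [SSet.mem_horn_iff_notMem_range]
    simp only [exists_prop]
    exact exists_congr fun j => and_congr Iff.rfl (not_congr (mem_vset_objEquiv x j).symm)
  let t : (SSet.horn.{u} d κ : SSet.{u}) ⟶ Z.toSSet :=
    { app := fun k => ↾fun s => G k.unop.len (SSet.stdSimplex.objEquiv s.1)
      naturality := by
        intro k l f
        ext s
        exact hG k.unop.len l.unop.len (SSet.stdSimplex.objEquiv s.1) f.unop
          ((hmem k.unop.len s.1).mp s.2) }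
  let g : restrict (ofMarking (Δ[d] : SSet.{u}) (admissible d κ)) Λ[d, κ] ⟶ Z :=
    { toSSetHom := t
      map_marked := by
        rintro l ⟨x, hx⟩ (hx' | ⟨-, hx'⟩)
        · exact Z.degenerate_subset _ (map_degenerate t
            ((SSet.Subcomplex.mem_degenerate_iff (A := Λ[d, κ]) ⟨x, hx⟩).mpr hx'))
        · exact hG' l _ ((hmem l x).mp hx)
            (fun j hj => (mem_vset_objEquiv x j).mpr (hx' j hj)) }
  obtain ⟨h, hh⟩ := hZ _ (ElementaryAnodyne.horn d hd κ) g
  have hy (k : ℕ) (x : ⦋k⦌ ⟶ ⦋d⦌) : Z.toSSet.map x.op (SSet.yonedaEquiv h.toSSetHom) =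
      h.toSSetHom.app (op ⦋k⦌) (SSet.stdSimplex.objEquiv.symm x) := by
    conv_rhs => rw [← SSet.yonedaEquiv.symm_apply_apply (Hom.toSSetHom h)]
    rfl
  refine ⟨SSet.yonedaEquiv h.toSSetHom, fun k x hx => ?_, fun k x hx => ?_⟩
  · rw [hy]
    exact congrArg (fun f : restrict (ofMarking (Δ[d] : SSet.{u}) (admissible d κ)) Λ[d, κ] ⟶ Z =>
      f.toSSetHom.app (op ⦋k⦌) (⟨SSet.stdSimplex.objEquiv.symm x, (hmem k _).mpr hx⟩ :
        (SSet.horn.{u} d κ : SSet.{u}) _⦋k⦌)) hh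
  -- The simplex contains `κ` and a neighbour of `κ`, which exists since `1 ≤ d`.
  · have hk : 0 < k := by
      obtain ⟨j, hj⟩ : ∃ j : Fin (d + 1), (j : ℕ) + 1 = κ ∨ (j : ℕ) = κ + 1 := by
        by_cases hκ : (κ : ℕ) < d
        · exact ⟨⟨κ + 1, by omega⟩, Or.inr rfl⟩
        · exact ⟨⟨κ - 1, by omega⟩, Or.inl (Nat.sub_add_cancel (by omega))⟩
      obtain ⟨i, hi⟩ := hx j (by tauto)
      obtain ⟨i', hi'⟩ := hx κ (by tauto)
      have : i ≠ i' := by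
        rintro rfl
        omega
      omega
    rw [hy]
    exact h.map_marked k _ (Or.inr ⟨hk, fun j hj => (mem_vset_objEquiv _ j).mp (hx j hj)⟩)

/-! ### Filling simplices by toggling a vertex -/

/-- One horn filling. The family `F` is coherent on `B` and on sets with at most `d` elements after
adding `c`. For the given `S`, all its subsets except `S` and `S \ {c}` are of this kind, so `F` is
defined on a horn at `c`. This horn is complicial: its relevant faces are marked by `h` inside `B`
and by `hFm` outside. -/
theorem exists_filling_aux (hZ : IsSaturatedComplicial N Z) {n : ℕ} (γ : Z.toSSet _⦋n⦌) (c : ℕ)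
    (B : Set ℕ → Prop) (hB : ∀ S T, S ⊆ T → B T → B S)
    (hBc : ∀ S, B S → B (insert c S)) (hB₀ : B ∅)
    (h : ∀ S R, ¬ B S → c ∈ S → R ⊆ S → c ∈ R → (∀ j, IsNbr S j c → j ∈ R) → B R → Z.Mk γ R)
    (d : ℕ) (F : ∀ k : ℕ, (⦋k⦌ ⟶ ⦋n⦌) → Z.toSSet _⦋k⦌)
    (hF : ∀ (k l : ℕ) (x : ⦋k⦌ ⟶ ⦋n⦌) (y : ⦋l⦌ ⟶ ⦋k⦌),
      (B (vset x) ∨ (insert c (vset x)).ncard ≤ d) → F l (y ≫ x) = Z.toSSet.map y.op (F k x))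
    (hFγ : ∀ (k : ℕ) (x : ⦋k⦌ ⟶ ⦋n⦌), B (vset x) → F k x = Z.toSSet.map x.op γ)
    (hFm : ∀ (k : ℕ) (x : ⦋k⦌ ⟶ ⦋n⦌), c ∈ vset x → ¬ B (vset x) → (vset x).ncard ≤ d →
      F k x ∈ Z.marked k) (S : Set ℕ) (hSn : ∀ v ∈ S, v ≤ n) (hcS : c ∈ S) (hSB : ¬ B S)
    (hSd : S.ncard = d + 1) :
    ∃ H : ∀ k : ℕ, (⦋k⦌ ⟶ ⦋n⦌) → Z.toSSet _⦋k⦌,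
      (∀ (k l : ℕ) (x : ⦋k⦌ ⟶ ⦋n⦌) (y : ⦋l⦌ ⟶ ⦋k⦌), H l (y ≫ x) = Z.toSSet.map y.op (H k x)) ∧
      (∀ (k : ℕ) (x : ⦋k⦌ ⟶ ⦋n⦌), vset x ⊆ S →
        (B (vset x) ∨ (insert c (vset x)).ncard ≤ d) → H k x = F k x) ∧
      ∀ (k : ℕ) (x : ⦋k⦌ ⟶ ⦋n⦌), vset x = S → H k x ∈ Z.marked k := by
  have hfin : S.Finite := (Set.finite_Iic n).subset hSn
  obtain ⟨e, σ, hσ, rfl⟩ := exists_enum hSn ⟨c, hcS⟩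
  obtain ⟨ρ, hρ⟩ := exists_retraction hσ
  obtain ⟨κ, rfl⟩ := hcS
  -- If `S = {c}`, then `S` would belong to `B`, being obtained from `∅` by adding `c`.
  have he : 1 ≤ e := by
    by_contra he
    obtain rfl : e = 0 := by omega
    refine hSB (hB _ _ ?_ (hBc _ hB₀))
    rintro _ ⟨i, rfl⟩
    exact Or.inl (by rw [Subsingleton.elim (α := Fin 1) i κ])
  have horn (k : ℕ) (x : ⦋k⦌ ⟶ ⦋e⦌) (hx : ∃ j : Fin (e + 1), j ≠ κ ∧ (j : ℕ) ∉ vset x) :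
      (insert (vtx σ κ) (vset (x ≫ σ))).ncard ≤ d := by
    obtain ⟨j, hj, hjx⟩ := hx
    rw [← Nat.lt_succ_iff, Nat.succ_eq_add_one, ← hSd]
    refine Set.ncard_lt_ncard ⟨Set.insert_subset (vtx_mem σ κ) (vset_comp_subset x σ), fun hs => ?_⟩
      hfin
    rcases hs (vtx_mem σ j) with h | h
    · exact hj (hσ h)
    · obtain ⟨i, hi, hi'⟩ := (vset_comp x σ _).mp h
      rw [hσ hi'] at hi
      exact hjx hi
  obtain ⟨t, ht, ht'⟩ := exists_horn_filler hZ he κ (fun k x => F k (x ≫ σ))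
    (fun k l x y hx => by rw [Category.assoc, hF _ _ _ _ (Or.inr (horn k x hx))])
    (fun k x hx hx' => by
      have hc : vtx σ κ ∈ vset (x ≫ σ) :=
        (vset_comp x σ _).mpr ⟨κ, hx' κ (Or.inr (Or.inl rfl)), rfl⟩
      by_cases hb : B (vset (x ≫ σ))
      · rw [hFγ _ _ hb]
        refine h _ _ hSB (vtx_mem σ κ) (vset_comp_subset x σ) hc (fun j hj => ?_) hb _ _ rfl
        obtain ⟨j, rfl⟩ := hj.1
        have := adjacent_of_isNbr hσ hj
        exact (vset_comp x σ _).mpr ⟨j, hx' j (by tauto), rfl⟩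
      · exact hFm _ _ hc hb ((congrArg Set.ncard (Set.insert_eq_of_mem hc)).symm.le.trans
          (horn k x hx)))
  -- The retraction `ρ` makes the family total and coherent; its values matter only on subsets of
  -- `S`.
  refine ⟨fun k x => Z.toSSet.map (x ≫ ρ).op t, fun k l x y => ?_, fun k x hxS hx => ?_,
    fun k x hxS => ?_⟩
  · simp only [Category.assoc, map_map]
  -- Neither a set in `B` nor a small set exhausts `S` after adding `c`; such faces therefore lie in
  -- the horn.
  · have hne : ¬ vset σ ⊆ insert (vtx σ κ) (vset x) := by
      rcases hx with hx | hx
      · exact fun hs => hSB (hB _ _ hs (hBc _ hx))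
      · intro hs
        have := Set.ncard_le_ncard hs
          ((hfin.subset hxS).insert _)
        omega
    obtain ⟨_, ⟨j, rfl⟩, hj⟩ := Set.not_subset.mp hne
    have := ht _ (x ≫ ρ) ⟨j, fun e => hj (Or.inl (by rw [e])), fun hjx => hj (Or.inr (by
      rw [← comp_retraction hρ hxS]
      exact (vset_comp _ _ _).mpr ⟨j, hjx, rfl⟩))⟩
    rw [comp_retraction hρ hxS] at this
    exact this
  · refine ht' _ _ fun j _ => ?_
    have hj : vtx σ j ∈ vset ((x ≫ ρ) ≫ σ) := by
      rw [comp_retraction hρ hxS.le, hxS]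
      exact vtx_mem σ j
    obtain ⟨i, hi, hi'⟩ := (vset_comp _ _ _).mp hj
    rwa [hσ hi'] at hi

/-- Let `B` be a simplicial complex on the vertices of `γ` such that the simplices outside of `B`
come in pairs `S`, `S ∪ {c}`. If sufficiently many simplices of `B` are marked, the restriction of
`γ` to `B` can be extended in such a way that the simplices outside `B` that contain `c` become
marked. -/
theorem exists_filling (hZ : IsSaturatedComplicial N Z) {n : ℕ} (γ : Z.toSSet _⦋n⦌) (c : ℕ)
    (B : Set ℕ → Prop) (hB : ∀ S T, S ⊆ T → B T → B S)
    (hBc : ∀ S, B S → B (insert c S)) (hB₀ : B ∅)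
    (h : ∀ S R, ¬ B S → c ∈ S → R ⊆ S → c ∈ R → (∀ j, IsNbr S j c → j ∈ R) → B R → Z.Mk γ R)
    (hc : c ≤ n) :
    ∃ γ' : Z.toSSet _⦋n⦌, (∀ (k : ℕ) (x : ⦋k⦌ ⟶ ⦋n⦌), B (vset x) →
        Z.toSSet.map x.op γ' = Z.toSSet.map x.op γ) ∧
      ∀ S, c ∈ S → ¬ B S → Z.Mk γ' S := by
  classical
  have hfin (k : ℕ) (x : ⦋k⦌ ⟶ ⦋n⦌) : (insert c (vset x)).Finite := (Set.finite_range _).insert c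
  -- The induction is on the size after adding `c`, so both members of a pair `S`, `S ∪ {c}` are
  -- defined at the same stage, by the same filler.
  have key (d : ℕ) : ∃ F : ∀ k : ℕ, (⦋k⦌ ⟶ ⦋n⦌) → Z.toSSet _⦋k⦌,
      (∀ (k l : ℕ) (x : ⦋k⦌ ⟶ ⦋n⦌) (y : ⦋l⦌ ⟶ ⦋k⦌),
        (B (vset x) ∨ (insert c (vset x)).ncard ≤ d) → F l (y ≫ x) = Z.toSSet.map y.op (F k x)) ∧
      (∀ (k : ℕ) (x : ⦋k⦌ ⟶ ⦋n⦌), B (vset x) → F k x = Z.toSSet.map x.op γ) ∧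
      ∀ (k : ℕ) (x : ⦋k⦌ ⟶ ⦋n⦌), c ∈ vset x → ¬ B (vset x) → (vset x).ncard ≤ d →
        F k x ∈ Z.marked k := by
    induction d with
    | zero =>
      refine ⟨fun k x => Z.toSSet.map x.op γ, fun k l x y _ => (map_map _ _ _ _).symm,
        fun _ _ _ => rfl, fun k x hx _ h0 => ?_⟩
      rw [Nat.le_zero, Set.ncard_eq_zero ((hfin k x).subset (Set.subset_insert _ _))] at h0
      rw [h0] at hx
      exact hx.elim
    | succ d ih =>
      obtain ⟨F, hF, hFγ, hFm⟩ := ih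
      have hH (S : Set ℕ) : ∃ H : ∀ k : ℕ, (⦋k⦌ ⟶ ⦋n⦌) → Z.toSSet _⦋k⦌,
          (∀ v ∈ S, v ≤ n) → c ∈ S → ¬ B S → S.ncard = d + 1 →
          (∀ (k l : ℕ) (x : ⦋k⦌ ⟶ ⦋n⦌) (y : ⦋l⦌ ⟶ ⦋k⦌),
            H l (y ≫ x) = Z.toSSet.map y.op (H k x)) ∧
          (∀ (k : ℕ) (x : ⦋k⦌ ⟶ ⦋n⦌), vset x ⊆ S →
            (B (vset x) ∨ (insert c (vset x)).ncard ≤ d) → H k x = F k x) ∧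
          ∀ (k : ℕ) (x : ⦋k⦌ ⟶ ⦋n⦌), vset x = S → H k x ∈ Z.marked k := by
        by_cases hS : (∀ v ∈ S, v ≤ n) ∧ c ∈ S ∧ ¬ B S ∧ S.ncard = d + 1
        · obtain ⟨h1, h2, h3, h4⟩ := hS
          obtain ⟨H, hH⟩ := exists_filling_aux hZ γ c B hB hBc hB₀ h d F hF hFγ hFm S h1 h2 h3 h4
          exact ⟨H, fun _ _ _ _ => hH⟩
        · exact ⟨F, fun h1 h2 h3 h4 => (hS ⟨h1, h2, h3, h4⟩).elim⟩
      choose H hH using hH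
      have hH' (k : ℕ) (x : ⦋k⦌ ⟶ ⦋n⦌) (hx : ¬ (B (vset x) ∨ (insert c (vset x)).ncard ≤ d))
          (hx' : B (vset x) ∨ (insert c (vset x)).ncard ≤ d + 1) := by
        rw [not_or] at hx
        exact hH (insert c (vset x))
          (by rintro v (rfl | hv); exacts [hc, le_of_mem_vset hv]) (Set.mem_insert _ _)
          (fun hb => hx.1 (hB _ _ (Set.subset_insert _ _) hb))
          (le_antisymm (hx'.resolve_left hx.1) (by omega))
      refine ⟨fun k x => if B (vset x) ∨ (insert c (vset x)).ncard ≤ d then F k x else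
        H (insert c (vset x)) k x, fun k l x y hx => ?_, fun k x hx => ?_, fun k x hcx hxB hx => ?_⟩
      · have hsub : insert c (vset (y ≫ x)) ⊆ insert c (vset x) :=
          Set.insert_subset_insert (vset_comp_subset y x)
        by_cases hxd : B (vset x) ∨ (insert c (vset x)).ncard ≤ d
        · have hyx : B (vset (y ≫ x)) ∨ (insert c (vset (y ≫ x))).ncard ≤ d :=
            hxd.imp (hB _ _ (vset_comp_subset y x))
              (Set.ncard_le_ncard hsub (hfin k x)).trans
          beta_reduce
          rw [if_pos hxd, if_pos hyx, hF _ _ _ _ hxd]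
        · obtain ⟨h1, h2, -⟩ := hH' k x hxd hx
          beta_reduce
          rw [if_neg hxd, ← h1]
          by_cases hyx : B (vset (y ≫ x)) ∨ (insert c (vset (y ≫ x))).ncard ≤ d
          · rw [if_pos hyx, h2 _ _ ((Set.subset_insert _ _).trans hsub) hyx]
          -- If both `x` and `y ≫ x` are new, their sets with `c` added have the same size, hence
          -- coincide, and the same filler is used.
          · rw [if_neg hyx, Set.eq_of_subset_of_ncard_le hsub _ (hfin k x)]
            rw [not_or] at hyx hxd
            have := hx.resolve_left hxd.1
            omega
      · beta_reduce
        rw [if_pos (Or.inl hx), hFγ _ _ hx]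
      · beta_reduce
        by_cases hxd : B (vset x) ∨ (insert c (vset x)).ncard ≤ d
        · rw [if_pos hxd]
          exact hFm _ _ hcx hxB (by rw [Set.insert_eq_of_mem hcx] at hxd; exact hxd.resolve_left hxB)
        · rw [if_neg hxd]
          have hi := Set.insert_eq_of_mem hcx
          exact (hH' k x hxd (Or.inr (by rwa [hi]))).2.2 _ _ hi.symm
  obtain ⟨F, hF, hFγ, hFm⟩ := key (n + 1)
  have hcard (k : ℕ) (x : ⦋k⦌ ⟶ ⦋n⦌) : (insert c (vset x)).ncard ≤ n + 1 := by
    have h1 : insert c (vset x) ⊆ (Finset.range (n + 1) : Set ℕ) := by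
      rintro v (rfl | hv)
      · simpa [Nat.lt_succ_iff] using hc
      · simpa [Nat.lt_succ_iff] using le_of_mem_vset hv
    have h2 := Set.ncard_le_ncard h1 (Finset.finite_toSet _)
    rwa [Set.ncard_coe_finset, Finset.card_range] at h2
  have hmap (k : ℕ) (x : ⦋k⦌ ⟶ ⦋n⦌) : Z.toSSet.map x.op (F n (𝟙 _)) = F k x := by
    rw [← hF n k (𝟙 _) x (Or.inr (hcard _ _)), Category.comp_id]
  refine ⟨F n (𝟙 _), fun k x hx => by rw [hmap, hFγ k x hx], ?_⟩
  rintro S hcS hSB k x rfl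
  rw [hmap]
  exact hFm _ _ hcS hSB ((Set.ncard_le_ncard (Set.subset_insert _ _) (hfin k x)).trans (hcard _ _))

/-! ### Inserting a vertex -/

theorem exists_pred {S : Set ℕ} {l p : ℕ} (hl : l ∈ S) (hlp : l < p) :
    ∃ j, IsNbr S j p ∧ l ≤ j ∧ j < p := by
  classical
  have h := Nat.findGreatest_spec (P := fun j => j ∈ S ∧ j < p) hlp.le ⟨hl, hlp⟩
  refine ⟨_, ⟨h.1, h.2.ne, fun i hi => ⟨fun hi' => ?_, fun hi' => ?_⟩⟩,
    Nat.le_findGreatest hlp.le ⟨hl, hlp⟩, h.2⟩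
  · exact absurd (Nat.le_findGreatest (P := fun j => j ∈ S ∧ j < p) hi'.2.le ⟨hi, hi'.2⟩)
      (not_le.mpr hi'.1)
  · have := h.2
    omega

theorem exists_succ {S : Set ℕ} {l p : ℕ} (hl : l ∈ S) (hlp : p < l) :
    ∃ j, IsNbr S j p ∧ p < j ∧ j ≤ l := by
  classical
  have he : ∃ j, j ∈ S ∧ p < j := ⟨l, hl, hlp⟩
  have h := Nat.find_spec he
  refine ⟨_, ⟨h.1, h.2.ne', fun i hi => ⟨fun hi' => ?_, fun hi' => ?_⟩⟩, h.2,
    Nat.find_min' he ⟨hl, hlp⟩⟩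
  · have := h.2
    omega
  · exact absurd (Nat.find_min' he ⟨hi, hi'.1⟩) (not_le.mpr hi'.2)

/-! ### Codegeneracies and cofaces acting on vertex sets -/

/-- The vertex map of the codegeneracy `σ_q`. -/
def collapse (q v : ℕ) : ℕ := if v ≤ q then v else v - 1

/-- The vertex map of the coface `δ_q`. -/
def skip (q v : ℕ) : ℕ := if v < q then v else v + 1

theorem collapse_of_le {q v : ℕ} (h : v ≤ q) : collapse q v = v := if_pos h

theorem collapse_of_lt {q v : ℕ} (h : q < v) : collapse q v = v - 1 := if_neg (by omega)

theorem skip_of_lt {q v : ℕ} (h : v < q) : skip q v = v := if_pos h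

theorem skip_of_le {q v : ℕ} (h : q ≤ v) : skip q v = v + 1 := if_neg (by omega)

theorem collapse_monotone (q : ℕ) : Monotone (collapse q) := by
  intro i j h
  unfold collapse
  split_ifs <;> omega

theorem skip_monotone (q : ℕ) : Monotone (skip q) := by
  intro i j h
  unfold skip
  split_ifs <;> omega

/-- The codegeneracy `σ_q`. -/
def collapseHom (n q : ℕ) (hq : q ≤ n) : ⦋n + 1⦌ ⟶ ⦋n⦌ :=
  homOfVtx (collapse q) (fun _ _ h _ => collapse_monotone q h)
    (fun i hi => by unfold collapse; split_ifs <;> omega)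

/-- The coface `δ_q`. -/
def skipHom (n q : ℕ) : ⦋n⦌ ⟶ ⦋n + 1⦌ :=
  homOfVtx (skip q) (fun _ _ h _ => skip_monotone q h)
    (fun i hi => by unfold skip; split_ifs <;> omega)

theorem skip_ne (q v : ℕ) : skip q v ≠ q := by
  unfold skip
  split_ifs <;> omega

theorem notMem_skip_image (q : ℕ) (S : Set ℕ) : q ∉ skip q '' S := by
  rintro ⟨v, -, h⟩
  exact skip_ne q v h

theorem collapse_skip (q v : ℕ) : collapse q (skip q v) = v := by
  unfold collapse skip
  split_ifs <;> omega

theorem skip_collapse {q v : ℕ} (h : v ≠ q) : skip q (collapse q v) = v := by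
  unfold collapse skip
  split_ifs <;> omega

theorem skipHom_comp_collapseHom (n q : ℕ) (hq : q ≤ n) :
    skipHom n q ≫ collapseHom n q hq = 𝟙 _ :=
  hom_ext_vtx fun _ => collapse_skip q _

theorem mem_collapse_of_le {q v : ℕ} {S : Set ℕ} (hv : v ∈ S) (h : v ≤ q) :
    v ∈ collapse q '' S := ⟨v, hv, collapse_of_le h⟩

theorem mem_collapse_of_succ {q v : ℕ} {S : Set ℕ} (hv : v + 1 ∈ S) (h : q ≤ v) :
    v ∈ collapse q '' S := ⟨v + 1, hv, collapse_of_lt (by omega)⟩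

theorem mem_skip_of_lt {q v : ℕ} {S : Set ℕ} (hv : v ∈ S) (h : v < q) :
    v ∈ skip q '' S := ⟨v, hv, skip_of_lt h⟩

theorem mem_skip_of_le {q v : ℕ} {S : Set ℕ} (hv : v ∈ S) (h : q ≤ v) :
    v + 1 ∈ skip q '' S := ⟨v, hv, skip_of_le h⟩

theorem mk_of_skip {n q : ℕ} (hq : q ≤ n + 1) {θ : Z.toSSet _⦋n + 1⦌} {R : Set ℕ} (hR : q ∉ R)
    (h : Z.Mk (Z.toSSet.map (skipHom n q).op θ) (collapse q '' R)) : Z.Mk θ R := by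
  rintro k x rfl
  -- For `q = n + 1` the function `collapse q` takes the value `n + 1` at `q`; the minimum corrects
  -- this and changes nothing on `R`, which does not contain `q`.
  let y : ⦋n + 1⦌ ⟶ ⦋n⦌ := homOfVtx (fun v => min (collapse q v) n)
    (fun _ _ h _ => min_le_min_right n (collapse_monotone q h)) (fun _ _ => min_le_right _ _)
  have hmin {v : ℕ} (hv : v ∈ vset x) : min (collapse q v) n = collapse q v := by
    have := le_of_mem_vset hv
    have : v ≠ q := fun e => hR (e ▸ hv)
    unfold collapse
    split_ifs <;> omega
  have hx : (x ≫ y) ≫ skipHom n q = x := hom_ext_vtx fun i => by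
    have hi : vtx x i ≠ q := fun e => hR (e ▸ vtx_mem x i)
    change skip q (min (collapse q (vtx x i)) n) = _
    rw [hmin (vtx_mem x i), skip_collapse hi]
  have := h k (x ≫ y) ((vset_comp_homOfVtx _ _ _ _).trans (Set.image_congr fun v hv => hmin hv))
  rwa [map_map, hx] at this

/-- Thinness read upwards: `R` is the face opposite to `k` in the larger set `R ∪ {k}`. -/
theorem mk_insert_thin (hZ : IsSaturatedComplicial N Z) {n : ℕ} {θ : Z.toSSet _⦋n⦌}
    {R : Set ℕ} {k : ℕ} (hk : k ∉ R) (hkn : k ≤ n) (hnt : R.Nontrivial)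
    (h₁ : ∀ R' ⊆ insert k R, k ∈ R' → (∀ j, IsNbr (insert k R) j k → j ∈ R') → Z.Mk θ R')
    (h₂ : ∀ j, IsNbr (insert k R) j k → Z.Mk θ (insert k R \ {j})) : Z.Mk θ R := by
  apply mk_of_forall
  intro hR _
  have hd : insert k R \ {k} = R := Set.insert_sdiff_self_of_notMem hk
  rw [← hd]
  refine mk_diff_of_thin hZ (Set.mem_insert _ _) ?_ (by rwa [hd]) h₁ h₂
  rintro v (rfl | hv)
  exacts [hkn, hR v hv]

theorem mk_insert_swap (hZ : IsSaturatedComplicial N Z) {n : ℕ} {θ : Z.toSSet _⦋n⦌}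
    {R : Set ℕ} {u v : ℕ} (hv : v ∉ R) (hvn : v ≤ n) (hnt : R.Nontrivial)
    (huv : IsNbr (insert v R) u v)
    (h₁ : ∀ R' ⊆ insert v R, u ∈ R' → v ∈ R' → Z.Mk θ R')
    (h₂ : Z.Mk θ (insert v R \ {u})) : Z.Mk θ R := by
  apply mk_of_forall
  intro hR _
  have hd : insert v R \ {v} = R := Set.insert_sdiff_self_of_notMem hv
  rw [← hd]
  refine mk_diff_swap hZ huv (Set.mem_insert _ _) ?_ h₁ h₂ (by rwa [hd])
  rintro w (rfl | hw)
  exacts [hvn, hR w hw]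

/-- A vertex `q` is inserted into `θ` in front of the vertex `q`, in such a way that
the simplices containing `p`, a vertex from `[a, p)` and a vertex from `(p, q]` are marked,
and the simplices without vertices in `[a, p)` are degenerate along `{q, q + 1}`. -/
theorem exists_insert (hZ : IsSaturatedComplicial N Z) {n a p q : ℕ} (θ : Z.toSSet _⦋n⦌)
    (hpq : p < q) (hq : q ≤ n)
    (h : ∀ S : Set ℕ, (∃ l ∈ S, a ≤ l ∧ l < p) → p ∈ S → (∃ j ∈ S, p < j ∧ j < q) → Z.Mk θ S) :
    ∃ θ' : Z.toSSet _⦋n + 1⦌, Z.toSSet.map (skipHom n q).op θ' = θ ∧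
      (∀ S : Set ℕ, (q ∉ S ∨ ∀ l ∈ S, ¬ (a ≤ l ∧ l < p)) → Z.Mk θ (collapse q '' S) → Z.Mk θ' S) ∧
      (∀ S : Set ℕ, (∀ l ∈ S, ¬ (a ≤ l ∧ l < p)) → q ∈ S → q + 1 ∈ S → Z.Mk θ' S) ∧
      ∀ S : Set ℕ, (∃ l ∈ S, a ≤ l ∧ l < p) → p ∈ S → (∃ j ∈ S, p < j ∧ j ≤ q) → Z.Mk θ' S := by
  -- The starting point is the degeneracy of `θ` that repeats `q`. The faces that avoid the first
  -- copy `q`, or avoid `[a, p)`, are kept; the others are rebuilt by toggling `p`, which makes the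
  -- edges from `[a, p)` to the new `q` factor through `p`.
  obtain ⟨θ', h₁, h₂⟩ := exists_filling hZ (Z.toSSet.map (collapseHom n q hq).op θ) p
    (fun S => q ∉ S ∨ ∀ l ∈ S, ¬ (a ≤ l ∧ l < p))
    (fun S T hST hT => hT.imp (fun h h' => h (hST h')) (fun h l hl => h l (hST hl)))
    (fun S hS => hS.imp
      (by rintro h (rfl | h'); exacts [absurd hpq (lt_irrefl _), h h'])
      (by rintro h l (rfl | hl); exacts [by omega, h l hl]))
    (Or.inl (Set.notMem_empty q))
    (by
      intro S R hSB hpS hRS hpR hnbr hRB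
      simp only [not_or, not_not, not_forall] at hSB
      obtain ⟨hqS, l, hlS, hal, hlp⟩ := hSB
      obtain ⟨i, hi, hli, hip⟩ := exists_pred hlS hlp
      obtain ⟨j, hj, hpj, hjq⟩ := exists_succ hqS hpq
      have hiR := hnbr i hi
      have hjR := hnbr j hj
      -- Since `R` contains the neighbour `i ∈ [a, p)`, it can lie in the kept complex only by
      -- avoiding `q`. The successor of `p` is then strictly below `q`, as the hypothesis on `θ`
      -- demands.
      have hqR : q ∉ R := hRB.resolve_right fun hR => hR i hiR ⟨by omega, hip⟩
      have hjq' : j ≠ q := fun e => hqR (e ▸ hjR)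
      exact mk_map (h _ ⟨i, mem_collapse_of_le hiR (by omega), by omega, hip⟩
        (mem_collapse_of_le hpR hpq.le) ⟨j, mem_collapse_of_le hjR hjq, hpj, by omega⟩))
    (by omega)
  refine ⟨θ', ?_, fun S hS hθ k x hx => ?_, fun S hS hq₁ hq₂ k x hx => ?_, fun S hl hp hj => ?_⟩
  · rw [h₁, map_map, skipHom_comp_collapseHom, map_id_apply]
    refine Or.inl ?_
    rintro ⟨i, hi⟩
    exact skip_ne q _ hi
  · rw [h₁ k x (by rwa [hx]), map_map]
    exact hθ k _ ((vset_comp_homOfVtx _ _ _ _).trans (by rw [hx]))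
  · rw [h₁ k x (by rw [hx]; exact Or.inr hS), map_map]
    refine Z.degenerate_subset _ (map_mem_degenerate _ _ fun hinj => ?_)
    obtain ⟨i, hi⟩ := hx.ge hq₁
    obtain ⟨j, hj⟩ := hx.ge hq₂
    have hij : i = j := by
      apply hinj
      change collapse q (vtx x i) = collapse q (vtx x j)
      rw [hi, hj, collapse_of_le le_rfl, collapse_of_lt (Nat.lt_add_one q), Nat.add_sub_cancel]
    rw [hij] at hi
    omega
  · by_cases hq' : q ∈ S
    · obtain ⟨l, hlS, hal⟩ := hl
      exact h₂ S hp fun hB => hB.elim (fun h => h hq') (fun h => h l hlS hal)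
    · intro k x hx
      rw [h₁ k x (by rw [hx]; exact Or.inl hq'), map_map]
      obtain ⟨l, hlS, hal⟩ := hl
      obtain ⟨j, hjS, hpj, hjq⟩ := hj
      have hjq' : j ≠ q := fun e => hq' (e ▸ hjS)
      refine h (collapse q '' S) ⟨l, mem_collapse_of_le hlS (by omega), hal⟩
        (mem_collapse_of_le hp hpq.le) ⟨j, mem_collapse_of_le hjS hjq, hpj, by omega⟩ k _
        ((vset_comp_homOfVtx _ _ _ _).trans (by rw [hx]))

/-! ### Two-sided saturation -/

/-- `S` has two elements in `[lo, hi)`. -/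
def TwoIn (S : Set ℕ) (lo hi : ℕ) : Prop := ∃ i ∈ S, ∃ j ∈ S, lo ≤ i ∧ i < j ∧ j < hi

theorem TwoIn.nontrivial {S : Set ℕ} {lo hi : ℕ} (h : TwoIn S lo hi) : S.Nontrivial := by
  obtain ⟨i, hi, j, hj, -, hij, -⟩ := h
  exact ⟨i, hi, j, hj, hij.ne⟩

/-- The sets that contain one of the edges `{a, a + 2}` and `{a + 1, a + 3}`. -/
def EqC (a : ℕ) (S : Set ℕ) : Prop := (a ∈ S ∧ a + 2 ∈ S) ∨ (a + 1 ∈ S ∧ a + 3 ∈ S)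

/-- An interpolation between `EqC a` and `EqC (a + 1)`: the vertices `a, …, p` represent the
first vertices of the `3`-simplex, and the vertices `p + 1, …, a + 3` represent, in reverse order,
the last ones. -/
def EqP (a p : ℕ) (S : Set ℕ) : Prop :=
  (∃ l, a ≤ l ∧ l + 2 ≤ p ∧ l ∈ S ∧ l + 2 ∈ S) ∨
  (∃ l n, a ≤ l ∧ l ≤ p ∧ n + l = p + 2 + a ∧ p < n ∧ n < a + 4 ∧ l ∈ S ∧ n ∈ S ∧ a + 4 ∈ S) ∨
  (∃ n, p < n ∧ n + 2 < a + 4 ∧ n ∈ S ∧ n + 2 ∈ S) ∨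
  ((∀ l ∈ S, ¬ (a ≤ l ∧ l ≤ p)) ∧ TwoIn S (p + 1) (a + 5)) ∨
  (TwoIn S a (p + 1) ∧ ∃ n ∈ S, p < n ∧ n < a + 4)

/-- The image of `EqP a (p - 1)` under the coface `δ_p`. -/
def EqP' (a p : ℕ) (R : Set ℕ) : Prop :=
  (∃ l, a ≤ l ∧ l + 2 < p ∧ l ∈ R ∧ l + 2 ∈ R) ∨
  (∃ l n, a ≤ l ∧ l < p ∧ n + l = p + 2 + a ∧ p < n ∧ n ≤ a + 4 ∧ l ∈ R ∧ n ∈ R ∧ a + 5 ∈ R) ∨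
  (∃ n, p < n ∧ n + 2 ≤ a + 4 ∧ n ∈ R ∧ n + 2 ∈ R) ∨
  ((∀ l ∈ R, ¬ (a ≤ l ∧ l < p)) ∧ TwoIn R (p + 1) (a + 6)) ∨
  (TwoIn R a p ∧ ∃ n ∈ R, p < n ∧ n ≤ a + 4)

theorem EqP.image_skip {a p : ℕ} {S : Set ℕ} (hp : p ≤ a + 2) (h : EqP a p S) :
    EqP' a (p + 1) (skip (p + 1) '' S) := by
  rcases h with ⟨l, h1, h2, h3, h4⟩ | ⟨l, n, h1, h2, h3, h4, h5, h6, h7, h8⟩ | ⟨n, h1, h2, h3, h4⟩ |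
    ⟨h1, i, hi, j, hj, h2, h3, h4⟩ | ⟨⟨i, hi, j, hj, h2, h3, h4⟩, n, hn, h5, h6⟩
  · exact Or.inl ⟨l, h1, by omega, mem_skip_of_lt h3 (by omega), mem_skip_of_lt h4 (by omega)⟩
  · exact Or.inr (Or.inl ⟨l, n + 1, h1, by omega, by omega, by omega, by omega,
      mem_skip_of_lt h6 (by omega), mem_skip_of_le h7 (by omega), mem_skip_of_le h8 (by omega)⟩)
  · exact Or.inr (Or.inr (Or.inl ⟨n + 1, by omega, by omega, mem_skip_of_le h3 (by omega),
      mem_skip_of_le h4 (by omega)⟩))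
  · refine Or.inr (Or.inr (Or.inr (Or.inl ⟨?_, i + 1, mem_skip_of_le hi (by omega), j + 1,
      mem_skip_of_le hj (by omega), by omega, by omega, by omega⟩)))
    rintro _ ⟨v, hv, rfl⟩ hv'
    have := h1 v hv
    unfold skip at hv'
    split_ifs at hv' <;> omega
  · exact Or.inr (Or.inr (Or.inr (Or.inr ⟨⟨i, mem_skip_of_lt hi (by omega), j,
      mem_skip_of_lt hj (by omega), by omega, by omega, by omega⟩, n + 1,
      mem_skip_of_le hn (by omega), by omega, by omega⟩)))

/-- `h₁`, `h₂`, `h₃` are the properties of the simplex produced by `exists_insert` at `q = a + 4`.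
In the critical case `R` meets `[a, p)` and contains `a + 4`. Then `R` is the face opposite to `p`
in `R ∪ {p}`, and `h₃` marks all required faces except the one opposite to a neighbour of `p` that
is the only element of `R` in `[a, p)` or in `(p, a + 4]`. -/
theorem mk_of_eqP' (hZ : IsSaturatedComplicial N Z) {n a p : ℕ} {θ : Z.toSSet _⦋n⦌}
    (han : a + 4 ≤ n) (hap : a < p) (hpa : p ≤ a + 3)
    (hθ : ∀ S, EqP a p S → Z.Mk θ S) {θ' : Z.toSSet _⦋n + 1⦌}
    (h₁ : ∀ S : Set ℕ, (a + 4 ∉ S ∨ ∀ l ∈ S, ¬ (a ≤ l ∧ l < p)) →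
      Z.Mk θ (collapse (a + 4) '' S) → Z.Mk θ' S)
    (h₂ : ∀ S : Set ℕ, (∀ l ∈ S, ¬ (a ≤ l ∧ l < p)) → a + 4 ∈ S → a + 5 ∈ S → Z.Mk θ' S)
    (h₃ : ∀ S : Set ℕ, (∃ l ∈ S, a ≤ l ∧ l < p) → p ∈ S → (∃ j ∈ S, p < j ∧ j ≤ a + 4) → Z.Mk θ' S)
    {R : Set ℕ} (hpR : p ∉ R) (hR : EqP' a p R) : Z.Mk θ' R := by
  by_cases hq : a + 4 ∈ R
  swap
  · have hqne {v : ℕ} (hv : v ∈ R) : v ≠ a + 4 := fun e => hq (e ▸ hv)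
    refine h₁ R (Or.inl hq) (hθ _ ?_)
    rcases hR with ⟨l, h1, h2, h3, h4⟩ | ⟨l, n, h1, h2, h3, h4, h5, h6, h7, h8⟩ |
      ⟨n, h1, h2, h3, h4⟩ | ⟨h1, i, hi, j, hj, h2, h3, h4⟩ |
      ⟨⟨i, hi, j, hj, h2, h3, h4⟩, n, hn, h5, h6⟩
    · exact Or.inl ⟨l, h1, h2.le, mem_collapse_of_le h3 (by omega),
        mem_collapse_of_le h4 (by omega)⟩
    · have := hqne h7
      exact Or.inr (Or.inl ⟨l, n, h1, h2.le, h3, h4, by omega, mem_collapse_of_le h6 (by omega),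
        mem_collapse_of_le h7 h5, mem_collapse_of_succ h8 le_rfl⟩)
    · have := hqne h4
      omega
    · have := hqne hi
      have := hqne hj
      refine Or.inr (Or.inr (Or.inr (Or.inl ⟨?_, i, mem_collapse_of_le hi (by omega), ?_⟩)))
      · rintro _ ⟨v, hv, rfl⟩ hv'
        have := h1 v hv
        have : v ≠ p := fun e => hpR (e ▸ hv)
        unfold collapse at hv'
        split_ifs at hv' <;> omega
      · by_cases hja : j ≤ a + 4
        · exact ⟨j, mem_collapse_of_le hj hja, by omega, by omega, by omega⟩
        · obtain rfl : j = a + 4 + 1 := by omega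
          exact ⟨a + 4, mem_collapse_of_succ hj le_rfl, by omega, by omega, by omega⟩
    · have := hqne hn
      exact Or.inr (Or.inr (Or.inr (Or.inr ⟨⟨i, mem_collapse_of_le hi (by omega), j,
        mem_collapse_of_le hj (by omega), by omega, by omega, by omega⟩, n,
        mem_collapse_of_le hn (by omega), by omega, by omega⟩)))
  by_cases hA : ∀ l ∈ R, ¬ (a ≤ l ∧ l < p)
  · by_cases hq' : a + 5 ∈ R
    · exact h₂ R hA hq hq'
    refine h₁ R (Or.inr hA) (hθ _ ?_)
    rcases hR with ⟨l, h1, h2, h3, h4⟩ | ⟨l, n, h1, h2, h3, h4, h5, h6, h7, h8⟩ |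
      ⟨n, h1, h2, h3, h4⟩ | ⟨h1, i, hi, j, hj, h2, h3, h4⟩ |
      ⟨⟨i, hi, j, hj, h2, h3, h4⟩, n, hn, h5, h6⟩
    · exact absurd ⟨h1, by omega⟩ (hA l h3)
    · exact absurd ⟨h1, h2⟩ (hA l h6)
    · refine Or.inr (Or.inr (Or.inr (Or.inl ⟨?_, n, mem_collapse_of_le h3 (by omega), n + 2,
        mem_collapse_of_le h4 (by omega), by omega, by omega, by omega⟩)))
      rintro _ ⟨v, hv, rfl⟩ hv'
      have := hA v hv
      have : v ≠ p := fun e => hpR (e ▸ hv)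
      unfold collapse at hv'
      split_ifs at hv' <;> omega
    · have : j ≠ a + 5 := fun e => hq' (e ▸ hj)
      refine Or.inr (Or.inr (Or.inr (Or.inl ⟨?_, i, mem_collapse_of_le hi (by omega), j,
        mem_collapse_of_le hj (by omega), by omega, by omega, by omega⟩)))
      rintro _ ⟨v, hv, rfl⟩ hv'
      have := hA v hv
      have : v ≠ p := fun e => hpR (e ▸ hv)
      unfold collapse at hv'
      split_ifs at hv' <;> omega
    · exact absurd ⟨h2, by omega⟩ (hA i hi)
  push Not at hA
  obtain ⟨l, hlR, hal, hlp⟩ := hA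
  have hqne : a + 4 ≠ l := by omega
  refine mk_insert_thin hZ hpR (by omega) ⟨_, hq, l, hlR, hqne⟩ ?_ ?_
  · intro R' _ hp' hnbr
    obtain ⟨i, hi, hi'⟩ := exists_pred (Set.mem_insert_of_mem p hlR) hlp
    obtain ⟨j, hj, hj'⟩ := exists_succ (p := p) (Set.mem_insert_of_mem p hq) (by omega)
    exact h₃ R' ⟨i, hnbr i hi, by omega, by omega⟩ hp' ⟨j, hnbr j hj, by omega, by omega⟩
  intro j hj
  obtain ⟨hjR, hjp, hjb⟩ := hj
  replace hjR : j ∈ R := hjR.resolve_left hjp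
  have hmem {v : ℕ} (hv : v ∈ R) (hvj : v ≠ j) : v ∈ insert p R \ {j} :=
    ⟨Or.inr hv, hvj⟩
  have hmemp : p ∈ insert p R \ {j} := ⟨Or.inl rfl, fun e => hjp e.symm⟩
  rcases lt_or_gt_of_ne hjp with hlt | hlt
  · have hlj := (hjb l (Or.inr hlR)).1
    by_cases hv : ∃ v ∈ R, v ≠ j ∧ a ≤ v ∧ v < p
    · obtain ⟨v, hv, hvj, hav, hvp⟩ := hv
      exact h₃ _ ⟨v, hmem hv hvj, hav, hvp⟩ hmemp ⟨a + 4, hmem hq (by omega), by omega, le_rfl⟩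
    push Not at hv
    -- Here `j` was the only element of `R` in `[a, p)`.
    have hA : ∀ v ∈ insert p R \ {j}, ¬ (a ≤ v ∧ v < p) := by
      rintro v ⟨rfl | hvR, hvj⟩ h
      · omega
      · have := hv v hvR hvj h.1
        omega
    by_cases hq' : a + 5 ∈ R
    · exact h₂ _ hA (hmem hq (by omega)) (hmem hq' (by omega))
    refine h₁ _ (Or.inr hA) (hθ _ ?_)
    rcases hR with ⟨l', h1, h2, h3, h4⟩ | ⟨l', n, h1, h2, h3, h4, h5, h6, h7, h8⟩ |
      ⟨n, h1, h2, h3, h4⟩ | ⟨h1, i, hi, j, hj, h2, h3, h4⟩ |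
      ⟨⟨i, hi, i', hi', h2, h3, h4⟩, n, hn, h5, h6⟩
    · by_cases e : l' = j
      · have := hv _ h4 (by omega) (by omega)
        omega
      · have := hv _ h3 e h1
        omega
    · exact absurd h8 hq'
    -- The bounds force `p = a + 1`, and `p` plays the part of `l` in the second clause of `EqP`.
    · obtain rfl : n = a + 2 := by omega
      exact Or.inr (Or.inl ⟨p, a + 2, by omega, le_rfl, by omega, by omega, by omega,
        mem_collapse_of_le hmemp (by omega), mem_collapse_of_le (hmem h3 (by omega)) (by omega),
        mem_collapse_of_le (hmem hq (by omega)) le_rfl⟩)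
    · exact absurd ⟨hal, hlp⟩ (h1 l hlR)
    · by_cases e : i = j
      · have := hv _ hi' (by omega) (by omega)
        omega
      · have := hv _ hi e h2
        omega
  · have hjq := (hjb _ (Or.inr hq)).2
    by_cases hv : ∃ v ∈ R, v ≠ j ∧ p < v ∧ v ≤ a + 4
    · obtain ⟨v, hv, hvj, hpv, hva⟩ := hv
      exact h₃ _ ⟨l, hmem hlR (by omega), hal, hlp⟩ hmemp ⟨v, hmem hv hvj, hpv, hva⟩
    push Not at hv
    -- Here `j` was the only element of `R` in `(p, a + 4]`. Without `a + 4` the face comes from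
    -- `θ`, and `p` helps to provide a pair `l`, `l + 2`.
    obtain rfl : j = a + 4 := by
      by_contra e
      have := hv _ hq (Ne.symm e) (by omega)
      omega
    refine h₁ _ (Or.inl fun h => h.2 rfl) (hθ _ (Or.inl ?_))
    rcases hR with ⟨l', h1, h2, h3, h4⟩ | ⟨l', n, h1, h2, h3, h4, h5, h6, h7, h8⟩ |
      ⟨n, h1, h2, h3, h4⟩ | ⟨h1, i, hi, j, hj, h2, h3, h4⟩ |
      ⟨⟨i, hi, i', hi', h2, h3, h4⟩, n, hn, h5, h6⟩
    · exact ⟨l', h1, h2.le, mem_collapse_of_le (hmem h3 (by omega)) (by omega),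
        mem_collapse_of_le (hmem h4 (by omega)) (by omega)⟩
    · have hn : n = a + 4 := by
        by_contra e
        have := hv _ h7 e h4
        omega
      obtain rfl : p = l' + 2 := by omega
      exact ⟨l', h1, le_rfl, mem_collapse_of_le (hmem h6 (by omega)) (by omega),
        mem_collapse_of_le hmemp (by omega)⟩
    · have := hv _ h3 (by omega) h1
      omega
    · exact absurd ⟨hal, hlp⟩ (h1 l hlR)
    · have mi := mem_collapse_of_le (q := a + 4) (hmem hi (by omega)) (by omega)
      have mi' := mem_collapse_of_le (q := a + 4) (hmem hi' (by omega)) (by omega)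
      have mp := mem_collapse_of_le (q := a + 4) hmemp (by omega)
      -- Three of the four numbers `a, …, a + 3` always include two at distance `2`.
      obtain e | e | e : i' = i + 2 ∨ p = i + 2 ∨ p = i' + 2 := by omega
      · exact ⟨i, h2, by omega, mi, e ▸ mi'⟩
      · exact ⟨i, h2, by omega, mi, e ▸ mp⟩
      · exact ⟨i', by omega, by omega, mi', e ▸ mp⟩

/-- `h₄` is what the next stage of the interpolation gives for faces without `p`. The case left over
by `h₃`, `h₄` and `hθ` is that `R` contains `p` and `a + 5` and nothing between them. Then `R` is
the face opposite to `a + 4` in `R ∪ {a + 4}`, where the neighbours of `a + 4` are `p` and `a + 5`.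
-/
theorem mk_of_twoIn_aux (hZ : IsSaturatedComplicial N Z) {n a p : ℕ} {θ : Z.toSSet _⦋n⦌}
    (han : a + 4 ≤ n) (hap : a < p) (hpa : p ≤ a + 3)
    (hθ : ∀ S, TwoIn S a (p + 1) → (∀ v ∈ S, ¬ (p < v ∧ v ≤ a + 4)) → Z.Mk θ S)
    {θ' : Z.toSSet _⦋n + 1⦌}
    (h₁ : ∀ S : Set ℕ, (a + 4 ∉ S ∨ ∀ l ∈ S, ¬ (a ≤ l ∧ l < p)) →
      Z.Mk θ (collapse (a + 4) '' S) → Z.Mk θ' S)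
    (h₂ : ∀ S : Set ℕ, (∀ l ∈ S, ¬ (a ≤ l ∧ l < p)) → a + 4 ∈ S → a + 5 ∈ S → Z.Mk θ' S)
    (h₃ : ∀ S : Set ℕ, (∃ l ∈ S, a ≤ l ∧ l < p) → p ∈ S → (∃ j ∈ S, p < j ∧ j ≤ a + 4) → Z.Mk θ' S)
    (h₄ : ∀ S : Set ℕ, p ∉ S → (TwoIn S a p ∨ TwoIn S (p + 1) (a + 6)) → Z.Mk θ' S)
    {R : Set ℕ} (hqR : a + 4 ∉ R) (hR : TwoIn R a (p + 1)) : Z.Mk θ' R := by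
  obtain ⟨l, hl, l', hl', h1, h2, h3⟩ := hR
  by_cases hp : p ∈ R
  swap
  · have : l' ≠ p := fun e => hp (e ▸ hl')
    exact h₄ R hp (Or.inl ⟨l, hl, l', hl', h1, h2, by omega⟩)
  have hlA : ∃ l ∈ R, a ≤ l ∧ l < p := ⟨l, hl, h1, by omega⟩
  by_cases hj : ∃ j ∈ R, p < j ∧ j ≤ a + 4
  · exact h₃ R hlA hp hj
  push Not at hj
  by_cases hq' : a + 5 ∈ R
  swap
  · refine h₁ R (Or.inl hqR) (hθ _ ⟨l, mem_collapse_of_le hl (by omega), l',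
      mem_collapse_of_le hl' (by omega), h1, h2, h3⟩ ?_)
    rintro _ ⟨v, hv, rfl⟩ ⟨h5, h6⟩
    have : v ≠ a + 5 := fun e => hq' (e ▸ hv)
    have := hj v hv
    unfold collapse at h5 h6
    split_ifs at h5 h6 <;> omega
  have hlq : l ≠ p := by omega
  refine mk_insert_thin hZ hqR (by omega) ⟨l, hl, p, hp, hlq⟩ ?_ ?_
  · intro R' _ hq hnbr
    have hpR' : p ∈ R' := hnbr p ⟨Or.inr hp, by omega, by
      rintro i (rfl | hi)
      · omega
      · have := hj i hi
        omega⟩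
    have hqR' : a + 5 ∈ R' := hnbr (a + 5) ⟨Or.inr hq', by omega, by
      rintro i (rfl | hi) <;> omega⟩
    by_cases hA : ∃ l ∈ R', a ≤ l ∧ l < p
    · exact h₃ R' hA hpR' ⟨a + 4, hq, by omega, le_rfl⟩
    · exact h₂ R' (fun l hl h => hA ⟨l, hl, h⟩) hq hqR'
  · rintro j ⟨hjR, hjne, hjb⟩
    replace hjR : j ∈ R := hjR.resolve_left hjne
    have hmem {v : ℕ} (hv : v ∈ R) (hvj : v ≠ j) : v ∈ insert (a + 4) R \ {j} :=
      ⟨Or.inr hv, hvj⟩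
    have hmemq : a + 4 ∈ insert (a + 4) R \ {j} := ⟨Or.inl rfl, fun e => hjne e.symm⟩
    obtain rfl | rfl : j = p ∨ j = a + 5 := by
      have := (hjb p (Or.inr hp)).1
      have := (hjb (a + 5) (Or.inr hq')).2
      have := hj j hjR
      omega
    · exact h₄ _ (fun h => h.2 rfl) (Or.inr ⟨a + 4, hmemq, a + 5, hmem hq' (by omega), by omega,
        by omega, by omega⟩)
    · exact h₃ _ ⟨l, hmem hl (by omega), h1, by omega⟩ (hmem hp (by omega))
        ⟨a + 4, hmemq, by omega, le_rfl⟩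

theorem mk_of_twoIn (hZ : IsSaturatedComplicial N Z) {n a p : ℕ} {θ : Z.toSSet _⦋n⦌}
    (han : a + 4 ≤ n) (hap : a < p) (hpa : p ≤ a + 3)
    (hθ : ∀ S, TwoIn S a (p + 1) → (∀ v ∈ S, ¬ (p < v ∧ v ≤ a + 4)) → Z.Mk θ S)
    {θ' : Z.toSSet _⦋n + 1⦌}
    (h₁ : ∀ S : Set ℕ, (a + 4 ∉ S ∨ ∀ l ∈ S, ¬ (a ≤ l ∧ l < p)) →
      Z.Mk θ (collapse (a + 4) '' S) → Z.Mk θ' S)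
    (h₂ : ∀ S : Set ℕ, (∀ l ∈ S, ¬ (a ≤ l ∧ l < p)) → a + 4 ∈ S → a + 5 ∈ S → Z.Mk θ' S)
    (h₃ : ∀ S : Set ℕ, (∃ l ∈ S, a ≤ l ∧ l < p) → p ∈ S → (∃ j ∈ S, p < j ∧ j ≤ a + 4) → Z.Mk θ' S)
    (h₄ : ∀ S : Set ℕ, p ∉ S → (TwoIn S a p ∨ TwoIn S (p + 1) (a + 6)) → Z.Mk θ' S)
    {R : Set ℕ} (hqR : a + 4 ∉ R) (hR : TwoIn R a (p + 1) ∨ TwoIn R (p + 1) (a + 6)) :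
    Z.Mk θ' R := by
  have key {R : Set ℕ} (hqR : a + 4 ∉ R) (hR : TwoIn R a (p + 1)) : Z.Mk θ' R :=
    mk_of_twoIn_aux hZ han hap hpa hθ h₁ h₂ h₃ h₄ hqR hR
  rcases hR with hR | hR
  · exact key hqR hR
  by_cases hp : p ∈ R
  swap
  · exact h₄ R hp (Or.inr hR)
  by_cases hl : ∃ l ∈ R, a ≤ l ∧ l < p
  · obtain ⟨l, hl, h1, h2⟩ := hl
    exact key hqR ⟨l, hl, p, hp, h1, h2, by omega⟩
  push Not at hl
  have hpp : p - 1 ∉ R := fun h => by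
    have := hl _ h
    omega
  -- Only `p` lies in `R ∩ [a, p]`, so it can be traded for `p - 1`: faces with both vertices fall
  -- under `key`, and the face without `p` under `h₄`.
  refine mk_insert_swap hZ (u := p) hpp (by omega) hR.nontrivial ⟨Or.inr hp, by omega, ?_⟩ ?_ ?_
  · intro i _
    omega
  · intro R' hR' hu hv
    refine key (fun h => ?_) ⟨p - 1, hv, p, hu, by omega, by omega, by omega⟩
    rcases hR' h with h | h
    · omega
    · exact hqR h
  · obtain ⟨i, hi, j, hj, h1, h2, h3⟩ := hR
    exact h₄ _ (fun h => h.2 rfl) (Or.inr ⟨i, ⟨Or.inr hi, fun (e : i = p) => by omega⟩,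
      j, ⟨Or.inr hj, fun (e : j = p) => by omega⟩, h1, h2, h3⟩)

/-- The two-sided saturation property for the `3`-simplex on the vertices `a, …, a + 3` of an
`n`-simplex. -/
def SaturatedAt (Z : MSSet.{u}) (a n : ℕ) : Prop :=
  ∀ θ : Z.toSSet _⦋n⦌, (∀ S, EqC a S → Z.Mk θ S) → ∀ S, TwoIn S a (a + 4) → Z.Mk θ S

/-- At stage `i` the vertices `a, …, a + i` have not been moved; stage `0` is settled by `h`. In the
larger simplex `θ'`, omitting the inserted vertex `a + 4` gives stage `i + 1` and omitting `a + (i +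
1)` gives stage `i`. -/
theorem saturatedAt_interpolation (hZ : IsSaturatedComplicial N Z) {n a : ℕ} (han : a + 4 ≤ n)
    (h : SaturatedAt Z (a + 1) n) (i : ℕ) (hi : i ≤ 3) (θ : Z.toSSet _⦋n⦌)
    (hθ : ∀ S, EqP a (a + i) S → Z.Mk θ S)
    (hθ' : ∀ S, TwoIn S a (a + i + 1) → (∀ v ∈ S, ¬ (a + i < v ∧ v ≤ a + 4)) → Z.Mk θ S)
    (S : Set ℕ) (hS : TwoIn S a (a + i + 1) ∨ TwoIn S (a + i + 1) (a + 5)) : Z.Mk θ S := by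
  induction i generalizing θ S with
  | zero =>
    refine h θ (fun S hS => hθ S ?_) S (hS.resolve_left ?_)
    · rcases hS with ⟨h1, h2⟩ | ⟨h1, h2⟩
      · exact Or.inr (Or.inr (Or.inl ⟨a + 1, by omega, by omega, h1, h2⟩))
      · by_cases ha : a ∈ S
        · exact Or.inr (Or.inl ⟨a, a + 2, by omega, by omega, by omega, by omega, by omega,
            ha, h1, h2⟩)
        · refine Or.inr (Or.inr (Or.inr (Or.inl ⟨fun l hl h => ha ?_, a + 2, h1, a + 4, h2,
            by omega, by omega, by omega⟩)))
          rwa [show a = l by omega]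
    · rintro ⟨l, -, l', -, h1, h2, h3⟩
      omega
  | succ i ih =>
    obtain ⟨θ', rfl, h₁, h₂, h₃⟩ := exists_insert hZ (a := a) (p := a + (i + 1)) (q := a + 4) θ
      (by omega) han (fun S ⟨l, hl, h1, h2⟩ hp ⟨j, hj, h3, h4⟩ => hθ S
        (Or.inr (Or.inr (Or.inr (Or.inr ⟨⟨l, hl, _, hp, h1, h2, by omega⟩, j, hj, h3, h4⟩)))))
    apply mk_map
    refine mk_of_twoIn hZ han (by omega) (by omega) hθ' h₁ h₂ h₃ (fun R hpR hR => ?_)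
      (notMem_skip_image _ S) (hS.imp ?_ ?_)
    · refine mk_of_skip (q := a + (i + 1)) (by omega) hpR (ih (by omega) _ (fun S hS => mk_map ?_)
        (fun S hS hS' => mk_map (h₁ _ (Or.inl ?_) (hθ' _ ?_ ?_))) _ (hR.imp ?_ ?_))
      · exact mk_of_eqP' hZ han (by omega) (by omega) hθ h₁ h₂ h₃ (notMem_skip_image _ S)
          (EqP.image_skip (p := a + i) (by omega) hS)
      · rintro ⟨v, hv, h⟩
        have := hS' v hv
        unfold skip at h
        split_ifs at h <;> omega
      · obtain ⟨l, hl, l', hl', h1, h2, h3⟩ := hS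
        exact ⟨l, mem_collapse_of_le (mem_skip_of_lt hl (by omega)) (by omega), l',
          mem_collapse_of_le (mem_skip_of_lt hl' (by omega)) (by omega), h1, h2, by omega⟩
      · rintro _ ⟨_, ⟨v, hv, rfl⟩, rfl⟩ h
        have := hS' v hv
        unfold skip collapse at h
        split_ifs at h <;> omega
      · rintro ⟨l, hl, l', hl', h1, h2, h3⟩
        exact ⟨l, mem_collapse_of_le hl (by omega), l', mem_collapse_of_le hl' (by omega), h1, h2,
          by omega⟩
      · rintro ⟨l, hl, l', hl', h1, h2, h3⟩
        exact ⟨l - 1, ⟨l, hl, collapse_of_lt (by omega)⟩, l' - 1, ⟨l', hl', collapse_of_lt (by omega)⟩,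
          by omega, by omega, by omega⟩
    · rintro ⟨l, hl, l', hl', h1, h2, h3⟩
      exact ⟨l, mem_skip_of_lt hl (by omega), l', mem_skip_of_lt hl' (by omega), h1, h2, h3⟩
    · rintro ⟨l, hl, l', hl', h1, h2, h3⟩
      refine ⟨l, mem_skip_of_lt hl (by omega), ?_⟩
      by_cases h4 : l' < a + 4
      · exact ⟨l', mem_skip_of_lt hl' h4, by omega, by omega, by omega⟩
      · exact ⟨l' + 1, mem_skip_of_le hl' (by omega), by omega, by omega, by omega⟩

/-- One-sided saturation implies two-sided saturation. -/
theorem saturatedAt_of_saturatedAt_last (hZ : IsSaturatedComplicial N Z)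
    (h₀ : ∀ a, SaturatedAt Z a (a + 3)) (b : ℕ) : ∀ a n, n = a + 3 + b → SaturatedAt Z a n := by
  induction b with
  | zero =>
    rintro a _ rfl
    exact h₀ a
  | succ b ih =>
    rintro a _ rfl θ hθ S hS
    -- At stage `3` the condition `EqP` reduces to `EqC a`. The `3`-simplex on `a + 1, …, a + 4` has
    -- one vertex fewer behind it, so the induction hypothesis covers it.
    refine saturatedAt_interpolation hZ (by omega) (ih (a + 1) (a + 3 + (b + 1)) (by omega)) 3 le_rfl
      θ (fun S hS => hθ S ?_) (fun S hS hS' => ?_) S (Or.inl hS)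
    · rcases hS with ⟨l, h1, h2, h3, h4⟩ | ⟨l, n, h1, h2, h3, h4, h5, h6, h7, h8⟩ |
        ⟨n, h1, h2, h3, h4⟩ | ⟨h1, i, hi, j, hj, h2, h3, h4⟩ |
        ⟨⟨i, hi, j, hj, h2, h3, h4⟩, n, hn, h5, h6⟩
      · obtain rfl | rfl : l = a ∨ l = a + 1 := by omega
        · exact Or.inl ⟨h3, h4⟩
        · exact Or.inr ⟨h3, h4⟩
      all_goals omega
    -- Faces without `a + 4` live in the simplex with this vertex omitted, to which the induction
    -- hypothesis applies directly.
    · have hq : a + 4 ∉ S := fun h => hS' _ h ⟨Nat.lt_add_one (a + 3), le_rfl⟩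
      refine mk_of_skip (q := a + 4) (n := a + 3 + b) (by omega) hq
        (ih a _ rfl _ (fun S hS => mk_map (hθ _ ?_)) _ ?_)
      · exact hS.imp
          (fun h => ⟨mem_skip_of_lt h.1 (by omega), mem_skip_of_lt h.2 (by omega)⟩)
          (fun h => ⟨mem_skip_of_lt h.1 (by omega), mem_skip_of_lt h.2 (by omega)⟩)
      · obtain ⟨l, hl, l', hl', h1, h2, h3⟩ := hS
        exact ⟨l, mem_collapse_of_le hl (by omega), l', mem_collapse_of_le hl' (by omega), h1, h2,
          by omega⟩

/-! ### The join with a `3`-simplex is a simplex -/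

/-- The vertices of a simplex of `Δ[a - 1]`. -/
def avtx (a : ℕ) {k : ℕ} (x : (simplexOnVertices.{u} a).toSSet _⦋k⦌) (i : Fin (k + 1)) : ℕ :=
  match a, x with
  -- A default value: `Δ[-1]` has no simplices.
  | 0, _ => 0
  | _ + 1, x => vtx (SSet.stdSimplex.objEquiv x) i

theorem avtx_map (a : ℕ) {k l : ℕ} (x : (simplexOnVertices.{u} a).toSSet _⦋k⦌) (f : ⦋l⦌ ⟶ ⦋k⦌)
    (i : Fin (l + 1)) :
    avtx a ((simplexOnVertices.{u} a).toSSet.map f.op x) i = avtx a x (f.toOrderHom i) := by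
  cases a <;> rfl

theorem avtx_lt (a : ℕ) {k : ℕ} (x : (simplexOnVertices.{u} a).toSSet _⦋k⦌) (i : Fin (k + 1)) :
    avtx a x i < a := by
  cases a with
  | zero => exact PEmpty.elim x
  | succ a => exact Nat.lt_succ_iff.mpr (vtx_le _ i)

theorem avtx_mono (a : ℕ) {k : ℕ} (x : (simplexOnVertices.{u} a).toSSet _⦋k⦌) {i j : Fin (k + 1)}
    (h : i ≤ j) : avtx a x i ≤ avtx a x j := by
  cases a with
  | zero => exact PEmpty.elim x
  | succ a => exact vtx_mono _ h

theorem avtx_ext (a : ℕ) {k : ℕ} {x y : (simplexOnVertices.{u} a).toSSet _⦋k⦌}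
    (h : ∀ i, avtx a x i = avtx a y i) : x = y := by
  cases a with
  | zero => exact PEmpty.elim x
  | succ a => exact SSet.stdSimplex.objEquiv.injective (hom_ext_vtx h)

theorem exists_avtx_eq (a : ℕ) {k : ℕ} (g : Fin (k + 1) → ℕ) (hg : Monotone g)
    (hga : ∀ i, g i < a) : ∃ x : (simplexOnVertices.{u} a).toSSet _⦋k⦌, ∀ i, avtx a x i = g i := by
  cases a with
  | zero => exact absurd (hga 0) (Nat.not_lt_zero _)
  | succ a =>
    exact ⟨SSet.stdSimplex.objEquiv.symm (SimplexCategory.Hom.mk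
      ⟨fun i => ⟨g i, hga i⟩, fun i j h => hg h⟩), fun i => rfl⟩

theorem not_injective_avtx_of_mem_degenerate (a : ℕ) {k : ℕ}
    {x : (simplexOnVertices.{u} a).toSSet _⦋k⦌}
    (hx : x ∈ (simplexOnVertices.{u} a).toSSet.degenerate k) :
    ¬ Function.Injective (avtx a x) := by
  obtain ⟨m, hm, f, y, rfl⟩ := hx
  intro h
  have hf : Function.Injective f.toOrderHom := fun i j hij => h (by
    rw [avtx_map, avtx_map, hij])
  have := Fintype.card_le_of_injective _ hf
  simp at this
  omega

section cutFiber

variable {n : SimplexCategory} {χ : Fin (n.len + 1) →o Fin 2} {ε : Fin 2} {a : ℕ}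

/-- A vertex of `cutFiber χ ε`. -/
def fiberVtx (χ : Fin (n.len + 1) →o Fin 2) (ε : Fin 2) (i : Fin (n.len + 1)) (h : χ i = ε) :
    (cutFiber.{u} χ ε : SSet.{u}) _⦋0⦌ :=
  ⟨SSet.stdSimplex.objEquiv.symm (SimplexCategory.const ⦋0⦌ n i), fun _ => h⟩

/-- The value of a map to `Δ[a - 1]` at a vertex. -/
def fiberVal (f : (cutFiber.{u} χ ε : SSet.{u}) ⟶ (simplexOnVertices.{u} a).toSSet)
    (i : Fin (n.len + 1)) (h : χ i = ε) : ℕ :=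
  avtx a (f.app (op ⦋0⦌) (fiberVtx χ ε i h)) 0

theorem avtx_app (f : (cutFiber.{u} χ ε : SSet.{u}) ⟶ (simplexOnVertices.{u} a).toSSet) {k : ℕ}
    (s : (cutFiber.{u} χ ε : SSet.{u}) _⦋k⦌) (j : Fin (k + 1)) :
    avtx a (f.app (op ⦋k⦌) s) j =
      fiberVal f ((SSet.stdSimplex.objEquiv s.1).toOrderHom j) (s.2 j) := by
  have h := avtx_map a (f.app (op ⦋k⦌) s) (SimplexCategory.const ⦋0⦌ ⦋k⦌ j) 0
  rw [← NatTrans.naturality_apply] at h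
  exact h.symm

theorem fiberVal_mono (f : (cutFiber.{u} χ ε : SSet.{u}) ⟶ (simplexOnVertices.{u} a).toSSet)
    {i j : Fin (n.len + 1)} (hi : χ i = ε) (hj : χ j = ε) (hij : i ≤ j) :
    fiberVal f i hi ≤ fiberVal f j hj := by
  let s : (cutFiber.{u} χ ε : SSet.{u}) _⦋1⦌ :=
    ⟨SSet.stdSimplex.objEquiv.symm (SimplexCategory.mkOfLe i j hij), fun v => by
      fin_cases v
      exacts [hi, hj]⟩
  have h := avtx_mono a (f.app (op ⦋1⦌) s) (i := 0) (j := 1) (by decide)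
  rw [avtx_app, avtx_app] at h
  exact h

theorem fiberVal_lt (f : (cutFiber.{u} χ ε : SSet.{u}) ⟶ (simplexOnVertices.{u} a).toSSet)
    {i : Fin (n.len + 1)} (hi : χ i = ε) : fiberVal f i hi < a := avtx_lt a _ _

theorem cutFiber_hom_ext {f g : (cutFiber.{u} χ ε : SSet.{u}) ⟶ (simplexOnVertices.{u} a).toSSet}
    (h : ∀ i hi, fiberVal f i hi = fiberVal g i hi) : f = g := by
  ext k s
  refine avtx_ext a (k := k.unop.len) fun j => ?_
  exact (avtx_app f s j).trans ((h _ _).trans (avtx_app g s j).symm)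

theorem exists_fiberVal_eq (g : Fin (n.len + 1) → ℕ) (hg : Monotone g)
    (hga : ∀ i, χ i = ε → g i < a) :
    ∃ f : (cutFiber.{u} χ ε : SSet.{u}) ⟶ (simplexOnVertices.{u} a).toSSet,
      ∀ i hi, fiberVal f i hi = g i := by
  have H (k : ℕ) (s : (cutFiber.{u} χ ε : SSet.{u}) _⦋k⦌) :=
    exists_avtx_eq a (fun j => g ((SSet.stdSimplex.objEquiv s.1).toOrderHom j))
      (fun i j hij => hg ((SSet.stdSimplex.objEquiv s.1).toOrderHom.monotone hij))
      (fun j => hga _ (s.2 j))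
  choose F hF using H
  refine ⟨{ app := fun k => ↾fun s => F k.unop.len s, naturality := ?_ }, fun i hi => hF 0 _ 0⟩
  intro k l f
  ext s
  refine avtx_ext a (k := l.unop.len) fun j => ?_
  refine (hF _ _ j).trans ?_
  refine Eq.trans ?_ (avtx_map a (F k.unop.len s) f.unop j).symm
  exact (hF k.unop.len s _).symm

end cutFiber

/-- The underlying simplicial set of `Δ[a - 1] ⋆ Δ[3]`. -/
abbrev joinThree (a : ℕ) : SSet.{u} :=
  joinSSet (simplexOnVertices.{u} a).toSSet (simplexOnVertices.{u} 4).toSSet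

section

variable {a : ℕ} {n : SimplexCategory}

theorem eq_one_of_ne_zero {e : Fin 2} (h : e ≠ 0) : e = 1 := by omega

/-- The vertices of a simplex of `Δ[a - 1] ⋆ Δ[3]`. -/
def jvtx (σ : JoinSimplex (simplexOnVertices.{u} a).toSSet (simplexOnVertices.{u} 4).toSSet n)
    (i : Fin (n.len + 1)) : ℕ :=
  if h : σ.cut i = 0 then fiberVal σ.left i h else a + fiberVal σ.right i (eq_one_of_ne_zero h)

variable (σ : JoinSimplex (simplexOnVertices.{u} a).toSSet (simplexOnVertices.{u} 4).toSSet n)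

theorem jvtx_of_eq_zero {i : Fin (n.len + 1)} (h : σ.cut i = 0) :
    jvtx σ i = fiberVal σ.left i h := dif_pos h

theorem jvtx_of_eq_one {i : Fin (n.len + 1)} (h : σ.cut i = 1) :
    jvtx σ i = a + fiberVal σ.right i h := dif_neg (by rw [h]; decide)

theorem jvtx_lt_iff (i : Fin (n.len + 1)) : jvtx σ i < a ↔ σ.cut i = 0 := by
  by_cases h : σ.cut i = 0
  · rw [jvtx_of_eq_zero σ h]
    exact iff_of_true (fiberVal_lt _ h) h
  · rw [jvtx_of_eq_one σ (eq_one_of_ne_zero h)]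
    exact iff_of_false (by omega) h

theorem jvtx_lt (i : Fin (n.len + 1)) : jvtx σ i < a + 4 := by
  by_cases h : σ.cut i = 0
  · have := (jvtx_lt_iff σ i).mpr h
    omega
  · rw [jvtx_of_eq_one σ (eq_one_of_ne_zero h)]
    have := fiberVal_lt σ.right (eq_one_of_ne_zero h)
    omega

theorem jvtx_monotone : Monotone (jvtx σ) := by
  intro i j hij
  by_cases hj : σ.cut j = 0
  · have hi : σ.cut i = 0 := le_antisymm ((σ.cut.monotone hij).trans hj.le) (Fin.zero_le _)
    rw [jvtx_of_eq_zero σ hi, jvtx_of_eq_zero σ hj]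
    exact fiberVal_mono _ hi hj hij
  · by_cases hi : σ.cut i = 0
    · have h1 := (jvtx_lt_iff σ i).mpr hi
      have h2 := (jvtx_lt_iff σ j).not.mpr hj
      omega
    · rw [jvtx_of_eq_one σ (eq_one_of_ne_zero hi), jvtx_of_eq_one σ (eq_one_of_ne_zero hj)]
      exact Nat.add_le_add_left (fiberVal_mono _ _ _ hij) a

theorem joinSimplex_ext
    {σ τ : JoinSimplex (simplexOnVertices.{u} a).toSSet (simplexOnVertices.{u} 4).toSSet n}
    (h : ∀ i, jvtx σ i = jvtx τ i) : σ = τ := by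
  have hc : σ.cut = τ.cut := by
    ext i
    have hi := jvtx_lt_iff σ i
    rw [h, jvtx_lt_iff] at hi
    by_cases h0 : τ.cut i = 0
    · rw [h0, hi.mp h0]
    · rw [eq_one_of_ne_zero h0, eq_one_of_ne_zero (mt hi.mpr h0)]
  obtain ⟨χ, x, y⟩ := σ
  obtain ⟨χ', x', y'⟩ := τ
  obtain rfl : χ = χ' := hc
  congr 1
  · refine cutFiber_hom_ext fun i hi => ?_
    have := h i
    rwa [jvtx_of_eq_zero _ hi, jvtx_of_eq_zero _ hi] at this
  · refine cutFiber_hom_ext fun i hi => ?_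
    have := h i
    rw [jvtx_of_eq_one _ hi, jvtx_of_eq_one _ hi] at this
    exact Nat.add_left_cancel this

/-- A simplex of `Δ[a - 1] ⋆ Δ[3]` as a morphism in the simplex category. -/
def jhom : n ⟶ ⦋a + 3⦌ :=
  SimplexCategory.Hom.mk ⟨fun i => ⟨jvtx σ i, jvtx_lt σ i⟩, fun _ _ h => jvtx_monotone σ h⟩

end

theorem jhom_map {a k l : ℕ} (σ : (joinThree.{u} a) _⦋k⦌) (f : ⦋l⦌ ⟶ ⦋k⦌) :
    jhom (n := ⦋l⦌) ((joinThree.{u} a).map f.op σ) = f ≫ jhom (n := ⦋k⦌) σ := rfl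

theorem exists_jhom_eq_id (a : ℕ) :
    ∃ J : (joinThree.{u} a) _⦋a + 3⦌, jhom (n := ⦋a + 3⦌) J = 𝟙 _ := by
  let χ : Fin (a + 3 + 1) →o Fin 2 :=
    ⟨fun i => if i.val < a then 0 else 1, fun i j h => by
      have h' : i.val ≤ j.val := h
      beta_reduce
      split_ifs
      · exact le_rfl
      · exact Fin.zero_le _
      · omega
      · exact le_rfl⟩
  obtain ⟨f, hf⟩ := exists_fiberVal_eq.{u} (n := ⦋a + 3⦌) (χ := χ) (ε := 0) (a := a)
    (fun i => i.val) (fun i j h => h) (fun i (hi : (if i.val < a then 0 else 1 : Fin 2) = 0) => by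
      by_contra h
      rw [if_neg h] at hi
      exact absurd hi (by decide))
  obtain ⟨g, hg⟩ := exists_fiberVal_eq.{u} (n := ⦋a + 3⦌) (χ := χ) (ε := 1) (a := 4)
    (fun i => i.val - a) (fun i j h => Nat.sub_le_sub_right h a) (fun i _ => by
      have : i.val < a + 3 + 1 := i.isLt
      omega)
  refine ⟨⟨χ, f, g⟩, hom_ext_vtx fun i => ?_⟩
  change jvtx (n := ⦋a + 3⦌) (⟨χ, f, g⟩ : JoinSimplex _ _ ⦋a + 3⦌) i = i.val
  by_cases h : i.val < a
  · exact (jvtx_of_eq_zero _ (if_pos h)).trans (hf _ _)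
  · refine (jvtx_of_eq_one _ (if_neg h)).trans ?_
    rw [hg]
    omega

/-- The simplex of `Δ[a - 1] ⋆ Δ[3]` that contains all vertices. -/
noncomputable def joinTop (a : ℕ) : (joinThree.{u} a) _⦋a + 3⦌ := (exists_jhom_eq_id a).choose

theorem jhom_map_joinTop (a : ℕ) {k : ℕ} (x : ⦋k⦌ ⟶ ⦋a + 3⦌) :
    jhom (n := ⦋k⦌) ((joinThree.{u} a).map x.op (joinTop a)) = x := by
  rw [jhom_map, joinTop, (exists_jhom_eq_id a).choose_spec, Category.comp_id]

/-- A simplex of the join is determined by its vertices. With `jhom_map_joinTop` this identifies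
`Δ[a - 1] ⋆ Δ[3]` with `Δ[a + 3]`. -/
theorem map_jhom_joinTop {a k : ℕ} (σ : (joinThree.{u} a) _⦋k⦌) :
    (joinThree.{u} a).map (jhom (n := ⦋k⦌) σ).op (joinTop a) = σ := by
  refine joinSimplex_ext (n := ⦋k⦌) fun i => ?_
  exact congrArg (fun f => vtx f i) (jhom_map_joinTop a (jhom (n := ⦋k⦌) σ))

/-! ### The marking of the join with a `3`-simplex -/

section

variable {a k : ℕ} (σ : (joinThree.{u} a) _⦋k⦌)

theorem jvtx_mem_vset (i : Fin (k + 1)) : jvtx (n := ⦋k⦌) σ i ∈ vset (jhom (n := ⦋k⦌) σ) := ⟨i, rfl⟩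

theorem not_injective_avtx_of_marked {x : (simplexOnVertices.{u} a).toSSet _⦋k⦌}
    (hx : x ∈ (simplexOnVertices.{u} a).marked k) : ¬ Function.Injective (avtx a x) := by
  cases a with
  | zero => exact PEmpty.elim x
  | succ a =>
    exact not_injective_avtx_of_mem_degenerate (a + 1) (hx.resolve_right fun h => h.2)

theorem avtx_left_app {d : ℕ} (s : (cutFiber.{u} (n := ⦋k⦌) σ.cut 0 : SSet.{u}) _⦋d⦌)
    (j : Fin (d + 1)) : avtx a (σ.left.app (op ⦋d⦌) s) j =
      jvtx (n := ⦋k⦌) σ ((SSet.stdSimplex.objEquiv s.1).toOrderHom j) :=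
  (avtx_app _ _ _).trans (jvtx_of_eq_zero (n := ⦋k⦌) σ (s.2 j)).symm

theorem avtx_right_app {d : ℕ} (s : (cutFiber.{u} (n := ⦋k⦌) σ.cut 1 : SSet.{u}) _⦋d⦌)
    (j : Fin (d + 1)) : a + avtx 4 (σ.right.app (op ⦋d⦌) s) j =
      jvtx (n := ⦋k⦌) σ ((SSet.stdSimplex.objEquiv s.1).toOrderHom j) :=
  (congrArg (a + ·) (avtx_app _ _ _)).trans (jvtx_of_eq_one (n := ⦋k⦌) σ (s.2 j)).symm

/-- Any three of the vertices `0, 1, 2, 3` include `0, 2` or `1, 3`; hence the marked `2`- and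
`3`-simplices of `Δ[3]_eq` need no clause of their own in `EqC`. -/
theorem eqC_of_injective {S : Set ℕ} {d : ℕ} (hd : 2 ≤ d) (g : Fin (d + 1) → ℕ)
    (hg : Function.Injective g) (hg4 : ∀ j, g j < 4) (hS : ∀ j, a + g j ∈ S) : EqC a S := by
  classical
  by_contra h
  have h1 : Finset.univ.image g ⊆ Finset.range 4 := by
    intro v hv
    obtain ⟨j, -, rfl⟩ := Finset.mem_image.mp hv
    exact Finset.mem_range.mpr (hg4 j)
  have h2 : (Finset.univ.image g).card = d + 1 := by
    rw [Finset.card_image_of_injective _ hg, Finset.card_univ, Fintype.card_fin]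
  have hm (v : ℕ) (hv : v ∈ Finset.univ.image g) : a + v ∈ S := by
    obtain ⟨j, -, rfl⟩ := Finset.mem_image.mp hv
    exact hS j
  have h02 : ¬ (0 ∈ Finset.univ.image g ∧ 2 ∈ Finset.univ.image g) :=
    fun h' => h (Or.inl ⟨hm 0 h'.1, hm 2 h'.2⟩)
  have h13 : ¬ (1 ∈ Finset.univ.image g ∧ 3 ∈ Finset.univ.image g) :=
    fun h' => h (Or.inr ⟨hm 1 h'.1, hm 3 h'.2⟩)
  have key : ∀ T ∈ (Finset.range 4).powerset, 3 ≤ T.card →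
      (0 ∈ T ∧ 2 ∈ T) ∨ (1 ∈ T ∧ 3 ∈ T) := by decide
  exact (key _ (Finset.mem_powerset.mpr h1) (by omega)).elim h02 h13

theorem of_mem_marked_joinEq {σ : (joinThree.{u} a) _⦋k⦌}
    (hσ : σ ∈ (join (simplexOnVertices.{u} a) simplexThreeEq).marked k) :
    ¬ Function.Injective (vtx (jhom (n := ⦋k⦌) σ)) ∨ EqC a (vset (jhom (n := ⦋k⦌) σ)) := by
  by_contra hn
  rw [not_or, not_not] at hn
  obtain ⟨hinj, hn⟩ := hn
  rcases hσ with hσ | ⟨-, ⟨d, s, hs, -, hm⟩ | ⟨d, s, hs, -, hm⟩⟩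
  · obtain ⟨m, hm, f, τ, rfl⟩ := hσ
    have hf : Function.Injective f.toOrderHom := fun i j hij =>
      hinj (congrArg (vtx (jhom (n := ⦋m⦌) τ)) hij)
    have := Fintype.card_le_of_injective _ hf
    simp at this
    omega
  · refine not_injective_avtx_of_marked hm fun i j hij => hs (hinj ?_)
    rw [avtx_left_app, avtx_left_app] at hij
    exact hij
  · have hi : Function.Injective (avtx 4 (σ.right.app (op ⦋d⦌) s)) := by
      intro i j hij
      apply hs
      apply hinj
      have hij' := congrArg (a + ·) hij
      beta_reduce at hij'
      rw [avtx_right_app, avtx_right_app] at hij'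
      exact hij'
    have hS (j : Fin (d + 1)) : a + avtx 4 (σ.right.app (op ⦋d⦌) s) j ∈
        vset (jhom (n := ⦋k⦌) σ) := by
      rw [avtx_right_app]
      exact ⟨_, rfl⟩
    rcases hm with hm | ⟨hd, hm⟩
    · exact not_injective_avtx_of_mem_degenerate 4 hm hi
    · have key (u v : Fin 4) (h : Set.range (fun j => (SSet.stdSimplex.objEquiv
          (n := ⦋3⦌) (σ.right.app (op ⦋d⦌) s)).toOrderHom j) = {u, v}) :
          a + u.val ∈ vset (jhom (n := ⦋k⦌) σ) ∧ a + v.val ∈ vset (jhom (n := ⦋k⦌) σ) := by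
        obtain ⟨i, hi⟩ := h.ge (Set.mem_insert u {v})
        obtain ⟨j, hj⟩ := h.ge (Set.mem_insert_of_mem u rfl)
        refine ⟨?_, ?_⟩
        · rw [← hi]
          exact hS i
        · rw [← hj]
          exact hS j
      rcases hm with hm | hm | hm
      · exact hn (eqC_of_injective hm _ hi (avtx_lt 4 _) hS)
      · exact hn (Or.inl (key 0 2 hm))
      · exact hn (Or.inr (key 1 3 hm))

theorem of_mem_marked_joinSharp {σ : (joinThree.{u} a) _⦋k⦌}
    (hσ : σ ∈ (join (simplexOnVertices.{u} a) simplexThreeSharp).marked k) :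
    ¬ Function.Injective (vtx (jhom (n := ⦋k⦌) σ)) ∨
      TwoIn (vset (jhom (n := ⦋k⦌) σ)) a (a + 4) := by
  by_contra hn
  rw [not_or, not_not] at hn
  obtain ⟨hinj, hn⟩ := hn
  rcases hσ with hσ | ⟨-, ⟨d, s, hs, -, hm⟩ | ⟨d, s, hs, -, hm⟩⟩
  · exact (of_mem_marked_joinEq (Or.inl hσ)).elim (fun h => h hinj) fun h => hn (h.elim
      (fun h => ⟨a, h.1, a + 2, h.2, by omega, by omega, by omega⟩)
      (fun h => ⟨a + 1, h.1, a + 3, h.2, by omega, by omega, by omega⟩))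
  · refine not_injective_avtx_of_marked hm fun i j hij => hs (hinj ?_)
    rw [avtx_left_app, avtx_left_app] at hij
    exact hij
  · have hd : 0 < d := pos_of_mem_marked _ hm
    have h0 := avtx_right_app σ s 0
    have h1 := avtx_right_app σ s (Fin.last d)
    have hne : (0 : Fin (d + 1)) ≠ Fin.last d := fun h => by
      have := congrArg Fin.val h
      simp at this
      omega
    have hne' : avtx 4 (σ.right.app (op ⦋d⦌) s) 0 ≠ avtx 4 (σ.right.app (op ⦋d⦌) s) (Fin.last d) :=
      fun h => hne (hs (hinj (by
        change jvtx (n := ⦋k⦌) σ _ = jvtx (n := ⦋k⦌) σ _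
        rw [← h0, ← h1, h])))
    have hle := avtx_mono 4 (σ.right.app (op ⦋d⦌) s) (Fin.zero_le (Fin.last d))
    have hlt := avtx_lt 4 (σ.right.app (op ⦋d⦌) s) (Fin.last d)
    refine hn ⟨_, h0 ▸ jvtx_mem_vset σ _, _, h1 ▸ jvtx_mem_vset σ _, by omega, by omega, by omega⟩

theorem mem_degenerate_joinThree {σ : (joinThree.{u} a) _⦋k⦌}
    (hσ : ¬ Function.Injective (vtx (jhom (n := ⦋k⦌) σ))) :
    σ ∈ (joinThree.{u} a).degenerate k := by
  rw [← map_jhom_joinTop σ]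
  exact map_mem_degenerate _ _ hσ

theorem exists_enum_right {i₀ : Fin (k + 1)} (hi₀ : a ≤ jvtx (n := ⦋k⦌) σ i₀) :
    ∃ (d : ℕ) (s : (cutFiber.{u} (n := ⦋k⦌) σ.cut 1 : SSet.{u}) _⦋d⦌),
      Function.Injective (SSet.stdSimplex.objEquiv s.1).toOrderHom ∧
      (∀ i, σ.cut i = 1 → i ∈ Set.range (SSet.stdSimplex.objEquiv s.1).toOrderHom) ∧
      ∀ v ∈ vset (jhom (n := ⦋k⦌) σ), a ≤ v →
        ∃ j, a + avtx 4 (σ.right.app (op ⦋d⦌) s) j = v := by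
  have hcut (i : Fin (k + 1)) (hi : a ≤ jvtx (n := ⦋k⦌) σ i) : σ.cut i = 1 :=
    eq_one_of_ne_zero fun h => absurd ((jvtx_lt_iff (n := ⦋k⦌) σ i).mpr h) (not_lt.mpr hi)
  obtain ⟨d, τ, hτ, hτS⟩ := exists_enum (n := k)
    (S := {v | ∃ i : Fin (k + 1), i.val = v ∧ σ.cut i = 1})
    (by rintro _ ⟨i, rfl, -⟩; exact Nat.lt_succ_iff.mp i.isLt) ⟨_, i₀, rfl, hcut i₀ hi₀⟩
  have hsurj (i : Fin (k + 1)) (hi : σ.cut i = 1) : ∃ j, τ.toOrderHom j = i := by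
    obtain ⟨j, hj⟩ := hτS.ge ⟨i, rfl, hi⟩
    exact ⟨j, Fin.ext hj⟩
  let s : (cutFiber.{u} (n := ⦋k⦌) σ.cut 1 : SSet.{u}) _⦋d⦌ :=
    ⟨SSet.stdSimplex.objEquiv.symm τ, fun j => by
      obtain ⟨i, hi, hi'⟩ := hτS.le (vtx_mem τ j)
      obtain rfl : i = τ.toOrderHom j := Fin.ext hi
      exact hi'⟩
  refine ⟨d, s, fun i j hij => hτ (congrArg Fin.val hij), hsurj, ?_⟩
  rintro _ ⟨i, rfl⟩ hi
  obtain ⟨j, rfl⟩ := hsurj i (hcut i hi)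
  exact ⟨j, avtx_right_app σ s j⟩

theorem mem_marked_joinSharp {σ : (joinThree.{u} a) _⦋k⦌}
    (hσ : TwoIn (vset (jhom (n := ⦋k⦌) σ)) a (a + 4)) :
    σ ∈ (join (simplexOnVertices.{u} a) simplexThreeSharp).marked k := by
  obtain ⟨i, hi, j, hj, h1, h2, h3⟩ := hσ
  obtain ⟨i₀, rfl⟩ := id hi
  obtain ⟨j₀, rfl⟩ := id hj
  obtain ⟨d, s, hs, hs', hv⟩ := exists_enum_right σ h1
  obtain ⟨i', hi'⟩ := hv _ hi h1
  obtain ⟨j', hj'⟩ := hv _ hj (by omega)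
  have hij : i' ≠ j' := by
    rintro rfl
    omega
  have hij₀ : i₀ ≠ j₀ := by
    rintro rfl
    omega
  exact Or.inr ⟨by omega, Or.inr ⟨d, s, hs, hs', Or.inr ⟨by omega, Set.mem_univ _⟩⟩⟩

theorem mem_marked_joinEq {σ : (joinThree.{u} a) _⦋k⦌}
    (hσ : EqC a (vset (jhom (n := ⦋k⦌) σ))) :
    σ ∈ (join (simplexOnVertices.{u} a) simplexThreeEq).marked k := by
  have key (u v : Fin 4) (huv : u ≠ v) (hu : a + u.val ∈ vset (jhom (n := ⦋k⦌) σ))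
      (hv : a + v.val ∈ vset (jhom (n := ⦋k⦌) σ)) :
      ∃ (d : ℕ) (s : (cutFiber.{u} (n := ⦋k⦌) σ.cut 1 : SSet.{u}) _⦋d⦌),
      Function.Injective (SSet.stdSimplex.objEquiv s.1).toOrderHom ∧
      (∀ i, σ.cut i = 1 → i ∈ Set.range (SSet.stdSimplex.objEquiv s.1).toOrderHom) ∧ 0 < d ∧
      (2 ≤ d ∨ Set.range (fun j => (SSet.stdSimplex.objEquiv
          (n := ⦋3⦌) (σ.right.app (op ⦋d⦌) s)).toOrderHom j) = {u, v}) := by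
    obtain ⟨i₀, hi₀⟩ := id hu
    obtain ⟨d, s, hs, hs', H⟩ := exists_enum_right σ (i₀ := i₀) (by
      change vtx _ i₀ = _ at hi₀
      change a ≤ vtx (jhom (n := ⦋k⦌) σ) i₀
      omega)
    obtain ⟨i', hi'⟩ := H _ hu (by omega)
    obtain ⟨j', hj'⟩ := H _ hv (by omega)
    have huv' : u.val ≠ v.val := fun h => huv (Fin.ext h)
    have hij : i' ≠ j' := by
      rintro rfl
      omega
    have hu' : (SSet.stdSimplex.objEquiv (n := ⦋3⦌) (σ.right.app (op ⦋d⦌) s)).toOrderHom i' = u :=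
      Fin.ext (Nat.add_left_cancel hi')
    have hv' : (SSet.stdSimplex.objEquiv (n := ⦋3⦌) (σ.right.app (op ⦋d⦌) s)).toOrderHom j' = v :=
      Fin.ext (Nat.add_left_cancel hj')
    refine ⟨d, s, hs, hs', by omega, ?_⟩
    by_cases hd : 2 ≤ d
    · exact Or.inl hd
    · refine Or.inr (Set.eq_of_subset_of_subset ?_ ?_)
      · rintro _ ⟨(j : Fin (d + 1)), rfl⟩
        obtain rfl | rfl : j = i' ∨ j = j' := by
          rw [Fin.ext_iff, Fin.ext_iff]
          have := Fin.val_ne_of_ne hij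
          have h1 : i'.val < d + 1 := i'.isLt
          have h2 : j'.val < d + 1 := j'.isLt
          have h3 : j.val < d + 1 := j.isLt
          omega
        · exact Or.inl hu'
        · exact Or.inr hv'
      · rintro _ (rfl | rfl)
        · exact ⟨_, hu'⟩
        · exact ⟨_, hv'⟩
  have hk : 0 < k := by
    have : ∃ u ∈ vset (jhom (n := ⦋k⦌) σ), ∃ v ∈ vset (jhom (n := ⦋k⦌) σ), u < v :=
      hσ.elim (fun h => ⟨_, h.1, _, h.2, by omega⟩) (fun h => ⟨_, h.1, _, h.2, by omega⟩)
    obtain ⟨_, ⟨i, rfl⟩, _, ⟨j, rfl⟩, hij⟩ := this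
    have : i ≠ j := by
      rintro rfl
      omega
    omega
  rcases hσ with hσ | hσ
  · obtain ⟨d, s, hs, hs', hd, h⟩ := key 0 2 (by decide) hσ.1 hσ.2
    exact Or.inr ⟨hk, Or.inr ⟨d, s, hs, hs', Or.inr ⟨hd, h.imp id Or.inl⟩⟩⟩
  · obtain ⟨d, s, hs, hs', hd, h⟩ := key 1 3 (by decide) hσ.1 hσ.2
    exact Or.inr ⟨hk, Or.inr ⟨d, s, hs, hs', Or.inr ⟨hd, h.imp id Or.inr⟩⟩⟩

end

/-- Under the identification of the join with `Δ[a + 3]`, this is the lifting property against the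
left saturation extension. -/
theorem saturatedAt_last (hZ : IsSaturatedComplicial N Z) (a : ℕ) : SaturatedAt Z a (a + 3) := by
  rintro θ hθ _ hS k x rfl
  let g : join (simplexOnVertices.{u} a) simplexThreeEq ⟶ Z :=
    { toSSetHom :=
        { app := fun n => ↾fun σ => Z.toSSet.map (jhom (n := n.unop) σ).op θ
          naturality := by
            intro n m f
            ext σ
            exact (map_map Z.toSSet θ (k := m.unop.len) (l := n.unop.len) f.unop
              (jhom (n := n.unop) σ)).symm }
      map_marked := by
        intro n σ hσ
        rcases of_mem_marked_joinEq hσ with h | h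
        · exact Z.degenerate_subset _ (map_mem_degenerate _ _ h)
        · exact hθ _ h _ _ rfl }
  obtain ⟨h, hh⟩ := hZ _ (ElementaryAnodyne.saturation a) g
  have h1 := h.map_marked k ((joinThree.{u} a).map x.op (joinTop a))
    (mem_marked_joinSharp (by rwa [jhom_map_joinTop]))
  have h2 : h.toSSetHom.app (op ⦋k⦌) ((joinThree.{u} a).map x.op (joinTop a)) =
      Z.toSSet.map (jhom (n := ⦋k⦌) ((joinThree.{u} a).map x.op (joinTop a))).op θ :=
    congrArg (fun f : join (simplexOnVertices.{u} a) simplexThreeEq ⟶ Z =>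
      f.toSSetHom.app (op ⦋k⦌) ((joinThree.{u} a).map x.op (joinTop a))) hh
  rwa [h2, jhom_map_joinTop] at h1

/-- The two-sided saturation property. -/
theorem saturatedAt (hZ : IsSaturatedComplicial N Z) {a n : ℕ} (h : a + 3 ≤ n) :
    SaturatedAt Z a n :=
  saturatedAt_of_saturatedAt_last hZ (saturatedAt_last hZ) (n - (a + 3)) a n (by omega)

/-! ### Extending maps along the tensor of a saturation extension with a simplex -/

theorem vset_skipHom {n q : ℕ} (hq : q ≤ n + 1) : vset (skipHom n q) = {v | v ≤ n + 1} \ {q} := by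
  ext v
  constructor
  · intro hv
    refine ⟨le_of_mem_vset hv, ?_⟩
    rintro rfl
    obtain ⟨i, hi⟩ := hv
    exact skip_ne v _ hi
  · rintro ⟨hv : v ≤ n + 1, hvq : v ≠ q⟩
    refine ⟨⟨collapse q v, ?_⟩, skip_collapse hvq⟩
    unfold collapse
    split_ifs <;> omega

theorem injective_vtx_skipHom (n q : ℕ) : Function.Injective (vtx (skipHom n q)) := by
  intro i j h
  have := congrArg (collapse q) h
  change collapse q (skip q i) = collapse q (skip q j) at this
  rw [collapse_skip, collapse_skip] at this
  exact Fin.ext this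

theorem exists_monotone_vtx_eq {k n : ℕ} (x : ⦋k⦌ ⟶ ⦋n⦌) :
    ∃ g : ℕ → ℕ, Monotone g ∧ (∀ l, g l ≤ n) ∧ ∀ i, vtx x i = g i :=
  ⟨fun l => vtx x ⟨min l k, by omega⟩, fun _ _ h => vtx_mono x (min_le_min_right k h),
    fun _ => vtx_le x _, fun i => congrArg (vtx x) (Fin.ext (by
      change i.val = min i.val k
      omega))⟩

section

variable {a m : ℕ}

/-- The simplex of `(Δ[a - 1] ⋆ Δ[3]) × Δ[m]` with given vertices. -/
noncomputable def prodSimplex {n : ℕ} (ξ : ⦋n⦌ ⟶ ⦋a + 3⦌) (y : ⦋n⦌ ⟶ ⦋m⦌) :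
    (joinThree.{u} a ⊗ Δ[m]) _⦋n⦌ :=
  ((joinThree.{u} a).map ξ.op (joinTop a), SSet.stdSimplex.objEquiv.symm y)

theorem map_prodSimplex {k n : ℕ} (ξ : ⦋n⦌ ⟶ ⦋a + 3⦌) (y : ⦋n⦌ ⟶ ⦋m⦌) (x : ⦋k⦌ ⟶ ⦋n⦌) :
    (joinThree.{u} a ⊗ Δ[m]).map x.op (prodSimplex ξ y) = prodSimplex (x ≫ ξ) (x ≫ y) :=
  Prod.ext (map_map (joinThree.{u} a) (joinTop a) x ξ) rfl

theorem exists_prodSimplex_eq {n : ℕ} (z : (joinThree.{u} a ⊗ Δ[m]) _⦋n⦌) :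
    ∃ ξ y, prodSimplex ξ y = z :=
  ⟨jhom (n := ⦋n⦌) z.1, SSet.stdSimplex.objEquiv z.2, Prod.ext (map_jhom_joinTop z.1) rfl⟩

/-- The pairs of vertices of `Δ[a - 1] ⋆ Δ[3]_eq` that span a marked edge. -/
def EqEdge (a v w : ℕ) : Prop := v = w ∨ (v = a ∧ w = a + 2) ∨ (v = a + 1 ∧ w = a + 3)

/-- A partition at `p ≥ v` has `w` and `w'` in its front face, which is therefore marked in the
join. For `p < v` the back face contains `max u p` and `v`, on which `y` agrees, so it is
degenerate. -/
theorem prodSimplex_mem_marked {n : ℕ} {ξ : ⦋n⦌ ⟶ ⦋a + 3⦌} {y : ⦋n⦌ ⟶ ⦋m⦌}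
    {u v w w' : Fin (n + 1)} (huv : u < v) (hy : vtx y u = vtx y v) (hw : w < w') (hw' : w' ≤ v)
    (h : EqEdge a (vtx ξ w) (vtx ξ w')) :
    prodSimplex ξ y ∈ (tensor (join (simplexOnVertices.{u} a) simplexThreeEq)
      (minimal (SSet.stdSimplex.{u}.obj ⦋m⦌))).marked n := by
  refine Or.inr ⟨by omega, fun p q hpq => ?_⟩
  by_cases hp : v.val ≤ p
  · left
    have hv (i : Fin (n + 1)) (hi : i ≤ v) : ∃ j : Fin (p + 1), j.val = i.val ∧
        vtx (SimplexCategory.subinterval 0 p (by lia) ≫ ξ) j = vtx ξ i :=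
      ⟨⟨i, by have : i.val ≤ v.val := hi; omega⟩, rfl, congrArg (vtx ξ) (Fin.ext (Nat.add_zero _))⟩
    obtain ⟨j, hj, hj'⟩ := hv w (hw.le.trans hw')
    obtain ⟨j', hjw, hjw'⟩ := hv w' hw'
    have key := jhom_map_joinTop.{u} a (SimplexCategory.subinterval 0 p (by lia) ≫ ξ)
    have hm := map_map (joinThree.{u} a) (joinTop a) (SimplexCategory.subinterval 0 p
      (show 0 + p ≤ n by lia)) ξ
    refine Set.mem_of_eq_of_mem hm ?_
    rcases h with h | h
    · refine degenerate_subset _ _ (mem_degenerate_joinThree fun hinj => ?_)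
      rw [key] at hinj
      have := hinj (hj'.trans (h.trans hjw'.symm))
      have : j.val = j'.val := congrArg Fin.val this
      have : w.val < w'.val := hw
      omega
    · refine mem_marked_joinEq ?_
      rw [key]
      refine h.imp (fun h => ⟨?_, ?_⟩) (fun h => ⟨?_, ?_⟩)
      · exact ⟨j, hj'.trans h.1⟩
      · exact ⟨j', hjw'.trans h.2⟩
      · exact ⟨j, hj'.trans h.1⟩
      · exact ⟨j', hjw'.trans h.2⟩
  · right
    have huv' : u.val < v.val := huv
    let i : Fin (n + 1) := ⟨max u p, by omega⟩
    have hi : vtx y i = vtx y v := by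
      refine le_antisymm (vtx_mono y (Fin.le_def.mpr (show max u.val p ≤ v.val by omega))) ?_
      rw [← hy]
      exact vtx_mono y (Fin.le_def.mpr (show u.val ≤ max u.val p by omega))
    let j (l : ℕ) (hl : p ≤ l) (hln : l ≤ n) : Fin (q + 1) := ⟨l - p, by omega⟩
    have hj (l : ℕ) (hl : p ≤ l) (hln : l ≤ n) :
        vtx (SimplexCategory.subinterval p q hpq.le ≫ y) (j l hl hln) = vtx y ⟨l, by omega⟩ :=
      congrArg (vtx y) (Fin.ext (Nat.sub_add_cancel hl))
    have hne : ¬ Function.Injective (vtx (SimplexCategory.subinterval p q hpq.le ≫ y)) := by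
      intro hinj
      have h1 := hinj ((hj i.val (le_max_right _ _) (by omega)).trans
        (hi.trans (hj v.val (by omega) (by omega)).symm))
      have h2 : max u.val p - p = v.val - p := congrArg Fin.val h1
      omega
    exact degenerate_subset _ _ (Set.mem_of_eq_of_mem
      (SSet.stdSimplex.objEquiv.injective (Category.comp_id _)).symm
      (map_mem_degenerate (SSet.stdSimplex.obj ⦋m⦌) (SSet.stdSimplex.objEquiv.symm (𝟙 _)) hne))

variable (f : tensor (join (simplexOnVertices.{u} a) simplexThreeEq)
  (minimal (SSet.stdSimplex.{u}.obj ⦋m⦌)) ⟶ Z)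

/-- The image under `f` of the simplex with given vertices. -/
noncomputable def image {n : ℕ} (ξ : ⦋n⦌ ⟶ ⦋a + 3⦌) (y : ⦋n⦌ ⟶ ⦋m⦌) : Z.toSSet _⦋n⦌ :=
  f.toSSetHom.app (op ⦋n⦌) (prodSimplex ξ y)

theorem map_image {k n : ℕ} (ξ : ⦋n⦌ ⟶ ⦋a + 3⦌) (y : ⦋n⦌ ⟶ ⦋m⦌) (x : ⦋k⦌ ⟶ ⦋n⦌) :
    Z.toSSet.map x.op (image f ξ y) = image f (x ≫ ξ) (x ≫ y) :=
  (NatTrans.naturality_apply f.toSSetHom x.op (prodSimplex ξ y)).symm.trans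
    (congrArg (f.toSSetHom.app (op ⦋k⦌)) (map_prodSimplex ξ y x))

/-! ### Marked images of simplices of the tensor -/

section

variable {f} {n : ℕ} {ξ : ⦋n⦌ ⟶ ⦋a + 3⦌} {y : ⦋n⦌ ⟶ ⦋m⦌} {g h : ℕ → ℕ} {R : Set ℕ}

theorem mk_image_of_eqEdge (hg : ∀ i, vtx ξ i = g i) (hh : ∀ i, vtx y i = h i) {u v w w' : ℕ}
    (hu : u ∈ R) (hv : v ∈ R) (hw : w ∈ R) (hw' : w' ∈ R) (huv : u < v) (hy : h u = h v)
    (hww : w < w') (hwv : w' ≤ v) (he : EqEdge a (g w) (g w')) : Z.Mk (image f ξ y) R := by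
  rintro k x rfl
  by_cases hx : Function.Injective (vtx x)
  · obtain ⟨u, rfl⟩ := hu
    obtain ⟨v, rfl⟩ := hv
    obtain ⟨w, rfl⟩ := hw
    obtain ⟨w', rfl⟩ := hw'
    have hs := vtx_strictMono hx
    rw [map_image]
    refine f.map_marked _ _ (prodSimplex_mem_marked (hs.lt_iff_lt.mp huv) ?_
      (hs.lt_iff_lt.mp hww) (hs.le_iff_le.mp hwv) ?_)
    · rw [vtx_comp, vtx_comp, hh, hh]
      exact hy
    · rw [vtx_comp, vtx_comp, hg, hg]
      exact he
  · exact Z.degenerate_subset _ (map_mem_degenerate _ _ hx)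

/-- The edge from `i` to `i + 1` is replaced by all four vertices of `Δ[3]`, with `y` constant on
them, giving an `(n + 2)`-simplex. Monotonicity of its first component needs the bound `a` before
`i` and the value `a + 3` after `i + 1`. The faces containing an edge `[02]` or `[13]` are marked in
the tensor because `y` agrees on that edge, so two-sided saturation applies. -/
theorem image_mem_marked_of_tail (hZ : IsSaturatedComplicial N Z) {i : ℕ} (hin : i + 1 ≤ n)
    (hg : ∀ i, vtx ξ i = g i) (hh : ∀ i, vtx y i = h i)
    (hlt : ∀ l < i, g l ≤ a) (hi : a ≤ g i) (hi' : g i < g (i + 1)) (hy : h i = h (i + 1))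
    (hgt : ∀ l, i + 1 < l → l ≤ n → g l = a + 3) : image f ξ y ∈ Z.marked n := by
  have hgm {l l' : ℕ} (h1 : l ≤ l') (h2 : l' ≤ n) : g l ≤ g l' :=
    (hg ⟨l, by omega⟩).symm.le.trans ((vtx_mono ξ (Fin.le_def.mpr h1)).trans
      (hg ⟨l', by omega⟩).le)
  have hhm {l l' : ℕ} (h1 : l ≤ l') (h2 : l' ≤ n) : h l ≤ h l' :=
    (hh ⟨l, by omega⟩).symm.le.trans ((vtx_mono y (Fin.le_def.mpr h1)).trans
      (hh ⟨l', by omega⟩).le)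
  have hgn {l : ℕ} (h1 : l ≤ n) : g l ≤ a + 3 := (hg ⟨l, by omega⟩).symm.le.trans (vtx_le _ _)
  have hhn {l : ℕ} (h1 : l ≤ n) : h l ≤ m := (hh ⟨l, by omega⟩).symm.le.trans (vtx_le _ _)
  let G (l : ℕ) : ℕ := if l < i then g l else if l ≤ i + 3 then a + (l - i) else a + 3
  let H (l : ℕ) : ℕ := if l < i then h l else if l ≤ i + 3 then h i else h (l - 2)
  -- The embedding that recovers the original simplex: the ends of the edge go to those of the four
  -- new vertices that have the same first component.
  let e (l : ℕ) : ℕ := if l < i then l else if l ≤ i + 1 then i + (g l - a) else l + 2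
  have he {l : ℕ} (hl : l ≤ n) : (l < i ∧ e l = l) ∨ (l = i ∧ e l = i + (g i - a)) ∨
      (l = i + 1 ∧ e l = i + (g (i + 1) - a)) ∨ (i + 1 < l ∧ e l = l + 2) := by
    by_cases h1 : l < i
    · exact Or.inl ⟨h1, if_pos h1⟩
    by_cases h2 : l ≤ i + 1
    · have h3 : e l = i + (g l - a) := (if_neg h1).trans (if_pos h2)
      by_cases h4 : l = i
      · exact Or.inr (Or.inl ⟨h4, by rw [h3, h4]⟩)
      · have h5 : l = i + 1 := by omega
        exact Or.inr (Or.inr (Or.inl ⟨h5, by rw [h3, h5]⟩))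
    · exact Or.inr (Or.inr (Or.inr ⟨by omega, (if_neg h1).trans (if_neg h2)⟩))
  have hi3 := hgn hin
  let Ξ : ⦋n + 2⦌ ⟶ ⦋a + 3⦌ := homOfVtx G
    (by
      intro l l' h1 h2
      change ite _ _ _ ≤ ite _ _ _
      by_cases hl : l < i
      · have := hlt l hl
        by_cases hl' : l' < i
        · rw [if_pos hl, if_pos hl']
          exact hgm h1 (by omega)
        · rw [if_pos hl, if_neg hl']
          split_ifs <;> omega
      · rw [if_neg hl, if_neg (show ¬ l' < i by omega)]
        split_ifs <;> omega)
    (by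
      intro l hl
      change ite _ _ _ ≤ _
      split_ifs
      · exact hgn (by omega)
      · omega
      · omega)
  let Y : ⦋n + 2⦌ ⟶ ⦋m⦌ := homOfVtx H
    (by
      intro l l' h1 h2
      change ite _ _ _ ≤ ite _ _ _
      split_ifs
      any_goals omega
      all_goals exact hhm (by omega) (by omega))
    (by
      intro l hl
      change ite _ _ _ ≤ _
      split_ifs
      all_goals exact hhn (by omega))
  let E : ⦋n⦌ ⟶ ⦋n + 2⦌ := homOfVtx e
    (by
      intro l l' h1 h2
      have h3 := he (h1.trans h2)
      have h4 := he h2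
      omega)
    (by
      intro l hl
      have h4 := he hl
      omega)
  have hEΞ : E ≫ Ξ = ξ := hom_ext_vtx fun l => by
    rw [hg]
    change G (e l) = g l
    have hl : l.val ≤ n := Nat.lt_succ_iff.mp l.isLt
    rcases he hl with ⟨h1, h2⟩ | ⟨h1, h2⟩ | ⟨h1, h2⟩ | ⟨h1, h2⟩
    · rw [h2]
      exact if_pos h1
    · rw [h2, h1]
      refine (if_neg (by omega)).trans ((if_pos (by omega)).trans ?_)
      omega
    · rw [h2, h1]
      refine (if_neg (by omega)).trans ((if_pos (by omega)).trans ?_)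
      omega
    · rw [h2, hgt l h1 hl]
      exact (if_neg (by omega)).trans (if_neg (by omega))
  have hEY : E ≫ Y = y := hom_ext_vtx fun l => by
    rw [hh]
    change H (e l) = h l
    have hl : l.val ≤ n := Nat.lt_succ_iff.mp l.isLt
    rcases he hl with ⟨h1, h2⟩ | ⟨h1, h2⟩ | ⟨h1, h2⟩ | ⟨h1, h2⟩
    · rw [h2]
      exact if_pos h1
    · rw [h2, h1]
      exact (if_neg (by omega)).trans (if_pos (by omega))
    · rw [h2, h1, ← hy]
      exact (if_neg (by omega)).trans (if_pos (by omega))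
    · rw [h2]
      exact (if_neg (by omega)).trans (if_neg (by omega))
  have hG {l : ℕ} (hl : l ≤ 3) : G (i + l) = a + l :=
    (if_neg (by omega)).trans ((if_pos (by omega)).trans (by omega))
  have hH {l : ℕ} (hl : l ≤ 3) : H (i + l) = h i :=
    (if_neg (by omega)).trans (if_pos (by omega))
  have key := saturatedAt hZ (a := i) (n := n + 2) (by omega) (image f Ξ Y) (by
    rintro S (⟨h1, h2⟩ | ⟨h1, h2⟩)
    · exact mk_image_of_eqEdge (g := G) (h := H) (fun _ => rfl) (fun _ => rfl) h1 h2 h1 h2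
        (by omega) ((hH (l := 0) (by omega)).trans (hH (l := 2) (by omega)).symm) (by omega) le_rfl
        (Or.inr (Or.inl ⟨hG (l := 0) (by omega), hG (by omega)⟩))
    · exact mk_image_of_eqEdge (g := G) (h := H) (fun _ => rfl) (fun _ => rfl) h1 h2 h1 h2
        (by omega) ((hH (l := 1) (by omega)).trans (hH (l := 3) (by omega)).symm) (by omega) le_rfl
        (Or.inr (Or.inr ⟨hG (l := 1) (by omega), hG (by omega)⟩))) (vset E) (by
    have h1 : e i = i + (g i - a) := (if_neg (by omega)).trans (if_pos (by omega))
    have h2 : e (i + 1) = i + (g (i + 1) - a) := (if_neg (by omega)).trans (if_pos (by omega))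
    exact ⟨_, ⟨⟨i, by omega⟩, h1⟩, _, ⟨⟨i + 1, by omega⟩, h2⟩, by omega, by omega, by omega⟩)
    n E rfl
  rwa [map_image, hEΞ, hEY] at key

theorem mk_image_of_tail (hZ : IsSaturatedComplicial N Z) {i j : ℕ} (hij : i < j) (hi : i ∈ R)
    (hj : j ∈ R) (hg : ∀ i, vtx ξ i = g i) (hh : ∀ i, vtx y i = h i)
    (hlt : ∀ l ∈ R, l < i → g l ≤ a) (hb : ∀ l ∈ R, ¬ (i < l ∧ l < j)) (hai : a ≤ g i)
    (hgij : g i < g j) (hy : h i = h j) (hgt : ∀ l ∈ R, j < l → g l = a + 3) :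
    Z.Mk (image f ξ y) R := by
  rintro k x rfl
  by_cases hx : Function.Injective (vtx x)
  · obtain ⟨i, rfl⟩ := hi
    obtain ⟨j, rfl⟩ := hj
    have hs := vtx_strictMono hx
    obtain ⟨X, -, -, hX⟩ := exists_monotone_vtx_eq x
    have hij' : i.val < j.val := hs.lt_iff_lt.mp hij
    have hj' : i.val + 1 = j.val := by
      by_contra hne
      have h3 : i.val + 1 < k + 1 := by omega
      exact hb _ (vtx_mem x ⟨i.val + 1, h3⟩)
        ⟨hs (Fin.lt_def.mpr (Nat.lt_succ_self _)), hs (Fin.lt_def.mpr (by simp only; omega))⟩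
    rw [map_image]
    refine image_mem_marked_of_tail hZ (g := fun l => g (X l)) (h := fun l => h (X l))
      (i := i.val) (by omega) ?_ ?_ ?_ ?_ ?_ ?_ ?_
    · intro l
      rw [vtx_comp, hg]
      exact congrArg g (hX l)
    · intro l
      rw [vtx_comp, hh]
      exact congrArg h (hX l)
    · intro l hl
      have h1 := hX ⟨l, by omega⟩
      rw [← h1]
      exact hlt _ (vtx_mem x _) (hs hl)
    · rwa [← hX]
    · rwa [hj', ← hX, ← hX]
    · rwa [hj', ← hX, ← hX]
    · intro l h1 h2
      have h3 := hX ⟨l, by omega⟩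
      rw [← h3]
      exact hgt _ (vtx_mem x _) (hs (Fin.lt_def.mpr (by simp only; omega)))
  · exact Z.degenerate_subset _ (map_mem_degenerate _ _ hx)

end

/-- The induction on `s` moves the last vertex not yet over `a + 3` there. That vertex is doubled,
with the second copy placed over `a + 3` and the same `y`; the faces omitting one copy are the old
simplex and one covered by the induction hypothesis. -/
theorem image_mem_marked (hZ : IsSaturatedComplicial N Z) {n i : ℕ} (hin : i + 1 ≤ n)
    {h : ℕ → ℕ} {y : ⦋n⦌ ⟶ ⦋m⦌} (hh : ∀ i, vtx y i = h i) (hy : h i = h (i + 1)) (s : ℕ)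
    {g : ℕ → ℕ} {ξ : ⦋n⦌ ⟶ ⦋a + 3⦌} (hg : ∀ i, vtx ξ i = g i)
    (hlt : ∀ l < i, g l < a) (hi : a ≤ g i) (hi' : g i < g (i + 1))
    (hgt : ∀ l, s < l → l ≤ n → g l = a + 3) : image f ξ y ∈ Z.marked n := by
  induction s generalizing g ξ with
  | zero =>
    exact image_mem_marked_of_tail hZ hin hg hh (fun l hl => (hlt l hl).le) hi hi' hy
      (fun l h1 h2 => hgt l (by omega) h2)
  | succ s ih =>
    have hgm {l l' : ℕ} (h1 : l ≤ l') (h2 : l' ≤ n) : g l ≤ g l' :=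
      (hg ⟨l, by omega⟩).symm.le.trans ((vtx_mono ξ (Fin.le_def.mpr h1)).trans
        (hg ⟨l', by omega⟩).le)
    have hhm {l l' : ℕ} (h1 : l ≤ l') (h2 : l' ≤ n) : h l ≤ h l' :=
      (hh ⟨l, by omega⟩).symm.le.trans ((vtx_mono y (Fin.le_def.mpr h1)).trans
        (hh ⟨l', by omega⟩).le)
    have hgn {l : ℕ} (h1 : l ≤ n) : g l ≤ a + 3 := (hg ⟨l, by omega⟩).symm.le.trans (vtx_le _ _)
    have hhn {l : ℕ} (h1 : l ≤ n) : h l ≤ m := (hh ⟨l, by omega⟩).symm.le.trans (vtx_le _ _)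
    by_cases hs : s ≤ i
    · exact image_mem_marked_of_tail hZ hin hg hh (fun l hl => (hlt l hl).le) hi hi' hy
        (fun l h1 h2 => hgt l (by omega) h2)
    by_cases hsn : s + 1 ≤ n
    swap
    · exact ih hg hlt hi hi' (fun l h1 h2 => by omega)
    by_cases hgs : g (s + 1) = a + 3
    · refine ih hg hlt hi hi' (fun l h1 h2 => ?_)
      by_cases hl : l = s + 1
      · rw [hl, hgs]
      · exact hgt l (by omega) h2
    let G (l : ℕ) : ℕ := if l ≤ s + 1 then g l else a + 3
    let G' (l : ℕ) : ℕ := if l ≤ s then g l else a + 3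
    let Ξ : ⦋n + 1⦌ ⟶ ⦋a + 3⦌ := homOfVtx G
      (by
        intro l l' h1 h2
        change ite _ _ _ ≤ ite _ _ _
        split_ifs
        · exact hgm h1 (by omega)
        · exact hgn (by omega)
        · omega
        · omega)
      (by
        intro l hl
        change ite _ _ _ ≤ _
        split_ifs
        · exact hgn (by omega)
        · exact le_rfl)
    let Ξ' : ⦋n⦌ ⟶ ⦋a + 3⦌ := homOfVtx G'
      (by
        intro l l' h1 h2
        change ite _ _ _ ≤ ite _ _ _
        split_ifs
        · exact hgm h1 (by omega)
        · exact hgn (by omega)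
        · omega
        · omega)
      (by
        intro l hl
        change ite _ _ _ ≤ _
        split_ifs
        · exact hgn (by omega)
        · exact le_rfl)
    have hG {l : ℕ} (hl : l ≤ s + 1) : G l = g l := if_pos hl
    have hG₂ {l : ℕ} (hl : s + 1 < l) : G l = a + 3 := if_neg (by omega)
    have hG' {l : ℕ} (hl : l ≤ s) : G' l = g l := if_pos hl
    have hG₂' {l : ℕ} (hl : s < l) : G' l = a + 3 := if_neg (by omega)
    let Y : ⦋n + 1⦌ ⟶ ⦋m⦌ := collapseHom n (s + 1) hsn ≫ y
    have hY (l : Fin (n + 1 + 1)) : vtx Y l = h (collapse (s + 1) l) := hh _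
    have h₁ : skipHom n (s + 1) ≫ Ξ = Ξ' := hom_ext_vtx fun l => by
      change G (skip (s + 1) l) = G' l
      by_cases hl : l.val < s + 1
      · rw [skip_of_lt hl, hG hl.le, hG' (by omega)]
      · rw [skip_of_le (by omega), hG₂ (by omega), hG₂' (by omega)]
    have h₂ : skipHom n (s + 2) ≫ Ξ = ξ := hom_ext_vtx fun l => by
      rw [hg]
      change G (skip (s + 2) l) = g l
      by_cases hl : l.val < s + 2
      · rw [skip_of_lt hl, hG (by omega)]
      · rw [skip_of_le (by omega), hG₂ (by omega), hgt l (by omega) (by omega)]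
    have h₃ : skipHom n (s + 1) ≫ Y = y := hom_ext_vtx fun l => by
      rw [hh]
      exact (hh _).trans (congrArg h (collapse_skip (s + 1) l))
    have h₄ : skipHom n (s + 2) ≫ Y = y := hom_ext_vtx fun l => by
      rw [hh]
      refine (hh _).trans (congrArg h ?_)
      change collapse (s + 1) (skip (s + 2) l) = l.val
      by_cases hl : l.val < s + 2
      · rw [skip_of_lt hl, collapse_of_le (by omega)]
      · rw [skip_of_le (by omega), collapse_of_lt (by omega), Nat.add_sub_cancel]
    have hyY : h (collapse (s + 1) (s + 1)) = h (collapse (s + 1) (s + 2)) := by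
      rw [collapse_of_le le_rfl, collapse_of_lt (Nat.lt_succ_self _)]
      rfl
    have key : Z.Mk (image f Ξ Y) ({v | v ≤ n + 1} \ {s + 2}) := by
      refine mk_diff_swap hZ (u := s + 1) ⟨show s + 1 ≤ n + 1 by omega, by omega, fun _ _ => by omega⟩
        (show s + 2 ≤ n + 1 by omega) (fun _ h => h) (fun R hR hu hv => ?_) ?_ ?_
      · have hs1 := hgm (l := i + 1) (l' := s + 1) (by omega) hsn
        have hs2 := hgn hsn
        by_cases h13 : g (s + 1) = a + 1
        · exact mk_image_of_eqEdge (g := G) (h := fun l => h (collapse (s + 1) l))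
              (fun _ => rfl) hY hu hv hu hv (by omega) hyY
            (by omega) le_rfl (Or.inr (Or.inr ⟨(hG le_rfl).trans h13, hG₂ (by omega)⟩))
        have h2 : g (s + 1) = a + 2 := by omega
        by_cases hR' : ∃ j ∈ R, j < s + 1 ∧ a ≤ g j
        · obtain ⟨j, hj, hjs, haj⟩ := hR'
          have := hgm hjs.le hsn
          obtain h3 | h3 | h3 : g j = a ∨ g j = a + 1 ∨ g j = a + 2 := by omega
          · exact mk_image_of_eqEdge (g := G) (h := fun l => h (collapse (s + 1) l))
              (fun _ => rfl) hY hu hv hj hu (by omega) hyY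
              hjs (by omega) (Or.inr (Or.inl ⟨(hG hjs.le).trans h3, (hG le_rfl).trans h2⟩))
          · exact mk_image_of_eqEdge (g := G) (h := fun l => h (collapse (s + 1) l))
              (fun _ => rfl) hY hu hv hj hv (by omega) hyY
              (by omega) le_rfl (Or.inr (Or.inr ⟨(hG hjs.le).trans h3, hG₂ (by omega)⟩))
          · exact mk_image_of_eqEdge (g := G) (h := fun l => h (collapse (s + 1) l))
              (fun _ => rfl) hY hu hv hj hu (by omega) hyY
              hjs (by omega) (Or.inl ((hG hjs.le).trans (h3.trans (h2.symm.trans (hG le_rfl).symm))))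
        · refine mk_image_of_tail hZ (i := s + 1) (j := s + 2) (by omega) hu hv (g := G)
            (h := fun l => h (collapse (s + 1) l)) (fun _ => rfl) hY (fun l hl hls => ?_) (fun _ _ => by omega) ?_ ?_ hyY
            (fun l _ hl => hG₂ (by omega))
          · rw [hG hls.le]
            by_contra hal
            exact hR' ⟨l, hl, hls, by omega⟩
          · rw [hG le_rfl]
            omega
          · rw [hG le_rfl, hG₂ (by omega)]
            omega
      · rw [← vset_skipHom (by omega)]
        refine mk_of_injective (injective_vtx_skipHom n (s + 1)) ?_
        rw [map_image, h₁, h₃]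
        refine ih (g := G') (fun _ => rfl) ?_ ?_ ?_ ?_
        · intro l hl
          rw [hG' (by omega)]
          exact hlt l hl
        · rwa [hG' (by omega)]
        · rwa [hG' (by omega), hG' (by omega)]
        · intro l hl _
          exact hG₂' hl
      · exact ⟨0, ⟨Nat.zero_le _, by simp⟩, 1, ⟨show 1 ≤ n + 1 by omega, by simp⟩, by omega⟩
    rw [← vset_skipHom (by omega)] at key
    have := key n _ rfl
    rwa [map_image, h₂, h₄] at this

theorem map_joinTop_mem_marked {p : ℕ} {ξ : ⦋p⦌ ⟶ ⦋a + 3⦌}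
    (h : ¬ Function.Injective (vtx ξ) ∨ EqC a (vset ξ)) :
    (joinThree.{u} a).map ξ.op (joinTop a) ∈
      (join (simplexOnVertices.{u} a) simplexThreeEq).marked p := by
  rcases h with h | h
  · exact degenerate_subset _ _ (map_mem_degenerate _ _ h)
  · refine mem_marked_joinEq ?_
    rwa [jhom_map_joinTop]

theorem image_mem_marked_of_mem_marked (hZ : IsSaturatedComplicial N Z) {n : ℕ}
    {ξ : ⦋n⦌ ⟶ ⦋a + 3⦌} {y : ⦋n⦌ ⟶ ⦋m⦌}
    (hz : prodSimplex ξ y ∈ (tensor (join (simplexOnVertices.{u} a) simplexThreeSharp)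
      (minimal (SSet.stdSimplex.{u}.obj ⦋m⦌))).marked n) : image f ξ y ∈ Z.marked n := by
  rcases hz with hz | ⟨hn, hz⟩
  · exact Z.degenerate_subset _ (map_degenerate _ hz)
  by_contra hf
  have hf' : ¬ ∀ (p q : ℕ) (hpq : p + q = n), _ ∨ _ := fun he =>
    hf (f.map_marked _ (prodSimplex ξ y) (Or.inr ⟨hn, he⟩))
  push Not at hf'
  obtain ⟨p, q, hpq, h1, h2⟩ := hf'
  have hL (p : ℕ) (hp : 0 + p ≤ n) :
      (joinThree.{u} a).map (SimplexCategory.subinterval 0 p hp).op (prodSimplex ξ y).1 =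
      (joinThree.{u} a).map (SimplexCategory.subinterval 0 p hp ≫ ξ).op (joinTop a) :=
    map_map (joinThree.{u} a) (joinTop a) _ ξ
  have h1' := fun (h : _ ∨ _) => h1 (Set.mem_of_eq_of_mem (hL p (by omega))
    (map_joinTop_mem_marked h))
  obtain ⟨hinj, hnC⟩ := not_or.mp h1'
  rw [not_not] at hinj
  obtain ⟨g, hgm, hgn, hg⟩ := exists_monotone_vtx_eq ξ
  obtain ⟨h, hhm, -, hh⟩ := exists_monotone_vtx_eq y
  have hX (p : ℕ) (hp : 0 + p ≤ n) (j : Fin (p + 1)) :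
      vtx (SimplexCategory.subinterval 0 p hp ≫ ξ) j = g j := hg _
  have hY (p q : ℕ) (hpq : p + q ≤ n) (j : Fin (q + 1)) :
      vtx (SimplexCategory.subinterval p q hpq ≫ y) j = h (j + p) := hh _
  have hgs {l l' : ℕ} (h1 : l < l') (h2 : l' ≤ p) : g l < g l' := by
    have := vtx_strictMono hinj (a := (⟨l, by omega⟩ : Fin (p + 1))) (b := ⟨l', by omega⟩) h1
    rwa [hX, hX] at this
  have hmem {l : ℕ} (h1 : l ≤ p) :
      g l ∈ vset (SimplexCategory.subinterval 0 p (show 0 + p ≤ n by omega) ≫ ξ) :=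
    ⟨⟨l, by omega⟩, hX _ _ _⟩
  -- Three front vertices in `Δ[3]` would make the front face marked in the join with `Δ[3]_eq`. So
  -- at most the last two are in `Δ[3]`.
  have htri {k₁ k₂ k₃ : ℕ} (h1 : k₁ < k₂) (h2 : k₂ < k₃) (h3 : k₃ ≤ p) : g k₁ < a := by
    by_contra h0
    have h4 := hgs h1 (by omega)
    have h5 := hgs h2 h3
    have h6 := hgn k₃
    have m1 := hmem (l := k₁) (by omega)
    have m2 := hmem (l := k₂) (by omega)
    have m3 := hmem h3
    by_cases e1 : g k₁ = a
    · rw [e1] at m1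
      by_cases e2 : g k₂ = a + 2
      · exact hnC (Or.inl ⟨m1, Set.mem_of_eq_of_mem e2.symm m2⟩)
      · by_cases e3 : g k₃ = a + 2
        · exact hnC (Or.inl ⟨m1, Set.mem_of_eq_of_mem e3.symm m3⟩)
        · exact hnC (Or.inr ⟨Set.mem_of_eq_of_mem (by omega) m2,
          Set.mem_of_eq_of_mem (by omega) m3⟩)
    · exact hnC (Or.inr ⟨Set.mem_of_eq_of_mem (by omega) m1,
        Set.mem_of_eq_of_mem (by omega) m3⟩)
  have hsharp (p' : ℕ) (hp : 0 + p' ≤ n) (hp' : p' ≤ p)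
      (hm : (joinThree.{u} a).map (SimplexCategory.subinterval 0 p' hp).op (prodSimplex ξ y).1 ∈
        (join (simplexOnVertices.{u} a) simplexThreeSharp).marked p') :
      ∃ i j, i < j ∧ j ≤ p' ∧ a ≤ g i := by
    have hm' := of_mem_marked_joinSharp (Set.mem_of_eq_of_mem (hL p' hp).symm hm)
    rw [jhom_map_joinTop] at hm'
    rcases hm' with hm' | ⟨_, ⟨i, rfl⟩, _, ⟨j, rfl⟩, h3, h4, -⟩
    · refine absurd (fun i j hij => ?_) hm'
      rw [hX, hX] at hij
      by_contra hne
      rcases lt_or_gt_of_ne (Fin.val_ne_of_ne hne) with hlt | hlt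
      · exact (hgs hlt (by omega)).ne hij
      · exact (hgs hlt (by omega)).ne' hij
    · rw [hX] at h3 h4
      rw [hX] at h4
      refine ⟨i, j, ?_, by omega, h3⟩
      by_contra hle
      exact absurd (hgm (not_lt.mp hle)) (not_le.mpr h4)
  obtain ⟨i₀, j₀, hij₀, hjp, hi₀⟩ := hsharp p (by omega) le_rfl ((hz p q hpq).resolve_right h2)
  obtain ⟨i, rfl⟩ : ∃ i, p = i + 1 := ⟨p - 1, by omega⟩
  have hlt : ∀ l < i, g l < a := fun l hl => htri hl (Nat.lt_succ_self i) le_rfl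
  -- The front face `0, …, i` has at most one vertex in `Δ[3]`, so it is unmarked even for `Δ[3]_♯`.
  -- Hence the back face from `i` is degenerate while the one from `i + 1` is not, and the
  -- repetition must occur at its first step.
  have hyi : h i = h (i + 1) := by
    have hdeg := (hz i (q + 1) (by omega)).resolve_left fun hm => by
      obtain ⟨i₁, j₁, hij₁, hji, hi₁⟩ := hsharp i (by omega) (by omega) hm
      have := hlt i₁ (by omega)
      omega
    have hdeg' := not_injective_avtx_of_mem_degenerate (m + 1) (hdeg.resolve_right fun h => h.2)
    have h2' : Function.Injective (vtx (SimplexCategory.subinterval (i + 1) q hpq.le ≫ y)) := by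
      by_contra hne
      exact h2 (degenerate_subset _ _ (Set.mem_of_eq_of_mem
        (SSet.stdSimplex.objEquiv.injective (Category.comp_id _)).symm
        (map_mem_degenerate (SSet.stdSimplex.obj ⦋m⦌) (SSet.stdSimplex.objEquiv.symm (𝟙 _)) hne)))
    have hhs {l l' : ℕ} (h1 : l < l') (hl : i + 1 ≤ l) (hl' : l' ≤ n) : h l ≠ h l' := by
      intro he
      have := h2' (a₁ := (⟨l - (i + 1), by omega⟩ : Fin (q + 1))) (a₂ := ⟨l' - (i + 1), by omega⟩) (by
        rw [hY, hY]
        simp only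
        rwa [Nat.sub_add_cancel hl, Nat.sub_add_cancel (by omega)])
      have : l - (i + 1) = l' - (i + 1) := congrArg Fin.val this
      omega
    by_contra hne
    have hlt' : h i < h (i + 1) := lt_of_le_of_ne (hhm (Nat.le_succ i)) hne
    have hhs' {l l' : ℕ} (h1 : l < l') (hl : i ≤ l) (hl' : l' ≤ n) : h l ≠ h l' := by
      by_cases hli : l = i
      · rw [hli]
        exact (hlt'.trans_le (hhm (show i + 1 ≤ l' by omega))).ne
      · exact hhs h1 (by omega) hl'
    refine hdeg' fun j j' hjj => ?_
    have e1 : h (j + i) = h (j' + i) := (hY i (q + 1) (by omega) j).symm.trans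
      (hjj.trans (hY i (q + 1) (by omega) j'))
    by_contra hne'
    have b1 : j.val < q + 1 + 1 := j.isLt
    have b2 : j'.val < q + 1 + 1 := j'.isLt
    rcases lt_or_gt_of_ne (Fin.val_ne_of_ne hne') with hl | hl
    · exact hhs' (l := j + i) (l' := j' + i) (by omega) (by omega) (by omega) e1
    · exact hhs' (l := j' + i) (l' := j + i) (by omega) (by omega) (by omega) e1.symm
  exact hf (image_mem_marked f hZ (i := i) (by omega) hh hyi n hg hlt
    (hi₀.trans (hgm (by omega))) (hgs (Nat.lt_succ_self i) le_rfl) (fun l h1 h2 => by omega))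

theorem exists_extension_tensor (hZ : IsSaturatedComplicial N Z) :
    ∃ f' : tensor (join (simplexOnVertices.{u} a) simplexThreeSharp)
      (minimal (SSet.stdSimplex.{u}.obj ⦋m⦌)) ⟶ Z,
      tensorMap (leftSaturationExtension a) (𝟙 _) ≫ f' = f := by
  refine ⟨⟨f.toSSetHom, fun n z hz => ?_⟩, rfl⟩
  obtain ⟨ξ, y, rfl⟩ := exists_prodSimplex_eq z
  exact image_mem_marked_of_mem_marked f hZ hz

end

variable {X Y : MSSet.{u}}

/-! ### Cylinders -/

theorem mono_of_mono_toSSetHom {w : X ⟶ Y} (hw : Mono w.toSSetHom) : Mono w :=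
  ⟨fun _ _ e => hom_ext (hw.right_cancellation _ _ (congrArg Hom.toSSetHom e))⟩

/-- The map from a simplex with minimal marking that corresponds to a simplex of `X`. -/
def ofSimplex {n : ℕ} (x : X.toSSet _⦋n⦌) : minimal (SSet.stdSimplex.{u}.obj ⦋n⦌) ⟶ X where
  toSSetHom := SSet.yonedaEquiv.symm x
  map_marked _ _ hy := X.degenerate_subset _ (map_degenerate _ (hy.resolve_right fun h => h.2))

/-- Monomorphisms are tested on simplices with minimal marking, which represent all simplices,
marked or not. -/
theorem injective_app_of_mono (w : X ⟶ Y) [Mono w] (n : ℕ) :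
    Function.Injective (w.toSSetHom.app (op ⦋n⦌)) := by
  intro x x' h
  have key : ofSimplex x ≫ w = ofSimplex x' ≫ w := hom_ext (SSet.yonedaEquiv.injective (by
    refine Eq.trans ?_ (h.trans ?_)
    · exact congrArg (w.toSSetHom.app (op ⦋n⦌)) (SSet.yonedaEquiv.apply_symm_apply x)
    · exact congrArg (w.toSSetHom.app (op ⦋n⦌)) (SSet.yonedaEquiv.apply_symm_apply x').symm))
  exact SSet.yonedaEquiv.symm.injective
    (congrArg Hom.toSSetHom ((cancel_mono w).mp key))

/-- The product of `X` with a simplicial set all of whose simplices are marked. -/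
def cyl (X : MSSet.{u}) (K : SSet.{u}) : MSSet.{u} where
  toSSet := X.toSSet ⊗ K
  marked n := {z | z.1 ∈ X.marked n}
  marked_zero := by
    ext z
    exact iff_of_false (fun h => (X.pos_of_mem_marked h).ne rfl) (fun h => h)
  degenerate_subset n z hz := X.degenerate_subset n
    (map_degenerate (CartesianMonoidalCategory.fst X.toSSet K) hz)

/-- The projection. -/
def cylπ (X : MSSet.{u}) (K : SSet.{u}) : cyl X K ⟶ X where
  toSSetHom := CartesianMonoidalCategory.fst X.toSSet K
  map_marked _ _ h := h

/-- Two points. -/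
abbrev twoPoints : SSet.{u} := (Functor.const _).obj (ULift.{u} Bool)

/-- The simplicial set with two vertices and a unique simplex for every sequence of vertices. -/
def interval : SSet.{u} where
  obj n := Fin (n.unop.len + 1) → ULift.{u} Bool
  map f := ↾fun j l => j (f.unop.toOrderHom l)

/-- The inclusion of the vertices. -/
def twoPointsι : twoPoints.{u} ⟶ interval.{u} where
  app _ := ↾fun b _ => b

/-- The inclusion of the ends of a cylinder. -/
def cylι (X : MSSet.{u}) : cyl X twoPoints ⟶ cyl X interval where
  toSSetHom := X.toSSet ◁ twoPointsι
  map_marked _ _ h := h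

/-- An end of a cylinder. -/
def cylEnd (X : MSSet.{u}) (b : Bool) : X ⟶ cyl X interval where
  toSSetHom :=
    { app := fun n => ↾fun x => (x, fun _ => ULift.up b) }
  map_marked _ _ h := h

instance : Mono (cylι X) := mono_of_mono_toSSetHom (by
  rw [NatTrans.mono_iff_mono_app]
  intro n
  rw [CategoryTheory.mono_iff_injective]
  rintro ⟨x, b⟩ ⟨x', b'⟩ h
  have h1 : x = x' := congrArg Prod.fst h
  have h2 : b = b' := congrFun (congrArg Prod.snd h) 0
  rw [h1, h2])

/-- A map from the two ends of a cylinder. -/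
def cylDesc (f g : X ⟶ Y) : cyl X twoPoints ⟶ Y where
  toSSetHom :=
    { app := fun n => ↾fun z => bif z.2.down then g.toSSetHom.app n z.1 else f.toSSetHom.app n z.1
      naturality := by
        intro n m θ
        ext ⟨x, ⟨b⟩⟩
        cases b
        · exact NatTrans.naturality_apply f.toSSetHom θ x
        · exact NatTrans.naturality_apply g.toSSetHom θ x }
  map_marked := by
    rintro n ⟨x, ⟨b⟩⟩ h
    cases b
    · exact f.map_marked n x h
    · exact g.map_marked n x h

/-- A map to a cylinder that is given on vertices. -/
def cylLift (f : Y ⟶ X) (j : Y.toSSet _⦋0⦌ → ULift.{u} Bool) : Y ⟶ cyl X interval where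
  toSSetHom :=
    { app := fun n => ↾fun y => (f.toSSetHom.app n y,
        fun l => j (Y.toSSet.map (SimplexCategory.const ⦋0⦌ n.unop l).op y))
      naturality := by
        intro n m θ
        ext y
        refine Prod.ext (show f.toSSetHom.app m (Y.toSSet.map θ y) =
          X.toSSet.map θ (f.toSSetHom.app n y) from NatTrans.naturality_apply f.toSSetHom θ y) (funext fun l => congrArg j ?_)
        exact map_map Y.toSSet (n := n.unop.len) (l := m.unop.len) y
          (SimplexCategory.const ⦋0⦌ m.unop l) θ.unop }
  map_marked n y h := f.map_marked n y h

theorem cyl_hom_ext {f g : Y ⟶ cyl X interval} (h : f ≫ cylπ X _ = g ≫ cylπ X _)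
    (h' : ∀ y : Y.toSSet _⦋0⦌, (f.toSSetHom.app (op ⦋0⦌) y).2 = (g.toSSetHom.app (op ⦋0⦌) y).2) :
    f = g := by
  refine hom_ext ?_
  ext n y
  refine Prod.ext (congrArg (fun t : Y ⟶ X => t.toSSetHom.app n y) h) (funext fun l => ?_)
  have := congrFun (h' (Y.toSSet.map (SimplexCategory.const ⦋0⦌ n.unop l).op y)) 0
  have e (f : Y ⟶ cyl X interval) : (f.toSSetHom.app (op ⦋0⦌)
      (Y.toSSet.map (SimplexCategory.const ⦋0⦌ n.unop l).op y)).2 0 =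
      (f.toSSetHom.app n y).2 l :=
    congrFun (congrArg Prod.snd (NatTrans.naturality_apply f.toSSetHom
      (SimplexCategory.const ⦋0⦌ n.unop l).op y)) 0
  exact (e f).symm.trans (this.trans (e g))

/-- A map to the cylinder is a map to `X` together with an arbitrary function on vertices, and such
functions extend along injections. -/
theorem cylπ_mem_rlp (X : MSSet.{u}) :
    (MorphismProperty.monomorphisms MSSet.{u}).rlp (cylπ X interval) := by
  classical
  intro A B i (hi : Mono i)
  refine ⟨fun {f g} sq => ?_⟩
  have hinj := injective_app_of_mono i 0
  let j (b : B.toSSet _⦋0⦌) : ULift.{u} Bool :=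
    if h : ∃ a, i.toSSetHom.app (op ⦋0⦌) a = b then (f.toSSetHom.app (op ⦋0⦌) h.choose).2 0
    else ⟨false⟩
  refine ⟨⟨⟨cylLift g j, cyl_hom_ext ?_ fun a => ?_, rfl⟩⟩⟩
  · exact sq.w.symm
  · have h : ∃ a', i.toSSetHom.app (op ⦋0⦌) a' = i.toSSetHom.app (op ⦋0⦌) a := ⟨a, rfl⟩
    funext l
    have h1 : j (i.toSSetHom.app (op ⦋0⦌) a) = (f.toSSetHom.app (op ⦋0⦌) a).2 0 :=
      (dif_pos h).trans (by rw [hinj h.choose_spec])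
    obtain rfl : l = 0 := Subsingleton.elim (α := Fin 1) _ _
    refine Eq.trans (congrArg j ?_) h1
    have h2 : SimplexCategory.const ⦋0⦌ ⦋0⦌ 0 = 𝟙 _ := hom_ext_vtx fun i => by
      rw [Subsingleton.elim (α := Fin 1) i 0]
      rfl
    exact (congrArg (fun t : ⦋0⦌ ⟶ ⦋0⦌ => B.toSSet.map t.op (i.toSSetHom.app (op ⦋0⦌) a)) h2).trans
      (map_id_apply B.toSSet _)

/-- The cylinder `cyl X interval`. -/
def precylinder (X : MSSet.{u}) : HomotopicalAlgebra.Precylinder X where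
  I := cyl X interval
  i₀ := cylEnd X false
  i₁ := cylEnd X true
  π := cylπ X interval

/-! ### Homotopies and the transport of markings -/

theorem LeftHomotopic.refl (f : X ⟶ Z) : LeftHomotopic f f :=
  ⟨precylinder X, cylπ_mem_rlp X, cylπ X _ ≫ f, rfl, rfl⟩

/-- In the `(n + 1)`-simplex that doubles vertex `i` of `x` and gives the copies the labels `j' i`
and `j i`, faces with both copies are degenerate in `X`, hence marked in the cylinder. Thinness then
transfers the marking from one face omitting a copy to the other. -/
theorem mem_marked_of_eq_off (hZ : IsSaturatedComplicial N Z) (G : cyl X interval ⟶ Z) {n : ℕ}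
    (hn : 0 < n)
    (x : X.toSSet _⦋n⦌) (i : Fin (n + 1)) (j j' : Fin (n + 1) → ULift.{u} Bool)
    (hj : ∀ l, l ≠ i → j l = j' l) (h : G.toSSetHom.app (op ⦋n⦌) (x, j) ∈ Z.marked n) :
    G.toSSetHom.app (op ⦋n⦌) (x, j') ∈ Z.marked n := by
  have hi : i.val ≤ n := Nat.lt_succ_iff.mp i.isLt
  let t : Fin (n + 1 + 1) → ULift.{u} Bool := fun l =>
    if l.val = i.val then j' i else j ((collapseHom n i hi).toOrderHom l)
  let θ := G.toSSetHom.app (op ⦋n + 1⦌) (X.toSSet.map (collapseHom n i hi).op x, t)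
  have hθ {k : ℕ} (y : ⦋k⦌ ⟶ ⦋n + 1⦌) : Z.toSSet.map y.op θ = G.toSSetHom.app (op ⦋k⦌)
      (X.toSSet.map (y ≫ collapseHom n i hi).op x, fun l => t (y.toOrderHom l)) := by
    refine (NatTrans.naturality_apply G.toSSetHom y.op _).symm.trans
      (congrArg (G.toSSetHom.app (op ⦋k⦌)) ?_)
    exact Prod.ext (map_map X.toSSet x y (collapseHom n i hi)) rfl
  have h₁ : skipHom n i ≫ collapseHom n i hi = 𝟙 _ := skipHom_comp_collapseHom n i hi
  have h₂ : skipHom n (i + 1) ≫ collapseHom n i hi = 𝟙 _ := hom_ext_vtx fun l => by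
    change collapse i (skip (i + 1) l) = l.val
    by_cases hl : l.val < i.val + 1
    · rw [skip_of_lt hl, collapse_of_le (by omega)]
    · rw [skip_of_le (by omega), collapse_of_lt (by omega), Nat.add_sub_cancel]
  have hx (y : ⦋n⦌ ⟶ ⦋n⦌) (hy : y = 𝟙 _) : X.toSSet.map y.op x = x := by
    rw [hy]
    exact map_id_apply X.toSSet x
  have key : Z.Mk θ ({v | v ≤ n + 1} \ {i.val + 1}) := by
    refine mk_diff_swap hZ (u := i.val) ⟨show i.val ≤ n + 1 by omega, by omega, fun _ _ => by omega⟩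
      (show i.val + 1 ≤ n + 1 by omega) (fun _ h => h) (fun R hR hu hv k y hy => ?_) ?_ ?_
    · rw [hθ]
      refine G.map_marked k _ (X.degenerate_subset k (map_mem_degenerate _ _ fun hinj => ?_))
      obtain ⟨u, hu⟩ := hy.ge hu
      obtain ⟨v, hv⟩ := hy.ge hv
      have huv : u = v := by
        apply hinj
        change collapse i (vtx y u) = collapse i (vtx y v)
        rw [hu, hv, collapse_of_le le_rfl, collapse_of_lt (Nat.lt_succ_self _)]
        rfl
      rw [huv] at hu
      omega
    · rw [← vset_skipHom (by omega)]
      refine mk_of_injective (injective_vtx_skipHom n i) ?_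
      rw [hθ]
      refine Set.mem_of_eq_of_mem (congrArg (G.toSSetHom.app (op ⦋n⦌))
        (Prod.ext (hx _ h₁) (funext fun l => ?_))) h
      refine (if_neg (skip_ne i l)).trans (congrArg j ?_)
      exact congrArg (fun y : ⦋n⦌ ⟶ ⦋n⦌ => y.toOrderHom l) h₁
    · by_cases hi0 : i.val = 0
      · exact ⟨0, ⟨Nat.zero_le _, by simp⟩, 2, ⟨show 2 ≤ n + 1 by omega, by simp [hi0]⟩, Nat.zero_ne_add_one 1⟩
      · exact ⟨0, ⟨Nat.zero_le _, by simp⟩, 1, ⟨show 1 ≤ n + 1 by omega, fun h => hi0 (Nat.succ.inj h).symm⟩,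
          Nat.zero_ne_add_one 0⟩
  rw [← vset_skipHom (by omega)] at key
  have := key n _ rfl
  rw [hθ] at this
  refine Set.mem_of_eq_of_mem (congrArg (G.toSSetHom.app (op ⦋n⦌))
    (Prod.ext (hx _ h₂).symm (funext fun l => ?_))) this
  change j' l = ite (skip (i + 1) l = i.val) _ _
  by_cases hl : l = i
  · rw [hl, if_pos (skip_of_lt (Nat.lt_succ_self _))]
  · rw [if_neg, ← hj l hl]
    · exact congrArg j (congrArg (fun y : ⦋n⦌ ⟶ ⦋n⦌ => y.toOrderHom l) h₂.symm)
    · intro h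
      have := Fin.val_ne_of_ne hl
      unfold skip at h
      split_ifs at h <;> omega

theorem mem_marked_of_end (hZ : IsSaturatedComplicial N Z) (G : cyl X interval ⟶ Z) {n : ℕ}
    (x : X.toSSet _⦋n⦌) (h : (cylEnd X false ≫ G).toSSetHom.app (op ⦋n⦌) x ∈ Z.marked n)
    (j : Fin (n + 1) → ULift.{u} Bool) : G.toSSetHom.app (op ⦋n⦌) (x, j) ∈ Z.marked n := by
  have hn := Z.pos_of_mem_marked h
  have key (s : ℕ) (j : Fin (n + 1) → ULift.{u} Bool) (hj : ∀ l, s ≤ l.val → j l = ⟨false⟩) :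
      G.toSSetHom.app (op ⦋n⦌) (x, j) ∈ Z.marked n := by
    induction s generalizing j with
    | zero =>
      obtain rfl : j = fun _ => ⟨false⟩ := funext fun l => hj l (Nat.zero_le _)
      exact h
    | succ s ih =>
      by_cases hs : s < n + 1
      · refine mem_marked_of_eq_off hZ G hn x ⟨s, hs⟩ (Function.update j ⟨s, hs⟩ ⟨false⟩) j
          (fun l hl => Function.update_of_ne hl _ _) (ih _ fun l hl => ?_)
        by_cases hl' : l = ⟨s, hs⟩
        · rw [hl', Function.update_self]
        · rw [Function.update_of_ne hl']
          have := Fin.val_ne_of_ne hl'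
          exact hj l (by simp only at this; omega)
      · exact ih j fun l hl => absurd l.isLt (by omega)
  exact key (n + 1) j fun l hl => absurd l.isLt (by omega)

/-- A map that is an isomorphism on underlying simplicial sets is an acyclic cofibration if every
map to a saturated complicial set extends along it. -/
theorem acyclicCofibration_of_exists_extension (w : X ⟶ Y) [IsIso w.toSSetHom]
    (h : ∀ Z : MSSet.{u}, IsSaturatedComplicial N Z → ∀ g : X ⟶ Z, ∃ g' : Y ⟶ Z, w ≫ g' = g) :
    AcyclicCofibration N w := by
  refine ⟨mono_of_mono_toSSetHom inferInstance, fun Z hZ => ⟨fun g => ?_, fun f g hfg => ?_⟩⟩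
  · obtain ⟨g', rfl⟩ := h Z hZ g
    exact ⟨g', LeftHomotopic.refl _⟩
  · obtain ⟨P, hP, H, h₀, h₁⟩ := hfg
    -- The given homotopy may use any cylinder `P`; lifting against its acyclic fibration replaces
    -- it by the standard one.
    have := hP (cylι X) (inferInstanceAs (Mono (cylι X)))
    have sq : CommSq (cylDesc P.i₀ P.i₁) (cylι X) P.π (cylπ X interval) := ⟨by
      refine hom_ext ?_
      ext n ⟨x, ⟨b⟩⟩
      cases b
      · exact congrArg (fun t : X ⟶ X => t.toSSetHom.app n x) P.i₀_π
      · exact congrArg (fun t : X ⟶ X => t.toSSetHom.app n x) P.i₁_π⟩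
    let G : cyl X interval ⟶ Z := sq.lift ≫ H
    have hG₀ : cylEnd X false ≫ G = w ≫ f := by
      rw [← h₀]
      refine hom_ext ?_
      ext n x
      exact congrArg (fun t : cyl X twoPoints ⟶ P.I => H.toSSetHom.app n
        (t.toSSetHom.app n (x, ⟨false⟩))) sq.fac_left
    have hG₁ : cylEnd X true ≫ G = w ≫ g := by
      rw [← h₁]
      refine hom_ext ?_
      ext n x
      exact congrArg (fun t : cyl X twoPoints ⟶ P.I => H.toSSetHom.app n
        (t.toSSetHom.app n (x, ⟨true⟩))) sq.fac_left
    have he {n : SimplexCategoryᵒᵖ} (y : Y.toSSet.obj n) :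
        w.toSSetHom.app n ((inv w.toSSetHom).app n y) = y :=
      congrArg (fun t : Y.toSSet ⟶ Y.toSSet => t.app n y) (IsIso.inv_hom_id w.toSSetHom)
    refine ⟨precylinder Y, cylπ_mem_rlp Y,
      { toSSetHom := (inv w.toSSetHom ▷ interval) ≫ G.toSSetHom
        map_marked := ?_ }, ?_, ?_⟩
    -- A simplex marked in `Y` need not be marked in `X`. Its image at the first end is marked
    -- because `f` is defined on `Y`, and this marking spreads over the cylinder.
    · rintro n ⟨y, j⟩ hy
      refine mem_marked_of_end hZ G ((inv w.toSSetHom).app (op ⦋n⦌) y) ?_ j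
      rw [hG₀]
      exact f.map_marked n _ (Set.mem_of_eq_of_mem (he y) hy)
    · refine hom_ext ?_
      ext n y
      refine (congrArg (fun t : X ⟶ Z => t.toSSetHom.app n ((inv w.toSSetHom).app n y)) hG₀).trans ?_
      exact congrArg (f.toSSetHom.app n) (he y)
    · refine hom_ext ?_
      ext n y
      refine (congrArg (fun t : X ⟶ Z => t.toSSetHom.app n ((inv w.toSSetHom).app n y)) hG₁).trans ?_
      exact congrArg (g.toSSetHom.app n) (he y)

/-! ### The pushout-tensor -/

instance isIso_toSSetHom {X Y : MSSet.{u}} (w : X ⟶ Y) [IsIso w] : IsIso w.toSSetHom :=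
  ⟨(inv w).toSSetHom, congrArg Hom.toSSetHom (IsIso.hom_inv_id w),
    congrArg Hom.toSSetHom (IsIso.inv_hom_id w)⟩

/-- The explicit pushout has the pushout of underlying simplicial sets below it, so the claim
reduces to isomorphisms being stable under cobase change. -/
instance isIso_toSSetHom_inr {A X Y : MSSet.{u}} (f : A ⟶ X) (g : A ⟶ Y) [IsIso f.toSSetHom] :
    IsIso (pushout.inr f g).toSSetHom := by
  rw [← (isPushout_pushoutObj f g).inr_isoPushout_hom]
  have h₁ : IsIso (pushout.inr f.toSSetHom g.toSSetHom) := inferInstance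
  have h₂ := isIso_toSSetHom (isPushout_pushoutObj f g).isoPushout.hom
  exact @IsIso.comp_isIso _ _ _ _ _ _ _ h₁ h₂

instance isIso_toSSetHom_tensorMap (a : ℕ) (B : MSSet.{u}) :
    IsIso (tensorMap (leftSaturationExtension a) (𝟙 B)).toSSetHom :=
  inferInstanceAs (IsIso (𝟙 (joinThree.{u} a ⊗ B.toSSet)))

theorem inr_pushoutTensor {I J A B : MSSet.{u}} (i : I ⟶ J) (b : A ⟶ B) :
    (pushout.inr (tensorMap i (𝟙 A)) (tensorMap (𝟙 I) b)).toSSetHom ≫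
      (pushoutTensor i b).toSSetHom = (tensorMap i (𝟙 B)).toSSetHom :=
  congrArg Hom.toSSetHom (pushout.inr_desc (tensorMap (𝟙 J) b) (tensorMap i (𝟙 B)) rfl)

end MSSet

theorem mainTheorem5 (m a : ℕ) :
    MSSet.AcyclicCofibration.{u} ⊤
      (MSSet.pushoutTensor (MSSet.leftSaturationExtension a) (MSSet.boundaryInclusion m)) := by
  have hw := MSSet.inr_pushoutTensor.{u} (MSSet.leftSaturationExtension a)
    (MSSet.boundaryInclusion m)
  have : IsIso (MSSet.pushoutTensor (MSSet.leftSaturationExtension.{u} a)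
      (MSSet.boundaryInclusion m)).toSSetHom :=
    IsIso.of_isIso_fac_left hw
  refine MSSet.acyclicCofibration_of_exists_extension _ fun Z hZ g => ?_
  obtain ⟨f', hf'⟩ := MSSet.exists_extension_tensor (pushout.inr _ _ ≫ g) hZ
  refine ⟨f', MSSet.hom_ext ?_⟩
  -- Both maps have underlying simplicial maps on the pushout, where the inclusion of the second
  -- summand is an isomorphism; agreement on that summand is enough.
  rw [← cancel_epi (pushout.inr (MSSet.tensorMap (MSSet.leftSaturationExtension.{u} a) (𝟙 _))
    (MSSet.tensorMap (𝟙 _) (MSSet.boundaryInclusion m))).toSSetHom]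
  exact ((Category.assoc _ _ _).symm.trans (congrArg (· ≫ f'.toSSetHom) hw)).trans
    (congrArg MSSet.Hom.toSSetHom hf')
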